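/- All graphs are simple. Let $G$ be a graph containing a triangle $\{v_1,v_2,v_3\}$ and an edge $\{v_2,v_4\}$ with $v_1,v_2,v_3,v_4$ distinct. The corresponding \emph{double triangle expansion} of $G$ is obtained by deleting the edges $\{v_1,v_3\}$ and $\{v_2,v_4\}$ and adding a new vertex adjacent to exactly $v_1,v_2,v_3,v_4$. A \emph{$K_5$ descendant} is a graph that is isomorphic to one obtained from $K_5$ by finitely many (possibly zero) double triangle expansions. The \emph{level} of a finite graph is its number of vertices minus its number of triangles. For $n\ge 0$ let $Z_n^*$ (the zigzag with $n$ triangles) be the graph on $\{1,\dots,n+2\}$ in which $i,j$ are adjacent if and only if $|i-j|\in\{1,2\}$ (so $Z_0^*$ is a single edge); its ends are $1$ and $n+2$. For $z_1,z_2\ge 1$ and $z_3\ge 0$ let $C(z_1,z_2,z_3)$ be the closed chain obtained from disjoint copies of $Z_{z_1}^*,Z_{z_2}^*,Z_{z_3}^*$ by identifying, for each $i\in\{1,2,3\}$ (indices modulo $3$), the last end of $Z_{z_i}^*$ with the first end of $Z_{z_{i+1}}^*$. Thus $C(z_1,z_2,0)$ is the open chain of the two zigzags $Z_{z_1}^*,Z_{z_2}^*$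 (glued at one end) together with an edge joining its two free ends. Let $a_i$ and $b_i$ denote the vertices $2$ and $z_i+1$ of the copy of $Z_{z_i}^*$. Let \[ A(z_1,z_2,z_3)=C(z_1,z_2,z_3)+\{a_1b_2,\;a_2a_3,\;b_1b_3\},\qquad B(z_1,z_2,z_3)=C(z_1,z_2,z_3)+\{a_1b_2,\;a_2b_3,\;a_3b_1\}. \] \textbf{Proposition.} (i) A graph is a $K_5$ descendant of level $3$ if and only if it is isomorphic to $A(z_1,z_2,z_3)$ for some integers $z_1,z_2\ge 3$, $z_3\ge 0$, or to $B(z_1,z_2,z_3)$ for some integers $z_1,z_2,z_3\ge 3$. (For $z_3\ge1$ these are completed closed chains of three zigzags; for $z_3=0$, completed open chains of two zigzags.) (ii) The generating function of the number of isomorphism classes of level $3$ $K_5$ descendants, counted by their number of vertices, is \[ \frac{x^9(1+x^2)}{(1-x)^3(1+x+x^2)}. \] -/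

import Mathlib

universe u

namespace DoubleTriangle

/-- The double triangle expansion of `G` at the triangle `{v₁, v₂, v₃}` and the edge `{v₂, v₄}`: the
edges `{v₁, v₃}` and `{v₂, v₄}` are subdivided and the two new vertices are identified (to `none`). -/
def expansion {V : Type u} (G : SimpleGraph V) (v₁ v₂ v₃ v₄ : V) : SimpleGraph (Option V) :=
  (G.deleteEdges {s(v₁, v₃), s(v₂, v₄)}).map some ⊔
    (SimpleGraph.edge none (some v₁) ⊔ SimpleGraph.edge none (some v₂) ⊔
      SimpleGraph.edge none (some v₃) ⊔ SimpleGraph.edge none (some v₄))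

/-- `H` is (isomorphic to) a double triangle expansion of `G`. -/
def IsChild {V W : Type u} (G : SimpleGraph V) (H : SimpleGraph W) : Prop :=
  ∃ v₁ v₂ v₃ v₄ : V, G.Adj v₁ v₂ ∧ G.Adj v₂ v₃ ∧ G.Adj v₁ v₃ ∧
    G.Adj v₂ v₄ ∧ v₄ ≠ v₁ ∧ v₄ ≠ v₃ ∧ Nonempty (H ≃g expansion G v₁ v₂ v₃ v₄)

/-- The graphs obtained, up to isomorphism, from the complete graph on five vertices by
finitely many (possibly zero) double triangle expansions. -/
inductive IsK5Descendant : ∀ {V : Type u}, SimpleGraph V → Prop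
  | complete {V : Type u} (hV : Nat.card V = 5) : IsK5Descendant (⊤ : SimpleGraph V)
  | child {V W : Type u} {G : SimpleGraph V} {H : SimpleGraph W} (hG : IsK5Descendant G)
      (hGH : IsChild G H) : IsK5Descendant H

/-- The level of a (finite) graph: its number of vertices minus its number of triangles. -/
noncomputable def level {V : Type u} (G : SimpleGraph V) : ℤ :=
  (Nat.card V : ℤ) - ({t : Finset V | G.IsNClique 3 t}.ncard : ℤ)

/-- Isomorphism of graphs on a given vertex set. -/
def isoSetoid (V : Type u) : Setoid (SimpleGraph V) where
  r G H := Nonempty (G ≃g H)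
  iseqv := ⟨fun _ => ⟨SimpleGraph.Iso.refl⟩, fun ⟨e⟩ => ⟨e.symm⟩, fun ⟨e⟩ ⟨f⟩ => ⟨e.trans f⟩⟩

/-- The number of unlabelled graphs (isomorphism classes) on `n` vertices that are
`K₅` descendants of level `L`. -/
noncomputable def numDescendants (L : ℤ) (n : ℕ) : ℕ :=
  (Quotient.mk (isoSetoid (Fin n)) '' {G | IsK5Descendant G ∧ level G = L}).ncard

/-- The zigzag `Z_n^*` with `n` triangles, on the vertices `0, …, n + 1`. For `n = 0` it is a
single edge. -/
def zigzag (n : ℕ) : SimpleGraph (Fin (n + 2)) :=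
  SimpleGraph.fromRel fun i j => j.val = i.val + 1 ∨ j.val = i.val + 2

/-- The vertices of a closed chain of `k` zigzags, the `i`-th one with `z i` triangles: the last
vertex of each zigzag is left out, since it is the first vertex of the (cyclically) next one. -/
abbrev ChainVertex {k : ℕ} (z : Fin k → ℕ) : Type := Σ i : Fin k, Fin (z i + 1)

/-- The vertex of the closed chain that is the `j`-th vertex of the `i`-th zigzag. -/
def chainVertex {k : ℕ} [NeZero k] (z : Fin k → ℕ) (i : Fin k) (j : Fin (z i + 2)) :
    ChainVertex z :=
  if h : j.val < z i + 1 then ⟨i, ⟨j.val, h⟩⟩ else ⟨i + 1, 0⟩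

/-- The closed `(z 0, …, z (k - 1))`-chain, for `k ≥ 2`: the last end vertex of each zigzag is
identified with the first end vertex of the next one, cyclically.

For `k = 3` and `z 2 = 0` this is the open `(z 0, z 1)`-chain together with an edge that joins
its two free end vertices. -/
def closedChain {k : ℕ} [NeZero k] (z : Fin k → ℕ) : SimpleGraph (ChainVertex z) :=
  ⨆ i : Fin k, (zigzag (z i)).map (chainVertex z i)

/-- The second vertex of the `i`-th zigzag: its chord vertex next to its first end. (For `z i = 1`
it is the middle vertex of the triangle, for `z i = 0` the last end of the edge.) -/
def firstChord {k : ℕ} [NeZero k] (z : Fin k → ℕ) (i : Fin k) : ChainVertex z :=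
  chainVertex z i 1

/-- The last but one vertex of the `i`-th zigzag: its chord vertex next to its last end. (For
`z i = 1` it is the middle vertex of the triangle, for `z i = 0` the first end of the edge.) -/
def lastChord {k : ℕ} [NeZero k] (z : Fin k → ℕ) (i : Fin k) : ChainVertex z :=
  chainVertex z i ⟨z i, by omega⟩

/-- The less symmetric completion of a closed chain of three zigzags, in which the last zigzag
is distinguished. -/
def templateA (z : Fin 3 → ℕ) : SimpleGraph (ChainVertex z) :=
  closedChain z ⊔ (SimpleGraph.edge (firstChord z 0) (lastChord z 1) ⊔
    SimpleGraph.edge (firstChord z 1) (firstChord z 2) ⊔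
    SimpleGraph.edge (lastChord z 0) (lastChord z 2))

/-- The rotationally symmetric completion of a closed chain of three zigzags. -/
def templateB (z : Fin 3 → ℕ) : SimpleGraph (ChainVertex z) :=
  closedChain z ⊔ ⨆ i : Fin 3, SimpleGraph.edge (firstChord z i) (lastChord z (i + 1))

end DoubleTriangle

/-!
A double triangle expansion adds one vertex and never adds more than one triangle: sending
the new vertex to `v₂` maps the triangles, except the two new ones on `v₁v₂` and `v₂v₃`, injectively
to old ones other than `{v₁, v₂, v₃}`. Hence the level never decreases, and every further
triangle on `v₁v₃`, as well as every triangle on `v₂v₄` that avoids `v₁` and `v₃`, makes it grow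
(`ncard_triangles_expansion_add_le`). To find the descendants of level three, it is therefore
enough to follow the expansions that stay below level four.

These run through three families of graphs, each described by labelling the vertices `0, …, N - 1`
along a closed chain of zigzags (`relC`, `relD`, `relE`): the squares of cycles, among them `K₅`
and the octahedron; the completed chains of two zigzags, of level two; and the completed chains of
three zigzags, of level three. Expanding at a triangle with `v₂` in its middle along the chain only
lengthens the zigzag. Expanding with `v₂` first or last in the triangle splits a zigzag with three
triangles off the end of a zigzag, or raises the level too much, or, for a middle zigzag with
exactly two triangles, exchanges the roles of its two chord vertices and so leads from the `A` to
the `B` templates. The case analysis is in `relC_child`, `relD_child` and `relE_child`, with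
symmetries of the chain (`relE_reverse`, `relD_rotate`, `relC_rotate`) moving the triangle to a
standard place; `IsK5Descendant.classification` collects it. Conversely, the same expansions
produce all members of the families (`isDescendantShape_relE`), and `templateA_iso` and
`templateB_iso` identify the third family with the templates.

For the count, the zigzags with at least three triangles are recovered from the graph as its maximal
zigzags (`IsFullZigzag.exists_segment`), since an edge in two triangles joins consecutive vertices
inside a zigzag. Two zigzags with a common end are recorded by `Facing`, together with the adjacency
of their chord vertices at the far ends. In an `A` template these are adjacent only for the two
zigzags that are not distinguished, in a `B` template for all pairs. So the isomorphism class
determines the kind of template and the unordered pair, respectively triple, of numbers of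
triangles (`formA_injective`, `formB_injective`, `formA_not_iso_formB`), and the reversal
and the rotation of the chain give all the required isomorphisms. With `c n = (n - 3) / 2 - 2` pairs
`3 ≤ x ≤ y` such that `x + y + 3 = n`, the numbers `a n` and `b n` of classes with `n` vertices
satisfy `a (n + 1) = a n + c (n + 1)` and `b (n + 3) = b n + c n`, which gives the generating
function.
-/

universe v w

namespace DoubleTriangle

/-! ### Double triangle expansions up to isomorphism -/

section Expansion

variable {V : Type u} {W : Type v}

theorem expansion_adj_some_some (G : SimpleGraph V) (v₁ v₂ v₃ v₄ x y : V) :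
    (expansion G v₁ v₂ v₃ v₄).Adj (some x) (some y) ↔
      G.Adj x y ∧ s(x, y) ≠ s(v₁, v₃) ∧ s(x, y) ≠ s(v₂, v₄) := by
  have h := SimpleGraph.map_adj_apply (f := Function.Embedding.some)
    (G := G.deleteEdges {s(v₁, v₃), s(v₂, v₄)}) (a := x) (b := y)
  change ((G.deleteEdges {s(v₁, v₃), s(v₂, v₄)}).map some).Adj (some x) (some y) ↔ _ at h
  simp [expansion, SimpleGraph.edge_adj, h]

theorem expansion_adj_none_some (G : SimpleGraph V) (v₁ v₂ v₃ v₄ x : V) :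
    (expansion G v₁ v₂ v₃ v₄).Adj none (some x) ↔ x = v₁ ∨ x = v₂ ∨ x = v₃ ∨ x = v₄ := by
  have h : ¬((G.deleteEdges {s(v₁, v₃), s(v₂, v₄)}).map some).Adj none (some x) := by
    rintro ⟨-, a, b, -, hab, -⟩
    exact Option.some_ne_none a hab
  simp [expansion, SimpleGraph.edge_adj, h, eq_comm, or_assoc]

theorem expansion_adj_some_none (G : SimpleGraph V) (v₁ v₂ v₃ v₄ x : V) :
    (expansion G v₁ v₂ v₃ v₄).Adj (some x) none ↔ x = v₁ ∨ x = v₂ ∨ x = v₃ ∨ x = v₄ := by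
  rw [SimpleGraph.adj_comm, expansion_adj_none_some]

/-- The vertices `v₁` and `v₃` play the same role in an expansion. -/
theorem expansion_swap (G : SimpleGraph V) (v₁ v₂ v₃ v₄ : V) :
    expansion G v₁ v₂ v₃ v₄ = expansion G v₃ v₂ v₁ v₄ := by
  have h : s(v₁, v₃) = s(v₃, v₁) := Sym2.eq_swap
  unfold expansion
  rw [h]
  ac_rfl

/-- Double triangle expansion commutes with isomorphisms. -/
theorem expansion_congr {G : SimpleGraph V} {G' : SimpleGraph W} (e : G ≃g G')
    (v₁ v₂ v₃ v₄ : V) :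
    Nonempty (expansion G v₁ v₂ v₃ v₄ ≃g expansion G' (e v₁) (e v₂) (e v₃) (e v₄)) := by
  have hs : ∀ a b c d : V, s(e a, e b) = s(e c, e d) ↔ s(a, b) = s(c, d) := fun a b c d => by
    simp
  refine ⟨⟨Equiv.optionCongr e.toEquiv, ?_⟩⟩
  rintro (_ | x) (_ | y)
  · simp
  · simp [expansion_adj_none_some]
  · simp [expansion_adj_some_none]
  · simp only [Equiv.optionCongr_apply, Option.map_some, expansion_adj_some_some]
    exact and_congr (e.map_adj_iff) (and_congr (not_congr (hs ..)) (not_congr (hs ..)))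

/-- The vertices where a double triangle expansion of `G` can be performed. -/
structure IsSite (G : SimpleGraph V) (v₁ v₂ v₃ v₄ : V) : Prop where
  adj₁₂ : G.Adj v₁ v₂
  adj₂₃ : G.Adj v₂ v₃
  adj₁₃ : G.Adj v₁ v₃
  adj₂₄ : G.Adj v₂ v₄
  ne₄₁ : v₄ ≠ v₁
  ne₄₃ : v₄ ≠ v₃

theorem IsSite.swap {G : SimpleGraph V} {v₁ v₂ v₃ v₄ : V} (h : IsSite G v₁ v₂ v₃ v₄) :
    IsSite G v₃ v₂ v₁ v₄ :=
  ⟨h.adj₂₃.symm, h.adj₁₂.symm, h.adj₁₃.symm, h.adj₂₄, h.ne₄₃, h.ne₄₁⟩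

theorem IsSite.map {G : SimpleGraph V} {G' : SimpleGraph W} (e : G ≃g G') {v₁ v₂ v₃ v₄ : V}
    (h : IsSite G v₁ v₂ v₃ v₄) : IsSite G' (e v₁) (e v₂) (e v₃) (e v₄) :=
  ⟨e.map_adj_iff.2 h.adj₁₂, e.map_adj_iff.2 h.adj₂₃, e.map_adj_iff.2 h.adj₁₃,
    e.map_adj_iff.2 h.adj₂₄, fun h' => h.ne₄₁ (e.injective h'), fun h' => h.ne₄₃ (e.injective h')⟩

theorem isChild_iff {W : Type u} {G : SimpleGraph V} {H : SimpleGraph W} :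
    IsChild G H ↔ ∃ v₁ v₂ v₃ v₄ : V, IsSite G v₁ v₂ v₃ v₄ ∧
      Nonempty (H ≃g expansion G v₁ v₂ v₃ v₄) := by
  constructor
  · rintro ⟨v₁, v₂, v₃, v₄, h12, h23, h13, h24, h41, h43, f⟩
    exact ⟨v₁, v₂, v₃, v₄, ⟨h12, h23, h13, h24, h41, h43⟩, f⟩
  · rintro ⟨v₁, v₂, v₃, v₄, ⟨h12, h23, h13, h24, h41, h43⟩, f⟩
    exact ⟨v₁, v₂, v₃, v₄, h12, h23, h13, h24, h41, h43, f⟩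

/-- All isomorphic copies of `G` in the universe `u` are `K₅` descendants. This allows working with
graphs on `Fin N` whatever the universe. -/
def IsDescendantShape (G : SimpleGraph W) : Prop :=
  ∀ (V : Type u) (H : SimpleGraph V), Nonempty (H ≃g G) → IsK5Descendant H

theorem IsDescendantShape.expansion {N : ℕ} {U : Type w} {G : SimpleGraph (Fin N)}
    {G' : SimpleGraph U} (h : IsDescendantShape.{u} G) {v₁ v₂ v₃ v₄ : Fin N}
    (hv : IsSite G v₁ v₂ v₃ v₄) (e : Nonempty (expansion G v₁ v₂ v₃ v₄ ≃g G')) :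
    IsDescendantShape.{u} G' := by
  rintro V H ⟨f⟩
  obtain ⟨e⟩ := e
  let i : (ULift.{u} (Fin N)) ≃ Fin N := Equiv.ulift
  let j : G.comap i ≃g G := SimpleGraph.Iso.comap i G
  have hd : IsK5Descendant (G.comap i) := h _ _ ⟨j⟩
  have hv' := hv.map j.symm
  refine .child hd (isChild_iff.2 ⟨_, _, _, _, hv', ?_⟩)
  obtain ⟨k⟩ := expansion_congr j.symm v₁ v₂ v₃ v₄
  exact ⟨(f.trans e.symm).trans k⟩

end Expansion

/-! ### The level under expansion -/

section Level

variable {V : Type u} {W : Type v}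

/-- The triangles of a graph. -/
abbrev triangles (G : SimpleGraph V) : Set (Finset V) := {t | G.IsNClique 3 t}

theorem ncard_triangles_eq_of_iso {G : SimpleGraph V} {H : SimpleGraph W} (e : G ≃g H) :
    (triangles G).ncard = (triangles H).ncard := by
  have key : ∀ {V : Type u} {W : Type v} {G : SimpleGraph V} {H : SimpleGraph W} (e : G ≃g H)
      (t : Finset V), G.IsNClique 3 t ↔ H.IsNClique 3 (t.map e.toEquiv.toEmbedding) := by
    intro V W G H e t
    rw [SimpleGraph.isNClique_iff, SimpleGraph.isNClique_iff, Finset.card_map]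
    refine and_congr_left fun _ => ?_
    rw [Finset.coe_map, SimpleGraph.isClique_iff, SimpleGraph.isClique_iff]
    change _ ↔ (e '' (t : Set V)).Pairwise H.Adj
    rw [e.injective.injOn.pairwise_image]
    exact forall₅_congr fun a _ b _ _ => e.map_adj_iff.symm
  refine Set.ncard_congr (fun t _ => t.map e.toEquiv.toEmbedding) (fun t ht => (key e t).1 ht)
    (fun a b _ _ h => Finset.map_injective _ h) fun t ht => ?_
  have ht' : (t.map e.symm.toEquiv.toEmbedding).map e.toEquiv.toEmbedding = t := by
    rw [Finset.map_map]
    convert Finset.map_refl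
    ext x
    exact e.apply_symm_apply x
  exact ⟨t.map e.symm.toEquiv.toEmbedding, (key e _).2 (by rw [ht']; exact ht), ht'⟩

theorem level_eq_of_iso {G : SimpleGraph V} {H : SimpleGraph W} (e : G ≃g H) :
    level G = level H := by
  unfold level
  rw [Nat.card_congr e.toEquiv, ncard_triangles_eq_of_iso e]

open Classical in
/-- Sending the new vertex to `v₂` maps the triangles of the expansion, up to the two on the edges
`{v₁, v₂}` and `{v₂, v₃}`, injectively to those triangles of `G` that are not destroyed. -/
theorem ncard_triangles_expansion_add_le [Finite V] {G : SimpleGraph V} {v₁ v₂ v₃ v₄ : V}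
    (hv : IsSite G v₁ v₂ v₃ v₄) {R : Finset (Finset V)} (hR : ∀ t ∈ R, G.IsNClique 3 t ∧
      ((v₁ ∈ t ∧ v₃ ∈ t) ∨ (v₂ ∈ t ∧ v₄ ∈ t ∧ v₁ ∉ t ∧ v₃ ∉ t))) :
    (triangles (expansion G v₁ v₂ v₃ v₄)).ncard + R.card ≤ (triangles G).ncard + 2 := by
  have h12 := hv.adj₁₂.ne
  have h23 := hv.adj₂₃.ne
  have h13 := hv.adj₁₃.ne
  have h24 := hv.adj₂₄.ne
  have h41 := hv.ne₄₁
  have h43 := hv.ne₄₃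
  let φ : Finset (Option V) → Finset V := fun t => t.image fun o => o.getD v₂
  let E : Set (Finset (Option V)) := {{none, some v₁, some v₂}, {none, some v₂, some v₃}}
  -- the two kinds of triangles of the expansion outside `E`
  have kinds : ∀ t ∈ triangles (expansion G v₁ v₂ v₃ v₄) \ E,
      (∃ a b c, t = {some a, some b, some c} ∧ φ t = {a, b, c} ∧ G.IsNClique 3 {a, b, c} ∧
        ¬ (v₁ ∈ φ t ∧ v₃ ∈ φ t) ∧ ¬ (v₂ ∈ φ t ∧ v₄ ∈ φ t)) ∨
      (t = {none, some v₁, some v₄} ∧ φ t = {v₂, v₁, v₄} ∧ G.IsNClique 3 {v₂, v₁, v₄}) ∨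
      (t = {none, some v₃, some v₄} ∧ φ t = {v₂, v₃, v₄} ∧ G.IsNClique 3 {v₂, v₃, v₄}) := by
    rintro t ⟨ht, htE⟩
    have hnone : ∀ a b : V, (expansion G v₁ v₂ v₃ v₄).Adj none (some a) →
        (expansion G v₁ v₂ v₃ v₄).Adj none (some b) →
        (expansion G v₁ v₂ v₃ v₄).Adj (some a) (some b) → t = {none, some a, some b} →
        (t = {none, some v₁, some v₄} ∧ G.Adj v₁ v₄) ∨
        (t = {none, some v₃, some v₄} ∧ G.Adj v₃ v₄) := by
      intro a b ha hb hab hteq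
      rw [expansion_adj_none_some] at ha hb
      rw [expansion_adj_some_some] at hab
      obtain ⟨hab, hd1, hd2⟩ := hab
      have hE : t ≠ {none, some v₁, some v₂} ∧ t ≠ {none, some v₂, some v₃} := by
        simpa [E] using htE
      have hab' := hab.ne
      have hteq' : t = {none, some b, some a} := by rw [hteq, Finset.pair_comm]
      rcases ha with rfl | rfl | rfl | rfl <;> rcases hb with rfl | rfl | rfl | rfl <;>
        first
        | exact absurd rfl hab'
        | exact absurd rfl hd1
        | exact absurd rfl hd2
        | exact absurd Sym2.eq_swap hd1
        | exact absurd Sym2.eq_swap hd2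
        | exact absurd hteq hE.1
        | exact absurd hteq hE.2
        | exact absurd hteq' hE.1
        | exact absurd hteq' hE.2
        | exact Or.inl ⟨hteq, hab⟩
        | exact Or.inr ⟨hteq, hab⟩
        | exact Or.inl ⟨hteq', hab.symm⟩
        | exact Or.inr ⟨hteq', hab.symm⟩
    have fin : ((t = {none, some v₁, some v₄} ∧ G.Adj v₁ v₄) ∨
        (t = {none, some v₃, some v₄} ∧ G.Adj v₃ v₄)) →
        (t = {none, some v₁, some v₄} ∧ φ t = {v₂, v₁, v₄} ∧ G.IsNClique 3 {v₂, v₁, v₄}) ∨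
        (t = {none, some v₃, some v₄} ∧ φ t = {v₂, v₃, v₄} ∧ G.IsNClique 3 {v₂, v₃, v₄}) := by
      rintro (⟨rfl, h⟩ | ⟨rfl, h⟩)
      · exact Or.inl ⟨rfl, by simp [φ, Finset.image_insert],
          SimpleGraph.is3Clique_triple_iff.2 ⟨hv.adj₁₂.symm, hv.adj₂₄, h⟩⟩
      · exact Or.inr ⟨rfl, by simp [φ, Finset.image_insert],
          SimpleGraph.is3Clique_triple_iff.2 ⟨hv.adj₂₃, hv.adj₂₄, h⟩⟩
    obtain ⟨x, y, z, hxy, hxz, hyz, hteq⟩ := SimpleGraph.is3Clique_iff.1 ht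
    rcases x with _ | a <;> rcases y with _ | b <;> rcases z with _ | c
    · exact absurd rfl hxy.ne
    · exact absurd rfl hxy.ne
    · exact absurd rfl hxz.ne
    · exact Or.inr (fin (hnone b c hxy hxz hyz hteq))
    · exact absurd rfl hyz.ne
    · exact Or.inr (fin (hnone a c hxy.symm hyz hxz (by rw [hteq, Finset.insert_comm])))
    · exact Or.inr (fin (hnone a b hxz.symm hyz.symm hxy (by
        rw [hteq]; ext o; simp; tauto)))
    · left
      rw [expansion_adj_some_some] at hxy hxz hyz
      have hφ : φ t = {a, b, c} := by simp [φ, hteq, Finset.image_insert]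
      refine ⟨a, b, c, hteq, hφ, SimpleGraph.is3Clique_triple_iff.2 ⟨hxy.1, hxz.1, hyz.1⟩, ?_, ?_⟩
      · rw [hφ]
        simp only [Finset.mem_insert, Finset.mem_singleton]
        grind
      · rw [hφ]
        simp only [Finset.mem_insert, Finset.mem_singleton]
        grind
  have hmaps : ∀ t ∈ triangles (expansion G v₁ v₂ v₃ v₄) \ E, φ t ∈ triangles G \ (R : Set _) := by
    intro t ht
    rcases kinds t ht with ⟨a, b, c, -, hφ, hc, h1, h2⟩ | ⟨-, hφ, hc⟩ | ⟨-, hφ, hc⟩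
    · refine ⟨by rw [hφ]; exact hc, fun hmem => ?_⟩
      rcases (hR _ hmem).2 with h | h
      · exact h1 h
      · exact h2 ⟨h.1, h.2.1⟩
    · refine ⟨by rw [hφ]; exact hc, fun hmem => ?_⟩
      have := (hR _ hmem).2
      rw [hφ] at this
      simp only [Finset.mem_insert, Finset.mem_singleton] at this
      grind
    · refine ⟨by rw [hφ]; exact hc, fun hmem => ?_⟩
      have := (hR _ hmem).2
      rw [hφ] at this
      simp only [Finset.mem_insert, Finset.mem_singleton] at this
      grind
  have hinj : Set.InjOn φ (triangles (expansion G v₁ v₂ v₃ v₄) \ E) := by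
    intro t ht t' ht' h
    rcases kinds t ht with ⟨a, b, c, h0, hφ, -, h1, h2⟩ | ⟨h0, hφ, -⟩ | ⟨h0, hφ, -⟩ <;>
    rcases kinds t' ht' with ⟨a', b', c', h0', hφ', -, h1', h2'⟩ | ⟨h0', hφ', -⟩ | ⟨h0', hφ', -⟩
    · rw [h, hφ'] at hφ
      have : t = ({a, b, c} : Finset V).image some := by rw [h0]; simp [Finset.image_insert]
      rw [this, ← hφ, h0']
      simp [Finset.image_insert]
    · exact absurd (by rw [h, hφ']; simp) h2
    · exact absurd (by rw [h, hφ']; simp) h2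
    · exact absurd (by rw [← h, hφ]; simp) h2'
    · rw [h0, h0']
    · have : v₁ ∈ φ t' := by rw [← h, hφ]; simp
      rw [hφ'] at this
      simp only [Finset.mem_insert, Finset.mem_singleton] at this
      grind
    · exact absurd (by rw [← h, hφ]; simp) h2'
    · have : v₁ ∈ φ t := by rw [h, hφ']; simp
      rw [hφ] at this
      simp only [Finset.mem_insert, Finset.mem_singleton] at this
      grind
    · rw [h0, h0']
  have hRsub : (R : Set (Finset V)) ⊆ triangles G := fun t ht => (hR t ht).1
  have hle := Set.ncard_le_ncard_of_injOn φ hmaps hinj (Set.toFinite _)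
  have hR' := Set.ncard_sdiff_add_ncard_of_subset hRsub (Set.toFinite _)
  have hE' := Set.ncard_le_ncard_sdiff_add_ncard (triangles (expansion G v₁ v₂ v₃ v₄)) E
    (Set.toFinite _)
  have hE2 : E.ncard ≤ 2 := (Set.ncard_insert_le _ _).trans (by simp)
  rw [Set.ncard_coe_finset] at hR'
  omega

/-- `R` is a set of triangles of `G` that contain one of the deleted edges. The triangles
`{v₁, v₂, v₄}` and `{v₂, v₃, v₄}` are excluded, as they reappear with the new vertex in place of
`v₂`. -/
theorem level_add_le_level_expansion [Finite V] {G : SimpleGraph V} {v₁ v₂ v₃ v₄ : V}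
    (hv : IsSite G v₁ v₂ v₃ v₄) {R : Finset (Finset V)} (hR : ∀ t ∈ R, G.IsNClique 3 t ∧
      ((v₁ ∈ t ∧ v₃ ∈ t) ∨ (v₂ ∈ t ∧ v₄ ∈ t ∧ v₁ ∉ t ∧ v₃ ∉ t))) :
    level G + R.card ≤ level (expansion G v₁ v₂ v₃ v₄) + 1 := by
  have h := ncard_triangles_expansion_add_le hv hR
  have hc : Nat.card (Option V) = Nat.card V + 1 := Finite.card_option
  unfold level
  rw [hc]
  push_cast
  simp only [triangles] at h
  omega

/-- The triangle `{v₁, v₂, v₃}` makes up for the new one. -/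
theorem level_le_level_expansion [Finite V] {G : SimpleGraph V} {v₁ v₂ v₃ v₄ : V}
    (hv : IsSite G v₁ v₂ v₃ v₄) : level G ≤ level (expansion G v₁ v₂ v₃ v₄) := by
  classical
  have := level_add_le_level_expansion hv (R := {{v₁, v₂, v₃}}) (by
    simp only [Finset.mem_singleton]
    rintro t rfl
    exact ⟨SimpleGraph.is3Clique_triple_iff.2 ⟨hv.adj₁₂, hv.adj₁₃, hv.adj₂₃⟩, by simp⟩)
  simp at this
  exact this

theorem level_add_one_le_of_common_neighbor₁₃ [Finite V] {G : SimpleGraph V} {v₁ v₂ v₃ v₄ x : V}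
    (hv : IsSite G v₁ v₂ v₃ v₄) (hx : x ≠ v₂) (h1 : G.Adj x v₁) (h3 : G.Adj x v₃) :
    level G + 1 ≤ level (expansion G v₁ v₂ v₃ v₄) := by
  classical
  have := level_add_le_level_expansion hv (R := {{v₁, v₂, v₃}, {v₁, x, v₃}}) (by
    simp only [Finset.mem_insert, Finset.mem_singleton]
    rintro t (rfl | rfl)
    · exact ⟨SimpleGraph.is3Clique_triple_iff.2 ⟨hv.adj₁₂, hv.adj₁₃, hv.adj₂₃⟩, by simp⟩
    · exact ⟨SimpleGraph.is3Clique_triple_iff.2 ⟨h1.symm, hv.adj₁₃, h3⟩, by simp⟩)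
  rw [Finset.card_pair] at this
  · push_cast at this
    omega
  · intro h
    have : x ∈ ({v₁, v₂, v₃} : Finset V) := by rw [h]; simp
    simp [hx, h1.ne, h3.ne] at this

theorem level_add_one_le_of_common_neighbor₂₄ [Finite V] {G : SimpleGraph V} {v₁ v₂ v₃ v₄ w : V}
    (hv : IsSite G v₁ v₂ v₃ v₄) (hw1 : w ≠ v₁) (hw3 : w ≠ v₃) (h2 : G.Adj w v₂)
    (h4 : G.Adj w v₄) : level G + 1 ≤ level (expansion G v₁ v₂ v₃ v₄) := by
  classical
  have h12 := hv.adj₁₂.ne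
  have h23 := hv.adj₂₃.ne
  have h41 := hv.ne₄₁
  have h43 := hv.ne₄₃
  have := level_add_le_level_expansion hv (R := {{v₁, v₂, v₃}, {v₂, w, v₄}}) (by
    simp only [Finset.mem_insert, Finset.mem_singleton]
    rintro t (rfl | rfl)
    · exact ⟨SimpleGraph.is3Clique_triple_iff.2 ⟨hv.adj₁₂, hv.adj₁₃, hv.adj₂₃⟩, by simp⟩
    · exact ⟨SimpleGraph.is3Clique_triple_iff.2 ⟨h2.symm, hv.adj₂₄, h4⟩, by
        simp [hw1.symm, hw3.symm, h12, h23.symm, h41.symm, h43.symm]⟩)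
  rw [Finset.card_pair] at this
  · push_cast at this
    omega
  · intro h
    have : w ∈ ({v₁, v₂, v₃} : Finset V) := by rw [h]; simp
    simp [hw1, hw3, h2.ne] at this

theorem level_add_two_le_of_common_neighbors [Finite V] {G : SimpleGraph V} {v₁ v₂ v₃ v₄ w x : V}
    (hv : IsSite G v₁ v₂ v₃ v₄) (hx : x ≠ v₂) (h1 : G.Adj x v₁) (h3 : G.Adj x v₃)
    (hw1 : w ≠ v₁) (hw3 : w ≠ v₃) (h2 : G.Adj w v₂)
    (h4 : G.Adj w v₄) : level G + 2 ≤ level (expansion G v₁ v₂ v₃ v₄) := by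
  classical
  have h12 := hv.adj₁₂.ne
  have h23 := hv.adj₂₃.ne
  have h41 := hv.ne₄₁
  have h43 := hv.ne₄₃
  have := level_add_le_level_expansion hv (R := {{v₁, v₂, v₃}, {v₁, x, v₃}, {v₂, w, v₄}}) (by
    simp only [Finset.mem_insert, Finset.mem_singleton]
    rintro t (rfl | rfl | rfl)
    · exact ⟨SimpleGraph.is3Clique_triple_iff.2 ⟨hv.adj₁₂, hv.adj₁₃, hv.adj₂₃⟩, by simp⟩
    · exact ⟨SimpleGraph.is3Clique_triple_iff.2 ⟨h1.symm, hv.adj₁₃, h3⟩, by simp⟩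
    · exact ⟨SimpleGraph.is3Clique_triple_iff.2 ⟨h2.symm, hv.adj₂₄, h4⟩, by
        simp [hw1.symm, hw3.symm, h12, h23.symm, h41.symm, h43.symm]⟩)
  rw [Finset.card_insert_of_notMem, Finset.card_pair] at this
  · push_cast at this
    omega
  · intro h
    have : v₁ ∈ ({v₂, w, v₄} : Finset V) := by rw [← h]; simp
    simp [hw1.symm, h12, h41.symm] at this
  · simp only [Finset.mem_insert, Finset.mem_singleton, not_or]
    constructor
    · intro h
      have : x ∈ ({v₁, v₂, v₃} : Finset V) := by rw [h]; simp
      simp [hx, h1.ne, h3.ne] at this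
    · intro h
      have : v₁ ∈ ({v₂, w, v₄} : Finset V) := by rw [← h]; simp
      simp [hw1.symm, h12, h41.symm] at this

end Level

/-! ### Graphs on initial segments of the natural numbers -/

/-- The symmetric closure of the restriction of `r` to pairs `i < j`. -/
def Linked (r : ℕ → ℕ → Prop) (i j : ℕ) : Prop := (i < j ∧ r i j) ∨ (j < i ∧ r j i)

theorem Linked.symm {r : ℕ → ℕ → Prop} {i j : ℕ} (h : Linked r i j) : Linked r j i := Or.symm h

theorem linked_comm {r : ℕ → ℕ → Prop} {i j : ℕ} : Linked r i j ↔ Linked r j i := or_comm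

theorem linked_of_lt {r : ℕ → ℕ → Prop} {i j : ℕ} (h : i < j) : Linked r i j ↔ r i j := by
  simp [Linked, h, h.le]

/-- The graph on `0, …, N - 1` in which `i < j` are adjacent if and only if `r i j`. -/
def natGraph (r : ℕ → ℕ → Prop) (N : ℕ) : SimpleGraph (Fin N) where
  Adj i j := Linked r i j
  symm := ⟨fun _ _ h => h.symm⟩
  loopless := ⟨fun i h => by rcases h with h | h <;> exact lt_irrefl _ h.1⟩

theorem natGraph_adj {r : ℕ → ℕ → Prop} {N : ℕ} {i j : Fin N} :
    (natGraph r N).Adj i j ↔ Linked r i j := Iff.rfl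

/-- An injective map of `0, …, N - 1` to itself that respects the relations is an isomorphism. -/
theorem exists_natGraph_iso {r r' : ℕ → ℕ → Prop} {N : ℕ} (g : ℕ → ℕ) (hg : ∀ i < N, g i < N)
    (hinj : ∀ i j, i < j → j < N → g i ≠ g j)
    (hr : ∀ i j, i < j → j < N → (Linked r' (g i) (g j) ↔ r i j)) :
    ∃ e : natGraph r N ≃g natGraph r' N, ∀ i, (e i).val = g i := by
  let f : Fin N → Fin N := fun i => ⟨g i, hg i i.2⟩
  have hf : Function.Injective f := by
    intro i j h
    have h' : g i = g j := congrArg Fin.val h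
    rcases lt_trichotomy i.val j.val with hlt | heq | hlt
    · exact absurd h' (hinj _ _ hlt j.2)
    · exact Fin.ext heq
    · exact absurd h'.symm (hinj _ _ hlt i.2)
  refine ⟨⟨Equiv.ofBijective f (Finite.injective_iff_bijective.1 hf), ?_⟩, fun i => rfl⟩
  intro i j
  change Linked r' (g i) (g j) ↔ Linked r i j
  rcases lt_trichotomy i.val j.val with hlt | heq | hlt
  · rw [hr _ _ hlt j.2, linked_of_lt hlt]
  · rw [heq]
    simp [Linked]
  · rw [linked_comm, hr _ _ hlt i.2, linked_comm, linked_of_lt hlt]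

/-- A labelling `g` of the old vertices of an expansion and `c` of the new vertex, under which the
edges are described by `r'`, is an isomorphism. -/
theorem expansion_natGraph_iso {r r' : ℕ → ℕ → Prop} {N : ℕ} {v₁ v₂ v₃ v₄ : Fin N} (g : ℕ → ℕ)
    (c : ℕ) (hc : c < N + 1) (hg : ∀ i < N, g i < N + 1 ∧ g i ≠ c)
    (hinj : ∀ i j, i < j → j < N → g i ≠ g j)
    (hold : ∀ i j, i < j → j < N → (Linked r' (g i) (g j) ↔ r i j ∧
      ¬((i = v₁ ∧ j = v₃) ∨ (i = v₃ ∧ j = v₁)) ∧ ¬((i = v₂ ∧ j = v₄) ∨ (i = v₄ ∧ j = v₂))))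
    (hnew : ∀ i < N, (Linked r' (g i) c ↔ i = v₁ ∨ i = v₂ ∨ i = v₃ ∨ i = v₄)) :
    Nonempty (expansion (natGraph r N) v₁ v₂ v₃ v₄ ≃g natGraph r' (N + 1)) := by
  let f : Option (Fin N) → Fin (N + 1) := fun o =>
    o.elim ⟨c, hc⟩ fun i => ⟨g i, (hg i i.2).1⟩
  have hf : Function.Injective f := by
    rintro (_ | i) (_ | j) h
    · rfl
    · exact absurd (congrArg Fin.val h).symm (hg j j.2).2
    · exact absurd (congrArg Fin.val h) (hg i i.2).2
    · have h' : g i = g j := congrArg Fin.val h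
      rcases lt_trichotomy i.val j.val with hlt | heq | hlt
      · exact absurd h' (hinj _ _ hlt j.2)
      · exact congrArg some (Fin.ext heq)
      · exact absurd h'.symm (hinj _ _ hlt i.2)
  have hcard : Nat.card (Option (Fin N)) = Nat.card (Fin (N + 1)) := by simp
  have hold' : ∀ i j : Fin N, i < j → ((natGraph r' (N + 1)).Adj (f (some i)) (f (some j)) ↔
      (expansion (natGraph r N) v₁ v₂ v₃ v₄).Adj (some i) (some j)) := by
    intro i j hij
    rw [expansion_adj_some_some, natGraph_adj, natGraph_adj, linked_of_lt hij]
    refine (hold i j hij j.2).trans (and_congr_right fun _ => ?_)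
    simp only [ne_eq, Sym2.eq_iff, Fin.ext_iff]
  refine ⟨⟨Equiv.ofBijective f (hf.bijective_of_nat_card_le hcard.ge), ?_⟩⟩
  rintro (_ | i) (_ | j)
  · simp
  · rw [expansion_adj_none_some, Fin.ext_iff, Fin.ext_iff, Fin.ext_iff, Fin.ext_iff,
      ← hnew j j.2, linked_comm]
    rfl
  · rw [expansion_adj_some_none, Fin.ext_iff, Fin.ext_iff, Fin.ext_iff, Fin.ext_iff,
      ← hnew i i.2]
    rfl
  · rcases lt_trichotomy i j with hlt | heq | hlt
    · exact hold' i j hlt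
    · rw [heq]
      simp
    · rw [SimpleGraph.adj_comm, SimpleGraph.adj_comm (expansion ..)]
      exact hold' j i hlt

/-! ### The template graphs, labelled along the chain -/

/-- The square of a cycle. -/
def relC (N i j : ℕ) : Prop :=
  j = i + 1 ∨ j = i + 2 ∨ (i = 0 ∧ j + 1 = N) ∨ (i = 0 ∧ j + 2 = N) ∨ (i = 1 ∧ j + 1 = N)

/-- Two zigzags, between the end vertices `0`, `p` and `N ≡ 0`. -/
def relD (p N i j : ℕ) : Prop :=
  j = i + 1 ∨ (j = i + 2 ∧ i + 1 ≠ p) ∨ (i = 0 ∧ j + 1 = N) ∨ (i = 0 ∧ j + 2 = N) ∨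
    (i = 1 ∧ j = p + 1) ∨ (i + 1 = p ∧ j + 1 = N)

/-- Three zigzags, between the end vertices `0`, `p`, `q` and `N ≡ 0`. The chord vertices
`p - 1` and `q + 1` are adjacent, and `s` and `t` are the chord vertices adjacent to `1` and
`N - 1`. -/
def relE (p q s t N i j : ℕ) : Prop :=
  j = i + 1 ∨ (j = i + 2 ∧ i + 1 ≠ p ∧ i + 1 ≠ q) ∨ (i = 0 ∧ j + 1 = N) ∨ (i = 0 ∧ j + 2 = N) ∨
    (i = 1 ∧ j = s) ∨ (i + 1 = p ∧ j = q + 1) ∨ (i = t ∧ j + 1 = N)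

/-- The admissible parameters of `relE`. The middle zigzag, from `p` to `q`, is the
distinguished one of `templateA` if `s = p + 1`, where it may be short, and `s = q - 1` gives
`templateB`. -/
def Params (p q s t N : ℕ) : Prop :=
  4 ≤ p ∧ p < q ∧ q + 4 ≤ N ∧ ((s = p + 1 ∧ t + 1 = q) ∨ (s + 1 = q ∧ t = p + 1 ∧ p + 4 ≤ q))

/-- Makes room for a new vertex between `c` and `c + 1`. -/
def insertAt (c i : ℕ) : ℕ := if i ≤ c then i else i + 1

/-! ### Expansions that lengthen a zigzag -/

/-- The new vertex is inserted between `c` and `c + 1`, where `c = v₂` is the middle vertex of the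
triangle. The vertex `v₄` comes after the triangle: it is the next one in the zigzag or, if `v₂`
is the last chord vertex, its neighbor across a completing edge. -/
theorem relE_insert_first_right {p q s t N c : ℕ} (h : Params p q s t N) {v₁ v₂ v₃ v₄ : Fin N}
    (h1 : v₁.val + 1 = c) (h2 : v₂.val = c) (h3 : v₃.val = c + 1) (hc : c < p)
    (h4 : (v₄.val = c + 2 ∧ c + 1 < p) ∨ (v₄.val = q + 1 ∧ c + 1 = p)) :
    Nonempty (expansion (natGraph (relE p q s t N) N) v₁ v₂ v₃ v₄ ≃g
      natGraph (relE (p + 1) (q + 1) (s + 1) (t + 1) (N + 1)) (N + 1)) := by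
  unfold Params at h
  refine expansion_natGraph_iso (insertAt c)
    (c + 1) (by omega)
    (fun i hi => by unfold insertAt; split_ifs <;> omega)
    (fun i j hij hj => by unfold insertAt; split_ifs <;> omega) (fun i j hij hj => ?_)
    (fun i hi => ?_)
  all_goals
    simp only [Linked, relE, insertAt]
    split_ifs <;> constructor <;> intro h' <;> grind (splits := 60)

/-- In the middle zigzag, `s'` and `t'` are the vertices `s` and `t` after the insertion: the one
next to the last end of the zigzag is shifted. -/
theorem relE_insert_middle_right {p q s t N c s' t' : ℕ} (h : Params p q s t N)
    {v₁ v₂ v₃ v₄ : Fin N}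
    (h1 : v₁.val + 1 = c) (h2 : v₂.val = c) (h3 : v₃.val = c + 1) (hpc : p < c)
    (hc : c < q)
    (hs : (s = p + 1 ∧ t + 1 = q ∧ s' = p + 1 ∧ t' = q) ∨
      (s + 1 = q ∧ t = p + 1 ∧ p + 4 ≤ q ∧ s' = q ∧ t' = p + 1))
    (h4 : (v₄.val = c + 2 ∧ c + 1 < q) ∨ (c + 1 = q ∧ t = c ∧ v₄.val + 1 = N) ∨
      (c + 1 = q ∧ s = c ∧ t ≠ c ∧ v₄.val = 1)) :
    Nonempty (expansion (natGraph (relE p q s t N) N) v₁ v₂ v₃ v₄ ≃g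
      natGraph (relE p (q + 1) s' t' (N + 1)) (N + 1)) := by
  unfold Params at h
  refine expansion_natGraph_iso (insertAt c)
    (c + 1) (by omega)
    (fun i hi => by unfold insertAt; split_ifs <;> omega)
    (fun i j hij hj => by unfold insertAt; split_ifs <;> omega) (fun i j hij hj => ?_)
    (fun i hi => ?_)
  all_goals
    simp only [Linked, relE, insertAt]
    split_ifs <;> constructor <;> intro h' <;> grind (splits := 60)

theorem relD_insert_right {p N c : ℕ} (hp : 4 ≤ p) (hN : p + 4 ≤ N) {v₁ v₂ v₃ v₄ : Fin N}
    (h1 : v₁.val + 1 = c) (h2 : v₂.val = c) (h3 : v₃.val = c + 1) (hc : c < p)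
    (h4 : (v₄.val = c + 2 ∧ c + 1 < p) ∨ (v₄.val + 1 = N ∧ c + 1 = p)) :
    Nonempty (expansion (natGraph (relD p N) N) v₁ v₂ v₃ v₄ ≃g
      natGraph (relD (p + 1) (N + 1)) (N + 1)) := by
  refine expansion_natGraph_iso (insertAt c)
    (c + 1) (by omega)
    (fun i hi => by unfold insertAt; split_ifs <;> omega)
    (fun i j hij hj => by unfold insertAt; split_ifs <;> omega) (fun i j hij hj => ?_)
    (fun i hi => ?_)
  all_goals
    simp only [Linked, relD, insertAt]
    split_ifs <;> constructor <;> intro h' <;> grind (splits := 60)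

theorem relC_insert_right {N : ℕ} (hN : 5 ≤ N) {v₁ v₂ v₃ v₄ : Fin N}
    (h1 : v₁.val = 1) (h2 : v₂.val = 2) (h3 : v₃.val = 3) (h4 : v₄.val = 4) :
    Nonempty (expansion (natGraph (relC N) N) v₁ v₂ v₃ v₄ ≃g
      natGraph (relC (N + 1)) (N + 1)) := by
  refine expansion_natGraph_iso (insertAt 2)
    3 (by omega)
    (fun i hi => by unfold insertAt; split_ifs <;> omega)
    (fun i j hij hj => by unfold insertAt; split_ifs <;> omega) (fun i j hij hj => ?_)
    (fun i hi => ?_)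
  all_goals
    simp only [Linked, relC, insertAt]
    split_ifs <;> constructor <;> intro h' <;> grind (splits := 60)

/-- The new vertex is inserted between `c` and `c + 1`, where `c + 1 = v₂` is the middle vertex of
the triangle, and the vertex `v₄` comes before the triangle. -/
theorem relE_insert_first_left {p q s t N c : ℕ} (h : Params p q s t N) {v₁ v₂ v₃ v₄ : Fin N}
    (h1 : v₁.val = c) (h2 : v₂.val = c + 1) (h3 : v₃.val = c + 2) (hc : c + 1 < p)
    (h4 : v₄.val + 1 = c ∨ (v₄.val = s ∧ c = 0)) :
    Nonempty (expansion (natGraph (relE p q s t N) N) v₁ v₂ v₃ v₄ ≃g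
      natGraph (relE (p + 1) (q + 1) (s + 1) (t + 1) (N + 1)) (N + 1)) := by
  unfold Params at h
  refine expansion_natGraph_iso (insertAt c)
    (c + 1) (by omega)
    (fun i hi => by unfold insertAt; split_ifs <;> omega)
    (fun i j hij hj => by unfold insertAt; split_ifs <;> omega) (fun i j hij hj => ?_)
    (fun i hi => ?_)
  all_goals
    simp only [Linked, relE, insertAt]
    split_ifs <;> constructor <;> intro h' <;> grind (splits := 60)

theorem relE_insert_middle_left {p q s t N c s' t' : ℕ} (h : Params p q s t N)
    {v₁ v₂ v₃ v₄ : Fin N}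
    (h1 : v₁.val = c) (h2 : v₂.val = c + 1) (h3 : v₃.val = c + 2) (hpc : p ≤ c)
    (hc : c + 1 < q)
    (hs : (s = p + 1 ∧ t + 1 = q ∧ s' = p + 1 ∧ t' = q) ∨
      (s + 1 = q ∧ t = p + 1 ∧ p + 4 ≤ q ∧ s' = q ∧ t' = p + 1))
    (h4 : (v₄.val + 1 = c ∧ p < c) ∨ (c = p ∧ s = c + 1 ∧ v₄.val = 1) ∨
      (c = p ∧ t = c + 1 ∧ s ≠ c + 1 ∧ v₄.val + 1 = N)) :
    Nonempty (expansion (natGraph (relE p q s t N) N) v₁ v₂ v₃ v₄ ≃g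
      natGraph (relE p (q + 1) s' t' (N + 1)) (N + 1)) := by
  unfold Params at h
  refine expansion_natGraph_iso (insertAt c)
    (c + 1) (by omega)
    (fun i hi => by unfold insertAt; split_ifs <;> omega)
    (fun i j hij hj => by unfold insertAt; split_ifs <;> omega) (fun i j hij hj => ?_)
    (fun i hi => ?_)
  all_goals
    simp only [Linked, relE, insertAt]
    split_ifs <;> constructor <;> intro h' <;> grind (splits := 60)

theorem relD_insert_left {p N c : ℕ} (hp : 4 ≤ p) (hN : p + 4 ≤ N) {v₁ v₂ v₃ v₄ : Fin N}
    (h1 : v₁.val = c) (h2 : v₂.val = c + 1) (h3 : v₃.val = c + 2) (hc : c + 1 < p)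
    (h4 : v₄.val + 1 = c ∨ (v₄.val = p + 1 ∧ c = 0)) :
    Nonempty (expansion (natGraph (relD p N) N) v₁ v₂ v₃ v₄ ≃g
      natGraph (relD (p + 1) (N + 1)) (N + 1)) := by
  refine expansion_natGraph_iso (insertAt c)
    (c + 1) (by omega)
    (fun i hi => by unfold insertAt; split_ifs <;> omega)
    (fun i j hij hj => by unfold insertAt; split_ifs <;> omega) (fun i j hij hj => ?_)
    (fun i hi => ?_)
  all_goals
    simp only [Linked, relD, insertAt]
    split_ifs <;> constructor <;> intro h' <;> grind (splits := 60)

theorem relC_insert_left {N : ℕ} (hN : 5 ≤ N) {v₁ v₂ v₃ v₄ : Fin N}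
    (h1 : v₁.val = 1) (h2 : v₂.val = 2) (h3 : v₃.val = 3) (h4 : v₄.val = 0) :
    Nonempty (expansion (natGraph (relC N) N) v₁ v₂ v₃ v₄ ≃g
      natGraph (relC (N + 1)) (N + 1)) := by
  refine expansion_natGraph_iso (insertAt 1)
    2 (by omega)
    (fun i hi => by unfold insertAt; split_ifs <;> omega)
    (fun i j hij hj => by unfold insertAt; split_ifs <;> omega) (fun i j hij hj => ?_)
    (fun i hi => ?_)
  all_goals
    simp only [Linked, relC, insertAt]
    split_ifs <;> constructor <;> intro h' <;> grind (splits := 60)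

/-! ### Expansions that create a new zigzag -/

/-- The vertex `v₂ = 2` is the last one of the triangle `{0, 1, 2}`. After relabelling the triangle,
the new vertex belongs to a zigzag with three triangles from `0` to `4`. The other lemmas of this
part treat the remaining choices of the triangle and of `v₄` in the same way. -/
theorem relC_split_start_three {N : ℕ} (hN : 7 ≤ N) {v₁ v₂ v₃ v₄ : Fin N}
    (h1 : v₁.val = 0) (h2 : v₂.val = 2) (h3 : v₃.val = 1) (h4 : v₄.val = 3) :
    Nonempty (expansion (natGraph (relC N) N) v₁ v₂ v₃ v₄ ≃g
      natGraph (relD 4 (N + 1)) (N + 1)) := by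
  refine expansion_natGraph_iso
    (fun i => if i = 0 then 0 else if i = 2 then 1 else if i = 1 then 3 else i + 1)
    2 (by omega)
    (fun i hi => by split_ifs <;> omega)
    (fun i j hij hj => by split_ifs <;> omega) (fun i j hij hj => ?_)
    (fun i hi => ?_)
  all_goals
    simp only [Linked, relC, relD]
    split_ifs <;> constructor <;> intro h' <;> grind (splits := 60)

theorem relD_split_two_three {p N : ℕ} (hp : 4 ≤ p) (hN : p + 4 ≤ N) {v₁ v₂ v₃ v₄ : Fin N}
    (h1 : v₁.val = 0) (h2 : v₂.val = 2) (h3 : v₃.val = 1) (h4 : v₄.val = 3) :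
    Nonempty (expansion (natGraph (relD p N) N) v₁ v₂ v₃ v₄ ≃g
      natGraph (relE 4 (p + 1) 5 p (N + 1)) (N + 1)) := by
  refine expansion_natGraph_iso
    (fun i => if i = 0 then 0 else if i = 2 then 1 else if i = 1 then 3 else i + 1)
    2 (by omega)
    (fun i hi => by split_ifs <;> omega)
    (fun i j hij hj => by split_ifs <;> omega) (fun i j hij hj => ?_)
    (fun i hi => ?_)
  all_goals
    simp only [Linked, relD, relE]
    split_ifs <;> constructor <;> intro h' <;> grind (splits := 60)

theorem relC_split_start_four {N : ℕ} (hN : 7 ≤ N) {v₁ v₂ v₃ v₄ : Fin N}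
    (h1 : v₁.val = 0) (h2 : v₂.val = 2) (h3 : v₃.val = 1) (h4 : v₄.val = 4) :
    Nonempty (expansion (natGraph (relC N) N) v₁ v₂ v₃ v₄ ≃g
      natGraph (relD 4 (N + 1)) (N + 1)) := by
  refine expansion_natGraph_iso
    (fun i => if i = 0 then 0 else if i = 2 then 2 else if i = 1 then 3 else i + 1)
    1 (by omega)
    (fun i hi => by split_ifs <;> omega)
    (fun i j hij hj => by split_ifs <;> omega) (fun i j hij hj => ?_)
    (fun i hi => ?_)
  all_goals
    simp only [Linked, relC, relD]
    split_ifs <;> constructor <;> intro h' <;> grind (splits := 60)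

theorem relD_split_two_four {p N : ℕ} (hp : 4 ≤ p) (hN : p + 4 ≤ N) {v₁ v₂ v₃ v₄ : Fin N}
    (h1 : v₁.val = 0) (h2 : v₂.val = 2) (h3 : v₃.val = 1) (h4 : v₄.val = 4) :
    Nonempty (expansion (natGraph (relD p N) N) v₁ v₂ v₃ v₄ ≃g
      natGraph (relE 4 (p + 1) 5 p (N + 1)) (N + 1)) := by
  refine expansion_natGraph_iso
    (fun i => if i = 0 then 0 else if i = 2 then 2 else if i = 1 then 3 else i + 1)
    1 (by omega)
    (fun i hi => by split_ifs <;> omega)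
    (fun i j hij hj => by split_ifs <;> omega) (fun i j hij hj => ?_)
    (fun i hi => ?_)
  all_goals
    simp only [Linked, relD, relE]
    split_ifs <;> constructor <;> intro h' <;> grind (splits := 60)

theorem relC_split_end_zero {N : ℕ} (hN : 7 ≤ N) {v₁ v₂ v₃ v₄ : Fin N}
    (h1 : v₁.val = 3) (h2 : v₂.val = 2) (h3 : v₃.val = 4) (h4 : v₄.val = 0) :
    Nonempty (expansion (natGraph (relC N) N) v₁ v₂ v₃ v₄ ≃g
      natGraph (relD 4 (N + 1)) (N + 1)) := by
  refine expansion_natGraph_iso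
    (fun i => if i = 0 then N else if i = 1 then 0 else if i = 3 then 1 else if i = 2 then 2 else i)
    3 (by omega)
    (fun i hi => by split_ifs <;> omega)
    (fun i j hij hj => by split_ifs <;> omega) (fun i j hij hj => ?_)
    (fun i hi => ?_)
  all_goals
    simp only [Linked, relC, relD]
    split_ifs <;> constructor <;> intro h' <;> grind (splits := 60)

theorem relC_split_end_one {N : ℕ} (hN : 7 ≤ N) {v₁ v₂ v₃ v₄ : Fin N}
    (h1 : v₁.val = 3) (h2 : v₂.val = 2) (h3 : v₃.val = 4) (h4 : v₄.val = 1) :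
    Nonempty (expansion (natGraph (relC N) N) v₁ v₂ v₃ v₄ ≃g
      natGraph (relD 4 (N + 1)) (N + 1)) := by
  refine expansion_natGraph_iso
    (fun i => if i = 0 then N else if i = 1 then 0 else if i = 3 then 1 else if i = 2 then 3 else i)
    2 (by omega)
    (fun i hi => by split_ifs <;> omega)
    (fun i j hij hj => by split_ifs <;> omega) (fun i j hij hj => ?_)
    (fun i hi => ?_)
  all_goals
    simp only [Linked, relC, relD]
    split_ifs <;> constructor <;> intro h' <;> grind (splits := 60)

theorem relD_split_one_zero {p N : ℕ} (hp : 4 ≤ p) (hN : p + 4 ≤ N) {v₁ v₂ v₃ v₄ : Fin N}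
    (h1 : v₁.val = 2) (h2 : v₂.val = 1) (h3 : v₃.val = 3) (h4 : v₄.val = 0) :
    Nonempty (expansion (natGraph (relD p N) N) v₁ v₂ v₃ v₄ ≃g
      natGraph (relE 4 (p + 1) 5 p (N + 1)) (N + 1)) := by
  refine expansion_natGraph_iso
    (fun i => if i = 0 then 0 else if i = 2 then 1 else if i = 1 then 3 else i + 1)
    2 (by omega)
    (fun i hi => by split_ifs <;> omega)
    (fun i j hij hj => by split_ifs <;> omega) (fun i j hij hj => ?_)
    (fun i hi => ?_)
  all_goals
    simp only [Linked, relD, relE]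
    split_ifs <;> constructor <;> intro h' <;> grind (splits := 60)

theorem relD_split_one_chord {p N : ℕ} (hp : 4 ≤ p) (hN : p + 4 ≤ N) {v₁ v₂ v₃ v₄ : Fin N}
    (h1 : v₁.val = 2) (h2 : v₂.val = 1) (h3 : v₃.val = 3) (h4 : v₄.val = p + 1) :
    Nonempty (expansion (natGraph (relD p N) N) v₁ v₂ v₃ v₄ ≃g
      natGraph (relE 4 (p + 1) 5 p (N + 1)) (N + 1)) := by
  refine expansion_natGraph_iso
    (fun i => if i = 0 then 0 else if i = 2 then 1 else if i = 1 then 2 else i + 1)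
    3 (by omega)
    (fun i hi => by split_ifs <;> omega)
    (fun i j hij hj => by split_ifs <;> omega) (fun i j hij hj => ?_)
    (fun i hi => ?_)
  all_goals
    simp only [Linked, relD, relE]
    split_ifs <;> constructor <;> intro h' <;> grind (splits := 60)

/-! ### Expansions that twist a zigzag with two triangles -/

/-- The middle zigzag has the two triangles `{p, p + 1, p + 2}` and `{p + 1, p + 2, p + 3}`. The
expansion gives it a third one, and the completing edges end at the other chord vertices: the
result is the labelled form of a `B` template. -/
theorem relE_twist_end {p N : ℕ} (hp : 4 ≤ p) (hN : p + 7 ≤ N) {v₁ v₂ v₃ v₄ : Fin N}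
    (h1 : v₁.val = p) (h2 : v₂.val = p + 2) (h3 : v₃.val = p + 1) (h4 : v₄.val = p + 3) :
    Nonempty (expansion (natGraph (relE p (p + 3) (p + 1) (p + 2) N) N) v₁ v₂ v₃ v₄ ≃g
      natGraph (relE p (p + 4) (p + 3) (p + 1) (N + 1)) (N + 1)) := by
  refine expansion_natGraph_iso
    (fun i => if i = p + 2 then p + 1 else if i = p + 1 then p + 3 else if i ≤ p then i else i + 1)
    (p + 2) (by omega)
    (fun i hi => by split_ifs <;> omega)
    (fun i j hij hj => by split_ifs <;> omega) (fun i j hij hj => ?_)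
    (fun i hi => ?_)
  all_goals
    simp only [Linked, relE]
    split_ifs <;> constructor <;> intro h' <;> grind (splits := 60)

theorem relE_twist_chord {p N : ℕ} (hp : 4 ≤ p) (hN : p + 7 ≤ N) {v₁ v₂ v₃ v₄ : Fin N}
    (h1 : v₁.val = p) (h2 : v₂.val = p + 2) (h3 : v₃.val = p + 1) (h4 : v₄.val + 1 = N) :
    Nonempty (expansion (natGraph (relE p (p + 3) (p + 1) (p + 2) N) N) v₁ v₂ v₃ v₄ ≃g
      natGraph (relE p (p + 4) (p + 3) (p + 1) (N + 1)) (N + 1)) := by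
  refine expansion_natGraph_iso
    (fun i => if i = p + 2 then p + 2 else if i = p + 1 then p + 3 else if i ≤ p then i else i + 1)
    (p + 1) (by omega)
    (fun i hi => by split_ifs <;> omega)
    (fun i j hij hj => by split_ifs <;> omega) (fun i j hij hj => ?_)
    (fun i hi => ?_)
  all_goals
    simp only [Linked, relE]
    split_ifs <;> constructor <;> intro h' <;> grind (splits := 60)

/-! ### Symmetries of the template graphs -/

theorem relC_rotate {N k : ℕ} (hk : k < N) :
    ∃ e : natGraph (relC N) N ≃g natGraph (relC N) N,
      ∀ i, (e i).val = if i.val + k < N then i.val + k else i.val + k - N := by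
  refine exists_natGraph_iso (fun i => if i + k < N then i + k else i + k - N)
    (fun i hi => by split_ifs <;> omega)
    (fun i j hij hj => by split_ifs <;> omega) (fun i j hij hj => ?_)
  simp only [Linked, relC]
  split_ifs <;> constructor <;> intro h' <;> grind (splits := 60)

theorem relE_reverse {p q s t N : ℕ} (h : Params p q s t N) :
    ∃ e : natGraph (relE p q s t N) N ≃g natGraph (relE (N - q) (N - p) (N - t) (N - s) N) N,
      ∀ i, (e i).val = if i.val = 0 then 0 else N - i.val := by
  unfold Params at h
  refine exists_natGraph_iso (fun i => if i = 0 then 0 else N - i)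
    (fun i hi => by split_ifs <;> omega)
    (fun i j hij hj => by split_ifs <;> omega) (fun i j hij hj => ?_)
  simp only [Linked, relE]
  split_ifs <;> constructor <;> intro h' <;> grind (splits := 60)

theorem relD_rotate {p N : ℕ} (hp : 4 ≤ p) (hN : p + 4 ≤ N) :
    ∃ e : natGraph (relD p N) N ≃g natGraph (relD (N - p) N) N,
      ∀ i, (e i).val = if i.val < p then i.val + N - p else i.val - p := by
  refine exists_natGraph_iso (fun i => if i < p then i + N - p else i - p)
    (fun i hi => by split_ifs <;> omega)
    (fun i j hij hj => by split_ifs <;> omega) (fun i j hij hj => ?_)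
  simp only [Linked, relD]
  split_ifs <;> constructor <;> intro h' <;> grind (splits := 60)

theorem relD_reverse {p N : ℕ} (hp : 4 ≤ p) (hN : p + 4 ≤ N) :
    ∃ e : natGraph (relD p N) N ≃g natGraph (relD p N) N,
      ∀ i, (e i).val = if i.val ≤ p then p - i.val else N + p - i.val := by
  refine exists_natGraph_iso (fun i => if i ≤ p then p - i else N + p - i)
    (fun i hi => by split_ifs <;> omega)
    (fun i j hij hj => by split_ifs <;> omega) (fun i j hij hj => ?_)
  simp only [Linked, relD]
  split_ifs <;> constructor <;> intro h' <;> grind (splits := 60)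

/-! ### Triangles of the template graphs -/

/-- The triangles consist of three cyclically consecutive vertices, the middle one of which is not
an end of a zigzag. The second alternative is the triangle around the last chord vertex `N - 1`. -/
theorem relE_triangle {p q s t N : ℕ} (h : Params p q s t N) {a b c : ℕ} (hab : a < b)
    (hbc : b < c) (hc : c < N) : (relE p q s t N a b ∧ relE p q s t N b c ∧ relE p q s t N a c) ↔
      (b = a + 1 ∧ c = a + 2 ∧ b ≠ p ∧ b ≠ q) ∨ (a = 0 ∧ b + 2 = N ∧ c + 1 = N) := by
  unfold Params at h
  unfold relE
  constructor <;> intro h' <;> grind (splits := 60)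

theorem relD_triangle {p N : ℕ} (hp : 4 ≤ p) (hN : p + 4 ≤ N) {a b c : ℕ} (hab : a < b)
    (hbc : b < c) (hc : c < N) : (relD p N a b ∧ relD p N b c ∧ relD p N a c) ↔
      (b = a + 1 ∧ c = a + 2 ∧ b ≠ p) ∨ (a = 0 ∧ b + 2 = N ∧ c + 1 = N) := by
  unfold relD
  constructor <;> intro h' <;> grind (splits := 60)

/-- If the triangles of a graph are the triples of cyclically consecutive vertices whose middle
vertex is neither `0` nor in `J`, then its level is `|J| + 1`. -/
theorem level_natGraph {r : ℕ → ℕ → Prop} {N : ℕ} (J : Finset ℕ) (hN : 5 ≤ N)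
    (hJ : ∀ j ∈ J, 0 < j ∧ j + 1 < N)
    (hr : ∀ a b c, a < b → b < c → c < N → ((r a b ∧ r b c ∧ r a c) ↔
      (b = a + 1 ∧ c = a + 2 ∧ b ∉ J) ∨ (a = 0 ∧ b + 2 = N ∧ c + 1 = N))) :
    level (natGraph r N) = J.card + 1 := by
  classical
  let F : ℕ → Finset (Fin N) := fun m =>
    Finset.univ.filter fun i => i.val + 1 = m ∨ i.val = m ∨ i.val = m + 1 ∨ (m + 1 = N ∧ i.val = 0)
  have hF : ∀ m i, i ∈ F m ↔
      i.val + 1 = m ∨ i.val = m ∨ i.val = m + 1 ∨ (m + 1 = N ∧ i.val = 0) := by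
    simp [F]
  have key : ∀ a b c : Fin N, a < b → b < c → r a b → r b c → r a c →
      ∃ m ∈ Finset.Ico 1 N \ J, F m = {a, b, c} := by
    intro a b c hab hbc h1 h2 h3
    have hab' : a.val < b.val := hab
    have hbc' : b.val < c.val := hbc
    have hc := c.2
    rcases (hr a b c hab hbc c.2).1 ⟨h1, h2, h3⟩ with ⟨hb, hc', hJ'⟩ | ⟨ha, hb, hc'⟩
    · refine ⟨b, by simp [hJ']; omega, ?_⟩
      ext i
      simp only [hF, Finset.mem_insert, Finset.mem_singleton, Fin.ext_iff]
      omega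
    · refine ⟨c, ?_, ?_⟩
      · simp only [Finset.mem_sdiff, Finset.mem_Ico]
        exact ⟨by omega, fun h => by have := hJ _ h; omega⟩
      · ext i
        simp only [hF, Finset.mem_insert, Finset.mem_singleton, Fin.ext_iff]
        omega
  have himage : triangles (natGraph r N) = F '' (Finset.Ico 1 N \ J : Finset ℕ) := by
    ext T
    constructor
    · intro hT
      obtain ⟨a, b, c, hab, hac, hbc, rfl⟩ := SimpleGraph.is3Clique_iff.1 hT
      have perm : ∀ x y z : Fin N, ({x, y, z} : Finset (Fin N)) = {a, b, c} →
          (∃ m ∈ Finset.Ico 1 N \ J, F m = {x, y, z}) →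
          ({a, b, c} : Finset (Fin N)) ∈ F '' (Finset.Ico 1 N \ J : Finset ℕ) := by
        rintro x y z hxyz ⟨m, hm, h⟩
        exact ⟨m, hm, h.trans hxyz⟩
      rw [natGraph_adj] at hab hac hbc
      rcases hab with ⟨l1, hab⟩ | ⟨l1, hab⟩ <;> rcases hac with ⟨l2, hac⟩ | ⟨l2, hac⟩ <;>
        rcases hbc with ⟨l3, hbc⟩ | ⟨l3, hbc⟩
      · exact perm a b c rfl (key a b c l1 l3 hab hbc hac)
      · exact perm a c b (by grind) (key a c b l2 l3 hac hbc hab)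
      · omega
      · exact perm c a b (by grind) (key c a b l2 l1 hac hab hbc)
      · exact perm b a c (by grind) (key b a c l1 l2 hab hac hbc)
      · omega
      · exact perm b c a (by grind) (key b c a l3 l2 hbc hac hab)
      · exact perm c b a (by grind) (key c b a l3 l1 hbc hab hac)
    · rintro ⟨m, hm, rfl⟩
      simp only [Finset.coe_sdiff, Finset.coe_Ico, Set.mem_sdiff, Set.mem_Ico, Finset.mem_coe] at hm
      have hmk : ∀ a b c : Fin N, a < b → b < c → F m = {a, b, c} →
          r a b ∧ r b c ∧ r a c → F m ∈ triangles (natGraph r N) := by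
        rintro a b c hab hbc hF' ⟨h1, h2, h3⟩
        refine SimpleGraph.is3Clique_iff.2 ⟨a, b, c, Or.inl ⟨hab, h1⟩, Or.inl ⟨hab.trans hbc, h3⟩,
          Or.inl ⟨hbc, h2⟩, hF'⟩
      by_cases hmN : m + 1 = N
      · refine hmk ⟨0, by omega⟩ ⟨m - 1, by omega⟩ ⟨m, by omega⟩ (Fin.mk_lt_mk.2 (by omega))
          (Fin.mk_lt_mk.2 (by omega)) ?_ ?_
        · ext i
          simp only [hF, Finset.mem_insert, Finset.mem_singleton, Fin.ext_iff]
          omega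
        · exact (hr _ _ _ (by dsimp; omega) (by dsimp; omega) (by dsimp; omega)).2
            (Or.inr (by dsimp; omega))
      · refine hmk ⟨m - 1, by omega⟩ ⟨m, by omega⟩ ⟨m + 1, by omega⟩ (Fin.mk_lt_mk.2 (by omega))
          (Fin.mk_lt_mk.2 (by omega)) ?_ ?_
        · ext i
          simp only [hF, Finset.mem_insert, Finset.mem_singleton, Fin.ext_iff]
          omega
        · exact (hr _ _ _ (by dsimp; omega) (by dsimp; omega) (by dsimp; omega)).2
            (Or.inl ⟨by dsimp; omega, by dsimp; omega, hm.2⟩)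
  have hinj : Set.InjOn F (Finset.Ico 1 N \ J : Finset ℕ) := by
    intro m hm m' hm' h
    simp only [Finset.coe_sdiff, Finset.coe_Ico, Set.mem_sdiff, Set.mem_Ico] at hm hm'
    have h1 := fun i (hi : i < N) => (hF m ⟨i, hi⟩).symm.trans ((by rw [h]) : _ ↔ ⟨i, hi⟩ ∈ F m')
    simp only [hF] at h1
    have := h1 (m - 1) (by omega)
    have := h1 m (by omega)
    have := h1 (m' - 1) (by omega)
    have := h1 m' (by omega)
    have := h1 0 (by omega)
    omega
  have hJs : J ⊆ Finset.Ico 1 N := fun j hj => by have := hJ j hj; simp; omega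
  have hcard := Finset.card_le_card hJs
  have hcount : (triangles (natGraph r N)).ncard = N - 1 - J.card := by
    rw [himage, hinj.ncard_image, Set.ncard_coe_finset, Finset.card_sdiff_of_subset hJs]
    simp
  simp only [Nat.card_Ico] at hcard
  unfold level
  rw [show {t : Finset (Fin N) | (natGraph r N).IsNClique 3 t}.ncard = _ from hcount]
  simp only [Nat.card_eq_fintype_card, Fintype.card_fin]
  omega

theorem level_relE {p q s t N : ℕ} (h : Params p q s t N) :
    level (natGraph (relE p q s t N) N) = 3 := by
  have h' := h
  unfold Params at h'
  rw [level_natGraph {p, q} (by omega) (by simp; omega) fun a b c hab hbc hc => by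
    simpa using relE_triangle h hab hbc hc]
  rw [Finset.card_pair (by omega)]
  norm_num

theorem level_relD {p N : ℕ} (hp : 4 ≤ p) (hN : p + 4 ≤ N) :
    level (natGraph (relD p N) N) = 2 := by
  rw [level_natGraph {p} (by omega) (by simp; omega) fun a b c hab hbc hc => by
    simpa using relD_triangle hp hN hab hbc hc]
  norm_num

/-! ### Expansions of the template graphs -/

section Children

/-- `G` is one of the template graphs of level three, up to isomorphism. -/
def IsTemplate {V : Type u} (G : SimpleGraph V) : Prop :=
  ∃ p q s t N, Params p q s t N ∧ Nonempty (G ≃g natGraph (relE p q s t N) N)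

theorem IsTemplate.of_iso {V : Type u} {W : Type v} {G : SimpleGraph V} {H : SimpleGraph W}
    (h : IsTemplate G) (e : H ≃g G) : IsTemplate H := by
  obtain ⟨p, q, s, t, N, hP, ⟨f⟩⟩ := h
  exact ⟨p, q, s, t, N, hP, ⟨e.trans f⟩⟩

theorem linked_add_one {r : ℕ → ℕ → Prop} {i : ℕ} (h : r i (i + 1)) : Linked r i (i + 1) :=
  Or.inl ⟨by omega, h⟩

theorem relE_linked_add_two {p q s t N i : ℕ} (hp : i + 1 ≠ p) (hq : i + 1 ≠ q) :
    Linked (relE p q s t N) i (i + 2) :=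
  Or.inl ⟨by omega, Or.inr (Or.inl ⟨rfl, hp, hq⟩)⟩

theorem relE_child_twist {p N : ℕ} (h : Params p (p + 3) (p + 1) (p + 2) N)
    {v₁ v₂ v₃ v₄ : Fin N} (h1 : v₁.val = p) (h2 : v₂.val = p + 2) (h3 : v₃.val = p + 1)
    (h4 : v₄.val = p + 3 ∨ v₄.val + 1 = N) :
    IsTemplate (expansion (natGraph (relE p (p + 3) (p + 1) (p + 2) N) N) v₁ v₂ v₃ v₄) := by
  unfold Params at h
  have hP : Params p (p + 4) (p + 3) (p + 1) (N + 1) := by unfold Params; omega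
  rcases h4 with h4 | h4
  · exact ⟨_, _, _, _, _, hP, relE_twist_end (by omega) (by omega) h1 h2 h3 h4⟩
  · exact ⟨_, _, _, _, _, hP, relE_twist_chord (by omega) (by omega) h1 h2 h3 h4⟩

/-- Sites in the first two zigzags, with the vertices of the triangle in increasing order up to the
choice of `v₂`. By `hx` and `hw`, there is no other triangle on `v₁v₃`, and none on `v₂v₄` that
avoids `v₁` and `v₃`. -/
theorem relE_child_of_le {p q s t N : ℕ} (h : Params p q s t N) {v₁ v₂ v₃ v₄ : Fin N}
    (hv : IsSite (natGraph (relE p q s t N) N) v₁ v₂ v₃ v₄) {a : ℕ}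
    (ha : a + 2 ≤ q) (hap : a + 1 ≠ p)
    (hT : (v₁.val = a ∧ v₂.val = a + 1 ∧ v₃.val = a + 2) ∨
      (v₁.val = a ∧ v₃.val = a + 1 ∧ v₂.val = a + 2) ∨
      (v₂.val = a ∧ v₁.val = a + 1 ∧ v₃.val = a + 2))
    (hx : ∀ x : Fin N, x ≠ v₂ → Linked (relE p q s t N) x v₁ → ¬ Linked (relE p q s t N) x v₃)
    (hw : ∀ x : Fin N, x ≠ v₁ → x ≠ v₃ → Linked (relE p q s t N) x v₂ →
      ¬ Linked (relE p q s t N) x v₄) :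
    IsTemplate (expansion (natGraph (relE p q s t N) N) v₁ v₂ v₃ v₄) := by
  have h' := h
  unfold Params at h'
  have h24 : Linked (relE p q s t N) v₂ v₄ := hv.adj₂₄
  have h41 : v₄.val ≠ v₁ := fun h => hv.ne₄₁ (Fin.ext h)
  have h43 : v₄.val ≠ v₃ := fun h => hv.ne₄₃ (Fin.ext h)
  have hvN := v₄.2
  have hx' : ∀ x < N, x ≠ v₂ → Linked (relE p q s t N) x v₁ → ¬ Linked (relE p q s t N) x v₃ :=
    fun x hxN hne => hx ⟨x, hxN⟩ (fun h => hne (congrArg Fin.val h))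
  have hw' : ∀ x < N, x ≠ v₁ → x ≠ v₃ → Linked (relE p q s t N) x v₂ →
      ¬ Linked (relE p q s t N) x v₄ :=
    fun x hxN hne hne' => hw ⟨x, hxN⟩ (fun h => hne (congrArg Fin.val h))
      (fun h => hne' (congrArg Fin.val h))
  rcases hT with ⟨h1, h2, h3⟩ | ⟨h1, h3, h2⟩ | ⟨h2, h1, h3⟩
  -- `v₂` is the middle vertex of the triangle, and the zigzag is lengthened
  · rw [h2] at h24
    rw [h1] at h41
    rw [h3] at h43
    by_cases hcp : a + 1 < p
    · have hP : Params (p + 1) (q + 1) (s + 1) (t + 1) (N + 1) := by unfold Params; omega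
      have h4 : ((v₄.val = a + 3 ∧ a + 2 < p) ∨ (v₄.val = q + 1 ∧ a + 2 = p)) ∨
          (v₄.val + 1 = a ∨ (v₄.val = s ∧ a = 0)) := by
        simp only [Linked, relE] at h24
        clear hx hw hx' hw'
        grind (splits := 60)
      rcases h4 with h4 | h4
      · exact ⟨_, _, _, _, _, hP, relE_insert_first_right h (c := a + 1) (by omega) h2 h3 hcp h4⟩
      · exact ⟨_, _, _, _, _, hP, relE_insert_first_left h (c := a) h1 h2 h3 hcp h4⟩
    · obtain ⟨s', t', hs⟩ : ∃ s' t', (s = p + 1 ∧ t + 1 = q ∧ s' = p + 1 ∧ t' = q) ∨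
          (s + 1 = q ∧ t = p + 1 ∧ p + 4 ≤ q ∧ s' = q ∧ t' = p + 1) := by
        rcases h'.2.2.2 with hst | hst
        · exact ⟨p + 1, q, Or.inl ⟨hst.1, hst.2, rfl, rfl⟩⟩
        · exact ⟨q, p + 1, Or.inr ⟨hst.1, hst.2.1, hst.2.2, rfl, rfl⟩⟩
      have hP : Params p (q + 1) s' t' (N + 1) := by unfold Params; omega
      have h4 : ((v₄.val = a + 3 ∧ a + 2 < q) ∨ (a + 2 = q ∧ t = a + 1 ∧ v₄.val + 1 = N) ∨
          (a + 2 = q ∧ s = a + 1 ∧ t ≠ a + 1 ∧ v₄.val = 1)) ∨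
          ((v₄.val + 1 = a ∧ p < a) ∨ (a = p ∧ s = a + 1 ∧ v₄.val = 1) ∨
          (a = p ∧ t = a + 1 ∧ s ≠ a + 1 ∧ v₄.val + 1 = N)) := by
        simp only [Linked, relE] at h24
        clear hx hw hx' hw'
        grind (splits := 60)
      rcases h4 with h4 | h4
      · exact ⟨_, _, _, _, _, hP,
          relE_insert_middle_right h (c := a + 1) (by omega) h2 h3 (by omega) (by omega) hs h4⟩
      · exact ⟨_, _, _, _, _, hP,
          relE_insert_middle_left h (c := a) h1 h2 h3 (by omega) (by omega) hs h4⟩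
  -- `v₂` is the last vertex: only a middle zigzag with two triangles admits such an expansion, as
  -- otherwise the predecessor of `v₁` violates `hx` or a successor of `v₂` violates `hw`
  · by_cases htw : a = p ∧ q = p + 3
    · obtain ⟨rfl, rfl⟩ := htw
      obtain ⟨rfl, rfl⟩ : s = a + 1 ∧ t = a + 2 := by omega
      have h4 : v₄.val = a + 3 ∨ v₄.val + 1 = N := by
        rw [h2] at h24
        rw [h1] at h41
        rw [h3] at h43
        simp only [Linked, relE] at h24
        clear hx hw hx' hw'
        grind (splits := 60)
      exact relE_child_twist h h1 h2 h3 h4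
    exfalso
    by_cases ha0 : a = 0 ∨ a = p
    · have h4 : v₄.val = a + 3 ∨ v₄.val = a + 4 := by
        rw [h2] at h24
        rw [h1] at h41
        rw [h3] at h43
        simp only [Linked, relE] at h24
        clear hx hw hx' hw'
        grind (splits := 60)
      rcases h4 with h4 | h4
      · refine hw' (a + 4) (by omega) (by omega) (by omega) ?_ ?_
        · rw [h2]
          exact (relE_linked_add_two (by omega) (by omega)).symm
        · rw [h4]
          exact (linked_add_one (Or.inl rfl)).symm
      · refine hw' (a + 3) (by omega) (by omega) (by omega) ?_ ?_
        · rw [h2]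
          exact (linked_add_one (Or.inl rfl)).symm
        · rw [h4]
          exact linked_add_one (Or.inl rfl)
    · obtain ⟨b, rfl⟩ : ∃ b, a = b + 1 := ⟨a - 1, by omega⟩
      refine hx' b (by omega) (by omega) ?_ ?_
      · rw [h1]
        exact linked_add_one (Or.inl rfl)
      · rw [h3]
        exact relE_linked_add_two (by omega) (by omega)
  -- `v₂` is the first vertex, which is the previous case read backwards
  · by_cases htw : a = p + 1 ∧ q = p + 3
    · obtain ⟨rfl, rfl⟩ := htw
      obtain ⟨rfl, rfl⟩ : s = p + 1 ∧ t = p + 2 := by omega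
      have h4 : v₄.val = p ∨ v₄.val = 1 := by
        rw [h2] at h24
        rw [h1] at h41
        rw [h3] at h43
        simp only [Linked, relE] at h24
        clear hx hw hx' hw'
        grind (splits := 60)
      obtain ⟨e, he⟩ := relE_reverse h
      obtain ⟨f⟩ := expansion_congr e v₁ v₂ v₃ v₄
      refine IsTemplate.of_iso ?_ f
      rw [expansion_swap]
      have r1 : N - p = N - (p + 3) + 3 := by omega
      have r2 : N - (p + 2) = N - (p + 3) + 1 := by omega
      have r3 : N - (p + 1) = N - (p + 3) + 2 := by omega
      have hP : Params (N - (p + 3)) (N - (p + 3) + 3) (N - (p + 3) + 1) (N - (p + 3) + 2) N := by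
        unfold Params
        omega
      revert e
      rw [r1, r2, r3]
      intro e he f
      refine relE_child_twist hP ?_ ?_ ?_ ?_
      · rw [he, h3, if_neg (by omega)]
      · rw [he, h2, if_neg (by omega)]
        omega
      · rw [he, h1, if_neg (by omega)]
        omega
      · rw [he, if_neg (by omega)]
        omega
    exfalso
    by_cases ha0 : a + 2 = p ∨ a + 2 = q
    · have h4 : v₄.val + 1 = a ∨ v₄.val + 2 = a := by
        rw [h2] at h24
        rw [h1] at h41
        rw [h3] at h43
        simp only [Linked, relE] at h24
        clear hx hw hx' hw'
        grind (splits := 60)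
      obtain ⟨b, rfl⟩ : ∃ b, a = b + 2 := ⟨a - 2, by omega⟩
      rcases h4 with h4 | h4
      · have h4 : v₄.val = b + 1 := by omega
        refine hw' b (by omega) (by omega) (by omega) ?_ ?_
        · rw [h2]
          exact relE_linked_add_two (by omega) (by omega)
        · rw [h4]
          exact linked_add_one (Or.inl rfl)
      · have h4 : v₄.val = b := by omega
        refine hw' (b + 1) (by omega) (by omega) (by omega) ?_ ?_
        · rw [h2]
          exact linked_add_one (Or.inl rfl)
        · rw [h4]
          exact (linked_add_one (Or.inl rfl)).symm
    · refine hx' (a + 3) (by omega) (by omega) ?_ ?_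
      · rw [h1]
        exact (relE_linked_add_two (by omega) (by omega)).symm
      · rw [h3]
        exact (linked_add_one (Or.inl rfl)).symm

theorem relE_exists_middle {p q s t N : ℕ} (h : Params p q s t N) {a b c : ℕ} (hab : a < b)
    (hbc : b < c) (hc : c < N) (h1 : Linked (relE p q s t N) a b)
    (h2 : Linked (relE p q s t N) b c) (h3 : Linked (relE p q s t N) a c) :
    (b = a + 1 ∧ c = a + 2 ∧ b ≠ p ∧ b ≠ q) ∨ (a = 0 ∧ b + 2 = N ∧ c + 1 = N) :=
  (relE_triangle h hab hbc hc).1 ⟨(linked_of_lt hab).1 h1, (linked_of_lt hbc).1 h2,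
    (linked_of_lt (hab.trans hbc)).1 h3⟩

/-- The triangle of a site with `v₁ < v₃`, up to the choice of `v₂`: three consecutive vertices from
`a` on, where `N` stands for `0` in the second alternative. -/
theorem relE_site_triangle {p q s t N : ℕ} (h : Params p q s t N) {v₁ v₂ v₃ v₄ : Fin N}
    (hv : IsSite (natGraph (relE p q s t N) N) v₁ v₂ v₃ v₄) (h13 : v₁ < v₃) :
    ∃ a, ((v₁.val = a ∧ v₂.val = a + 1 ∧ v₃.val = a + 2) ∨
      (v₁.val = a ∧ v₃.val = a + 1 ∧ v₂.val = a + 2) ∨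
      (v₂.val = a ∧ v₁.val = a + 1 ∧ v₃.val = a + 2)) ∧ a + 1 ≠ p ∧ a + 1 ≠ q ∨
      a + 2 = N ∧ ((v₁.val = 0 ∧ v₂.val = a ∧ v₃.val = a + 1) ∨
      (v₁.val = 0 ∧ v₂.val = a + 1 ∧ v₃.val = a) ∨
      (v₂.val = 0 ∧ v₁.val = a ∧ v₃.val = a + 1)) := by
  have l12 : Linked (relE p q s t N) v₁ v₂ := hv.adj₁₂
  have l23 : Linked (relE p q s t N) v₂ v₃ := hv.adj₂₃
  have l13 : Linked (relE p q s t N) v₁ v₃ := hv.adj₁₃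
  have hlt : v₁.val < v₃.val := h13
  rcases lt_trichotomy v₁.val v₂.val with h12 | h12 | h12
  · rcases lt_trichotomy v₂.val v₃.val with h23 | h23 | h23
    · rcases relE_exists_middle h h12 h23 v₃.2 l12 l23 l13 with h | h
      · exact ⟨v₁, Or.inl (by omega)⟩
      · exact ⟨v₂, Or.inr (by omega)⟩
    · exact absurd (Fin.ext h23) hv.adj₂₃.ne
    · rcases relE_exists_middle h hlt h23 v₂.2 l13 l23.symm l12 with h | h
      · exact ⟨v₁, Or.inl (by omega)⟩
      · exact ⟨v₃, Or.inr (by omega)⟩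
  · exact absurd (Fin.ext h12) hv.adj₁₂.ne
  · rcases relE_exists_middle h h12 hlt v₃.2 l12.symm l13 l23 with h | h
    · exact ⟨v₂, Or.inl (by omega)⟩
    · exact ⟨v₁, Or.inr (by omega)⟩

/-- The reversal of the chain takes a triangle of consecutive vertices from `a` on to one from
`N - (a + 2)` on. -/
theorem reverse_triangle {N a x y z x' y' z' : ℕ} (ha0 : 0 < a) (hN : a + 2 ≤ N)
    (ha : ((x = a ∧ y = a + 1 ∧ z = a + 2) ∨ (x = a ∧ z = a + 1 ∧ y = a + 2) ∨
      (y = a ∧ x = a + 1 ∧ z = a + 2)) ∨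
      a + 2 = N ∧ ((x = 0 ∧ y = a ∧ z = a + 1) ∨ (x = 0 ∧ y = a + 1 ∧ z = a) ∨
      (y = 0 ∧ x = a ∧ z = a + 1)))
    (hx : x' = if x = 0 then 0 else N - x) (hy : y' = if y = 0 then 0 else N - y)
    (hz : z' = if z = 0 then 0 else N - z) :
    (x' < z' → (x' = N - (a + 2) ∧ y' = N - (a + 2) + 1 ∧ z' = N - (a + 2) + 2) ∨
      (x' = N - (a + 2) ∧ z' = N - (a + 2) + 1 ∧ y' = N - (a + 2) + 2) ∨
      (y' = N - (a + 2) ∧ x' = N - (a + 2) + 1 ∧ z' = N - (a + 2) + 2)) ∧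
    (z' < x' → (z' = N - (a + 2) ∧ y' = N - (a + 2) + 1 ∧ x' = N - (a + 2) + 2) ∨
      (z' = N - (a + 2) ∧ x' = N - (a + 2) + 1 ∧ y' = N - (a + 2) + 2) ∨
      (y' = N - (a + 2) ∧ z' = N - (a + 2) + 1 ∧ x' = N - (a + 2) + 2)) := by
  rcases ha with (ha | ha | ha) | ⟨hN', ha | ha | ha⟩ <;> constructor <;> intro hlt <;> grind

/-- The expansions of level three of the template graphs are template graphs. -/
theorem relE_child {p q s t N : ℕ} (h : Params p q s t N) {v₁ v₂ v₃ v₄ : Fin N}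
    (hv : IsSite (natGraph (relE p q s t N) N) v₁ v₂ v₃ v₄)
    (hl : level (expansion (natGraph (relE p q s t N) N) v₁ v₂ v₃ v₄) ≤ 3) :
    IsTemplate (expansion (natGraph (relE p q s t N) N) v₁ v₂ v₃ v₄) := by
  -- up to exchanging `v₁` and `v₃`
  wlog h13 : v₁ < v₃ generalizing v₁ v₃
  · rw [expansion_swap]
    rw [expansion_swap] at hl
    exact this hv.swap hl (lt_of_le_of_ne (not_lt.1 h13) hv.adj₁₃.ne.symm)
  have hx : ∀ x : Fin N, x ≠ v₂ → Linked (relE p q s t N) x v₁ →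
      ¬ Linked (relE p q s t N) x v₃ := by
    intro x hne h1 h3
    have := level_add_one_le_of_common_neighbor₁₃ hv hne h1 h3
    rw [level_relE h] at this
    omega
  have hw : ∀ x : Fin N, x ≠ v₁ → x ≠ v₃ → Linked (relE p q s t N) x v₂ →
      ¬ Linked (relE p q s t N) x v₄ := by
    intro x hne hne' h2 h4
    have := level_add_one_le_of_common_neighbor₂₄ hv hne hne' h2 h4
    rw [level_relE h] at this
    omega
  have h' := h
  unfold Params at h'
  obtain ⟨a, ha⟩ := relE_site_triangle h hv h13
  by_cases haq : a + 2 ≤ q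
  · rcases ha with ha | ha
    · exact relE_child_of_le h hv haq ha.2.1 ha.1 hx hw
    · omega
  -- the triangle lies in the last zigzag, which a reversal of the chain moves to the front
  obtain ⟨e, he⟩ := relE_reverse h
  obtain ⟨f⟩ := expansion_congr e v₁ v₂ v₃ v₄
  refine IsTemplate.of_iso ?_ f
  have hP : Params (N - q) (N - p) (N - t) (N - s) N := by
    unfold Params
    omega
  have hv' := hv.map e
  have hx' : ∀ x : Fin N, x ≠ e v₂ → Linked (relE (N - q) (N - p) (N - t) (N - s) N) x (e v₁) →
      ¬ Linked (relE (N - q) (N - p) (N - t) (N - s) N) x (e v₃) := by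
    intro x hne h1 h3
    obtain ⟨y, rfl⟩ := e.surjective x
    exact hx y (fun h => hne (congrArg e h)) (e.map_adj_iff.1 h1) (e.map_adj_iff.1 h3)
  have hw' : ∀ x : Fin N, x ≠ e v₁ → x ≠ e v₃ →
      Linked (relE (N - q) (N - p) (N - t) (N - s) N) x (e v₂) →
      ¬ Linked (relE (N - q) (N - p) (N - t) (N - s) N) x (e v₄) := by
    intro x hne hne' h2 h4
    obtain ⟨y, rfl⟩ := e.surjective x
    exact hw y (fun h => hne (congrArg e h)) (fun h => hne' (congrArg e h))
      (e.map_adj_iff.1 h2) (e.map_adj_iff.1 h4)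
  obtain ⟨r1, r2⟩ := reverse_triangle (by omega)
    (by have := v₁.2; have := v₂.2; have := v₃.2; omega)
    (ha.imp_left And.left) (he v₁) (he v₂) (he v₃)
  rcases lt_or_gt_of_ne (e.injective.ne hv.adj₁₃.ne) with hlt | hlt
  · exact relE_child_of_le hP hv' (a := N - (a + 2)) (by omega) (by omega) (r1 hlt) hx' hw'
  · rw [expansion_swap]
    exact relE_child_of_le hP hv'.swap (a := N - (a + 2)) (by omega) (by omega) (r2 hlt)
      (fun x hne h1 h3 => hx' x hne h3 h1) (fun x hne hne' => hw' x hne' hne)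

/-- `G` is, up to isomorphism, a closed chain of two zigzags with at least three triangles each,
completed by edges between the first chord vertices and between the last chord vertices. -/
def IsDoubleChain {V : Type u} (G : SimpleGraph V) : Prop :=
  ∃ p N, 4 ≤ p ∧ p + 4 ≤ N ∧ Nonempty (G ≃g natGraph (relD p N) N)

theorem IsDoubleChain.of_iso {V : Type u} {W : Type v} {G : SimpleGraph V} {H : SimpleGraph W}
    (h : IsDoubleChain G) (e : H ≃g G) : IsDoubleChain H := by
  obtain ⟨p, N, hp, hN, ⟨f⟩⟩ := h
  exact ⟨p, N, hp, hN, ⟨e.trans f⟩⟩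

theorem relD_linked_add_two {p N i : ℕ} (hp : i + 1 ≠ p) : Linked (relD p N) i (i + 2) :=
  Or.inl ⟨by omega, Or.inr (Or.inl ⟨rfl, hp⟩)⟩

/-- Either `{v₁, v₂, v₃}` is the only triangle on `v₁v₃`, or every triangle on `v₂v₄` contains `v₁`
or `v₃`. Otherwise the expansion raises the level by at least two. -/
def NoCommonNeighbors {V : Type u} (G : SimpleGraph V) (v₁ v₂ v₃ v₄ : V) : Prop :=
  ∀ x w : V, x ≠ v₂ → G.Adj x v₁ → G.Adj x v₃ → w ≠ v₁ → w ≠ v₃ → G.Adj w v₂ → ¬ G.Adj w v₄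

theorem NoCommonNeighbors.swap {V : Type u} {G : SimpleGraph V} {v₁ v₂ v₃ v₄ : V}
    (h : NoCommonNeighbors G v₁ v₂ v₃ v₄) : NoCommonNeighbors G v₃ v₂ v₁ v₄ :=
  fun x w hx h1 h3 hw1 hw3 => h x w hx h3 h1 hw3 hw1

theorem NoCommonNeighbors.map {V : Type u} {W : Type v} {G : SimpleGraph V} {H : SimpleGraph W}
    (e : G ≃g H) {v₁ v₂ v₃ v₄ : V} (h : NoCommonNeighbors G v₁ v₂ v₃ v₄) :
    NoCommonNeighbors H (e v₁) (e v₂) (e v₃) (e v₄) := by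
  intro x w hx h1 h3 hw1 hw3 h2 h4
  obtain ⟨x, rfl⟩ := e.surjective x
  obtain ⟨w, rfl⟩ := e.surjective w
  exact h x w (fun h => hx (congrArg e h)) (e.map_adj_iff.1 h1) (e.map_adj_iff.1 h3)
    (fun h => hw1 (congrArg e h)) (fun h => hw3 (congrArg e h)) (e.map_adj_iff.1 h2)
    (e.map_adj_iff.1 h4)

/-- Sites in the first zigzag where `v₂` is the last vertex of the triangle. -/
theorem relD_child_of_last {p N : ℕ} (hp : 4 ≤ p) (hN : p + 4 ≤ N) {v₁ v₂ v₃ v₄ : Fin N}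
    (hv : IsSite (natGraph (relD p N) N) v₁ v₂ v₃ v₄)
    (hxw : NoCommonNeighbors (natGraph (relD p N) N) v₁ v₂ v₃ v₄) {a : ℕ} (ha : a + 2 ≤ p)
    (h1 : v₁.val = a) (h3 : v₃.val = a + 1) (h2 : v₂.val = a + 2) :
    IsTemplate (expansion (natGraph (relD p N) N) v₁ v₂ v₃ v₄) := by
  have h24 : Linked (relD p N) v₂ v₄ := hv.adj₂₄
  have h41 : v₄.val ≠ v₁ := fun h => hv.ne₄₁ (Fin.ext h)
  have h43 : v₄.val ≠ v₃ := fun h => hv.ne₄₃ (Fin.ext h)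
  rw [h2] at h24
  rw [h1] at h41
  rw [h3] at h43
  have hvN := v₄.2
  have hP : Params 4 (p + 1) 5 p (N + 1) := by unfold Params; omega
  by_cases ha3 : a + 3 = p
  · have h4 : v₄.val = p ∨ v₄.val + 1 = N := by
      simp only [Linked, relD] at h24
      grind (splits := 60)
    obtain ⟨e, he⟩ := relD_reverse hp hN
    obtain ⟨f⟩ := expansion_congr e v₁ v₂ v₃ v₄
    refine IsTemplate.of_iso ?_ f
    rw [expansion_swap]
    have e1 : (e v₁).val = 3 := by rw [he, h1, if_pos (by omega)]; omega
    have e2 : (e v₂).val = 1 := by rw [he, h2, if_pos (by omega)]; omega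
    have e3 : (e v₃).val = 2 := by rw [he, h3, if_pos (by omega)]; omega
    rcases h4 with h4 | h4
    · have e4 : (e v₄).val = 0 := by rw [he, if_pos (by omega)]; omega
      exact ⟨_, _, _, _, _, hP, relD_split_one_zero hp hN e3 e2 e1 e4⟩
    · have e4 : (e v₄).val = p + 1 := by rw [he, if_neg (by omega)]; omega
      exact ⟨_, _, _, _, _, hP, relD_split_one_chord hp hN e3 e2 e1 e4⟩
  · have h4 : v₄.val = a + 3 ∨ v₄.val = a + 4 := by
      simp only [Linked, relD] at h24
      grind (splits := 60)
    rcases Nat.eq_zero_or_pos a with rfl | ha0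
    · rcases h4 with h4 | h4
      · exact ⟨_, _, _, _, _, hP, relD_split_two_three hp hN h1 h2 h3 h4⟩
      · exact ⟨_, _, _, _, _, hP, relD_split_two_four hp hN h1 h2 h3 h4⟩
    -- inside the zigzag, the predecessor of `v₁` and a successor of `v₂` are common neighbors
    · exfalso
      obtain ⟨b, rfl⟩ : ∃ b, a = b + 1 := ⟨a - 1, by omega⟩
      have hx1 : Linked (relD p N) b v₁ := by
        rw [h1]
        exact linked_add_one (Or.inl rfl)
      have hx3 : Linked (relD p N) b v₃ := by
        rw [h3]
        exact relD_linked_add_two (by omega)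
      have key := fun w => hxw ⟨b, by omega⟩ w (by rw [Ne, Fin.ext_iff, h2]; dsimp; omega) hx1 hx3
      rcases h4 with h4 | h4
      · refine key ⟨b + 5, by omega⟩ (by rw [Ne, Fin.ext_iff, h1]; dsimp; omega)
          (by rw [Ne, Fin.ext_iff, h3]; dsimp; omega) ?_ ?_
        · rw [natGraph_adj, h2]
          exact (relD_linked_add_two (by omega)).symm
        · rw [natGraph_adj, h4]
          exact (linked_add_one (Or.inl rfl)).symm
      · refine key ⟨b + 4, by omega⟩ (by rw [Ne, Fin.ext_iff, h1]; dsimp; omega)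
          (by rw [Ne, Fin.ext_iff, h3]; dsimp; omega) ?_ ?_
        · rw [natGraph_adj, h2]
          exact (linked_add_one (Or.inl rfl)).symm
        · rw [natGraph_adj, h4]
          exact linked_add_one (Or.inl rfl)

/-- Sites in the first zigzag. -/
theorem relD_child_of_le {p N : ℕ} (hp : 4 ≤ p) (hN : p + 4 ≤ N) {v₁ v₂ v₃ v₄ : Fin N}
    (hv : IsSite (natGraph (relD p N) N) v₁ v₂ v₃ v₄)
    (hxw : NoCommonNeighbors (natGraph (relD p N) N) v₁ v₂ v₃ v₄) {a : ℕ} (ha : a + 2 ≤ p)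
    (hT : (v₁.val = a ∧ v₂.val = a + 1 ∧ v₃.val = a + 2) ∨
      (v₁.val = a ∧ v₃.val = a + 1 ∧ v₂.val = a + 2) ∨
      (v₂.val = a ∧ v₁.val = a + 1 ∧ v₃.val = a + 2)) :
    IsDoubleChain (expansion (natGraph (relD p N) N) v₁ v₂ v₃ v₄) ∨
      IsTemplate (expansion (natGraph (relD p N) N) v₁ v₂ v₃ v₄) := by
  rcases hT with ⟨h1, h2, h3⟩ | ⟨h1, h3, h2⟩ | ⟨h2, h1, h3⟩
  · left
    have h24 : Linked (relD p N) v₂ v₄ := hv.adj₂₄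
    have h41 : v₄.val ≠ v₁ := fun h => hv.ne₄₁ (Fin.ext h)
    have h43 : v₄.val ≠ v₃ := fun h => hv.ne₄₃ (Fin.ext h)
    rw [h2] at h24
    rw [h1] at h41
    rw [h3] at h43
    have hvN := v₄.2
    have h4 : ((v₄.val = a + 3 ∧ a + 2 < p) ∨ (v₄.val + 1 = N ∧ a + 2 = p)) ∨
        (v₄.val + 1 = a ∨ (v₄.val = p + 1 ∧ a = 0)) := by
      simp only [Linked, relD] at h24
      grind (splits := 60)
    refine ⟨p + 1, N + 1, by omega, by omega, ?_⟩
    rcases h4 with h4 | h4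
    · exact relD_insert_right hp hN (c := a + 1) (by omega) h2 h3 (by omega) h4
    · exact relD_insert_left hp hN (c := a) h1 h2 h3 (by omega) h4
  · exact Or.inr (relD_child_of_last hp hN hv hxw ha h1 h3 h2)
  · right
    obtain ⟨e, he⟩ := relD_reverse hp hN
    obtain ⟨f⟩ := expansion_congr e v₁ v₂ v₃ v₄
    refine IsTemplate.of_iso ?_ f
    rw [expansion_swap]
    refine relD_child_of_last hp hN (hv.map e).swap (hxw.map e).swap (a := p - (a + 2)) (by omega)
      ?_ ?_ ?_
    · rw [he, h3, if_pos (by omega)]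
    · rw [he, h1, if_pos (by omega)]
      omega
    · rw [he, h2, if_pos (by omega)]
      omega

theorem relD_exists_middle {p N : ℕ} (hp : 4 ≤ p) (hN : p + 4 ≤ N) {a b c : ℕ} (hab : a < b)
    (hbc : b < c) (hc : c < N) (h1 : Linked (relD p N) a b)
    (h2 : Linked (relD p N) b c) (h3 : Linked (relD p N) a c) :
    (b = a + 1 ∧ c = a + 2 ∧ b ≠ p) ∨ (a = 0 ∧ b + 2 = N ∧ c + 1 = N) :=
  (relD_triangle hp hN hab hbc hc).1 ⟨(linked_of_lt hab).1 h1, (linked_of_lt hbc).1 h2,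
    (linked_of_lt (hab.trans hbc)).1 h3⟩

theorem relD_site_triangle {p N : ℕ} (hp : 4 ≤ p) (hN : p + 4 ≤ N) {v₁ v₂ v₃ v₄ : Fin N}
    (hv : IsSite (natGraph (relD p N) N) v₁ v₂ v₃ v₄) (h13 : v₁ < v₃) :
    ∃ a, ((v₁.val = a ∧ v₂.val = a + 1 ∧ v₃.val = a + 2) ∨
      (v₁.val = a ∧ v₃.val = a + 1 ∧ v₂.val = a + 2) ∨
      (v₂.val = a ∧ v₁.val = a + 1 ∧ v₃.val = a + 2)) ∧ a + 1 ≠ p ∨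
      a + 2 = N ∧ ((v₁.val = 0 ∧ v₂.val = a ∧ v₃.val = a + 1) ∨
      (v₁.val = 0 ∧ v₂.val = a + 1 ∧ v₃.val = a) ∨
      (v₂.val = 0 ∧ v₁.val = a ∧ v₃.val = a + 1)) := by
  have l12 : Linked (relD p N) v₁ v₂ := hv.adj₁₂
  have l23 : Linked (relD p N) v₂ v₃ := hv.adj₂₃
  have l13 : Linked (relD p N) v₁ v₃ := hv.adj₁₃
  have hlt : v₁.val < v₃.val := h13
  rcases lt_trichotomy v₁.val v₂.val with h12 | h12 | h12
  · rcases lt_trichotomy v₂.val v₃.val with h23 | h23 | h23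
    · rcases relD_exists_middle hp hN h12 h23 v₃.2 l12 l23 l13 with h | h
      · exact ⟨v₁, Or.inl (by omega)⟩
      · exact ⟨v₂, Or.inr (by omega)⟩
    · exact absurd (Fin.ext h23) hv.adj₂₃.ne
    · rcases relD_exists_middle hp hN hlt h23 v₂.2 l13 l23.symm l12 with h | h
      · exact ⟨v₁, Or.inl (by omega)⟩
      · exact ⟨v₃, Or.inr (by omega)⟩
  · exact absurd (Fin.ext h12) hv.adj₁₂.ne
  · rcases relD_exists_middle hp hN h12 hlt v₃.2 l12.symm l13 l23 with h | h
    · exact ⟨v₂, Or.inl (by omega)⟩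
    · exact ⟨v₁, Or.inr (by omega)⟩

/-- The rotation of the chain by `p` takes a triangle of consecutive vertices from `a` on to one
from `a - p` on. -/
theorem rotate_triangle {N p a x y z x' y' z' : ℕ} (hp : 0 < p) (hap : p ≤ a)
    (ha : ((x = a ∧ y = a + 1 ∧ z = a + 2) ∨ (x = a ∧ z = a + 1 ∧ y = a + 2) ∨
      (y = a ∧ x = a + 1 ∧ z = a + 2)) ∨
      a + 2 = N ∧ ((x = 0 ∧ y = a ∧ z = a + 1) ∨ (x = 0 ∧ y = a + 1 ∧ z = a) ∨
      (y = 0 ∧ x = a ∧ z = a + 1)))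
    (hx : x' = if x < p then x + N - p else x - p) (hy : y' = if y < p then y + N - p else y - p)
    (hz : z' = if z < p then z + N - p else z - p) :
    (x' < z' → (x' = a - p ∧ y' = a - p + 1 ∧ z' = a - p + 2) ∨
      (x' = a - p ∧ z' = a - p + 1 ∧ y' = a - p + 2) ∨
      (y' = a - p ∧ x' = a - p + 1 ∧ z' = a - p + 2)) ∧
    (z' < x' → (z' = a - p ∧ y' = a - p + 1 ∧ x' = a - p + 2) ∨
      (z' = a - p ∧ x' = a - p + 1 ∧ y' = a - p + 2) ∨
      (y' = a - p ∧ z' = a - p + 1 ∧ x' = a - p + 2)) := by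
  rcases ha with (ha | ha | ha) | ⟨hN', ha | ha | ha⟩ <;> constructor <;> intro hlt <;> grind

/-- The expansions of level at most three of completed closed chains of two zigzags. -/
theorem relD_child {p N : ℕ} (hp : 4 ≤ p) (hN : p + 4 ≤ N) {v₁ v₂ v₃ v₄ : Fin N}
    (hv : IsSite (natGraph (relD p N) N) v₁ v₂ v₃ v₄)
    (hl : level (expansion (natGraph (relD p N) N) v₁ v₂ v₃ v₄) ≤ 3) :
    IsDoubleChain (expansion (natGraph (relD p N) N) v₁ v₂ v₃ v₄) ∨
      IsTemplate (expansion (natGraph (relD p N) N) v₁ v₂ v₃ v₄) := by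
  -- up to exchanging `v₁` and `v₃`
  wlog h13 : v₁ < v₃ generalizing v₁ v₃
  · rw [expansion_swap]
    rw [expansion_swap] at hl
    exact this hv.swap hl (lt_of_le_of_ne (not_lt.1 h13) hv.adj₁₃.ne.symm)
  have hxw : NoCommonNeighbors (natGraph (relD p N) N) v₁ v₂ v₃ v₄ := by
    intro x w hx h1 h3 hw1 hw3 h2 h4
    have := level_add_two_le_of_common_neighbors hv hx h1 h3 hw1 hw3 h2 h4
    rw [level_relD hp hN] at this
    omega
  obtain ⟨a, ha⟩ := relD_site_triangle hp hN hv h13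
  by_cases hap : a + 2 ≤ p
  · rcases ha with ha | ha
    · exact relD_child_of_le hp hN hv hxw hap ha.1
    · omega
  -- the triangle lies in the second zigzag, which a rotation of the chain moves to the front
  obtain ⟨e, he⟩ := relD_rotate hp hN
  obtain ⟨f⟩ := expansion_congr e v₁ v₂ v₃ v₄
  refine Or.imp (fun h => IsDoubleChain.of_iso h f) (fun h => IsTemplate.of_iso h f) ?_
  obtain ⟨r1, r2⟩ := rotate_triangle (by omega) (by omega) (ha.imp_left And.left)
    (he v₁) (he v₂) (he v₃)
  have haN : a - p + 2 ≤ N - p := by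
    have := v₁.2
    have := v₂.2
    have := v₃.2
    omega
  rcases lt_or_gt_of_ne (e.injective.ne hv.adj₁₃.ne) with hlt | hlt
  · exact relD_child_of_le (by omega) (by omega) (hv.map e) (hxw.map e) haN (r1 hlt)
  · rw [expansion_swap]
    exact relD_child_of_le (by omega) (by omega) (hv.map e).swap (hxw.map e).swap haN (r2 hlt)

/-- The expansions of squares of long cycles. -/
theorem relC_child {N : ℕ} (hN : 7 ≤ N) {v₁ v₂ v₃ v₄ : Fin N}
    (hv : IsSite (natGraph (relC N) N) v₁ v₂ v₃ v₄) :
    Nonempty (expansion (natGraph (relC N) N) v₁ v₂ v₃ v₄ ≃g natGraph (relC (N + 1)) (N + 1)) ∨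
      IsDoubleChain (expansion (natGraph (relC N) N) v₁ v₂ v₃ v₄) := by
  -- by rotational symmetry, `v₂ = 2`
  wlog h2 : v₂.val = 2 generalizing v₁ v₂ v₃ v₄
  · obtain ⟨k, hk, hk2⟩ : ∃ k < N, (if v₂.val + k < N then v₂.val + k else v₂.val + k - N) = 2 := by
      have := v₂.2
      by_cases h : v₂.val ≤ 2
      · exact ⟨2 - v₂.val, by omega, by rw [if_pos (by omega)]; omega⟩
      · exact ⟨N + 2 - v₂.val, by omega, by rw [if_neg (by omega)]; omega⟩
    obtain ⟨e, he⟩ := relC_rotate hk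
    obtain ⟨f⟩ := expansion_congr e v₁ v₂ v₃ v₄
    rcases this (hv.map e) ((he v₂).trans hk2) with ⟨⟨g⟩⟩ | h
    · exact Or.inl ⟨f.trans g⟩
    · exact Or.inr (h.of_iso f)
  wlog h13 : v₁ < v₃ generalizing v₁ v₃
  · rw [expansion_swap]
    exact this hv.swap (lt_of_le_of_ne (not_lt.1 h13) hv.adj₁₃.ne.symm)
  have hlt : v₁.val < v₃.val := h13
  have l12 : Linked (relC N) v₁ v₂ := hv.adj₁₂
  have l23 : Linked (relC N) v₂ v₃ := hv.adj₂₃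
  have l13 : Linked (relC N) v₁ v₃ := hv.adj₁₃
  have l24 : Linked (relC N) v₂ v₄ := hv.adj₂₄
  have h41 : v₄.val ≠ v₁ := fun h => hv.ne₄₁ (Fin.ext h)
  have h43 : v₄.val ≠ v₃ := fun h => hv.ne₄₃ (Fin.ext h)
  rw [h2] at l12 l23 l24
  have hnbr : ∀ i < N, Linked (relC N) 2 i → i = 0 ∨ i = 1 ∨ i = 3 ∨ i = 4 := by
    intro i hi h
    simp only [Linked, relC] at h
    omega
  have h1 := hnbr _ v₁.2 l12.symm
  have h3 := hnbr _ v₃.2 l23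
  have h4 := hnbr _ v₄.2 l24
  have h13' : (v₁.val = 0 ∧ v₃.val = 1) ∨ (v₁.val = 1 ∧ v₃.val = 3) ∨
      (v₁.val = 3 ∧ v₃.val = 4) := by
    rw [linked_of_lt hlt] at l13
    unfold relC at l13
    omega
  rcases h13' with ⟨h1', h3'⟩ | ⟨h1', h3'⟩ | ⟨h1', h3'⟩
  · right
    have h4' : v₄.val = 3 ∨ v₄.val = 4 := by omega
    rcases h4' with h4' | h4'
    · exact ⟨_, _, le_rfl, by omega, relC_split_start_three hN h1' h2 h3' h4'⟩
    · exact ⟨_, _, le_rfl, by omega, relC_split_start_four hN h1' h2 h3' h4'⟩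
  · left
    have h4' : v₄.val = 4 ∨ v₄.val = 0 := by omega
    rcases h4' with h4' | h4'
    · exact relC_insert_right (by omega) h1' h2 h3' h4'
    · exact relC_insert_left (by omega) h1' h2 h3' h4'
  · right
    have h4' : v₄.val = 0 ∨ v₄.val = 1 := by omega
    rcases h4' with h4' | h4'
    · exact ⟨_, _, le_rfl, by omega, relC_split_end_zero hN h1' h2 h3' h4'⟩
    · exact ⟨_, _, le_rfl, by omega, relC_split_end_one hN h1' h2 h3' h4'⟩

end Children

/-! ### The classification of the descendants of level at most three -/

section Descendants

theorem natGraph_relC_five : natGraph (relC 5) 5 = ⊤ := by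
  ext i j
  rw [natGraph_adj, SimpleGraph.top_adj, Ne, Fin.ext_iff]
  have := i.2
  have := j.2
  simp only [Linked, relC]
  omega

/-- The square of the cycle of length six is the octahedron, in which only antipodes, here congruent
modulo three, are not adjacent. -/
theorem linked_relC_six {i j : ℕ} (hi : i < 6) (hj : j < 6) :
    Linked (relC 6) i j ↔ i % 3 ≠ j % 3 := by
  simp only [Linked, relC]
  omega

/-- The complete graph has only one expansion, as its automorphisms move any site to any other. -/
theorem relC_five_child {v₁ v₂ v₃ v₄ : Fin 5}
    (hv : IsSite (natGraph (relC 5) 5) v₁ v₂ v₃ v₄) :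
    Nonempty (expansion (natGraph (relC 5) 5) v₁ v₂ v₃ v₄ ≃g natGraph (relC 6) 6) := by
  have h12 := hv.adj₁₂.ne
  have h23 := hv.adj₂₃.ne
  have h13 := hv.adj₁₃.ne
  have h24 := hv.adj₂₄.ne
  have h41 := hv.ne₄₁
  have h43 := hv.ne₄₃
  have hinj : Function.Injective ![v₁, v₂, v₃, v₄] := by
    intro i j h
    fin_cases i <;> fin_cases j <;> simp_all
  have hinj' : Function.Injective (![1, 2, 3, 4] : Fin 4 → Fin 5) := by decide
  obtain ⟨σ, hσ⟩ : ∃ σ : Equiv.Perm (Fin 5), ∀ i, σ (![v₁, v₂, v₃, v₄] i) = ![1, 2, 3, 4] i := by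
    let f : {x // x ∈ Set.range ![v₁, v₂, v₃, v₄]} ≃
        {x // x ∈ Set.range (![1, 2, 3, 4] : Fin 4 → Fin 5)} :=
      (Equiv.ofInjective _ hinj).symm.trans (Equiv.ofInjective _ hinj')
    refine ⟨f.extendSubtype, fun i => ?_⟩
    rw [Equiv.extendSubtype_apply_of_mem f _ ⟨i, rfl⟩]
    simp only [f, Equiv.trans_apply]
    have : (Equiv.ofInjective ![v₁, v₂, v₃, v₄] hinj).symm ⟨_, ⟨i, rfl⟩⟩ = i :=
      (Equiv.ofInjective ![v₁, v₂, v₃, v₄] hinj).symm_apply_apply i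
    rw [this]
    rfl
  let e : natGraph (relC 5) 5 ≃g natGraph (relC 5) 5 := ⟨σ, by
    intro a b
    rw [natGraph_relC_five]
    simp⟩
  obtain ⟨f⟩ := expansion_congr e v₁ v₂ v₃ v₄
  obtain ⟨g⟩ := relC_insert_right (N := 5) le_rfl (v₁ := e v₁) (v₂ := e v₂) (v₃ := e v₃)
    (v₄ := e v₄) (congrArg Fin.val (hσ 0)) (congrArg Fin.val (hσ 1)) (congrArg Fin.val (hσ 2))
    (congrArg Fin.val (hσ 3))
  exact ⟨f.trans g⟩

/-- A labelling of the octahedron that takes the given vertices to `1`, `2`, `3` and `4`. -/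
def octahedronLabel (a b c d i : ℕ) : ℕ :=
  if i = a then 1 else if i = d then 4 else if i = b then 2 else if i = c then 3 else
    if i % 3 = b % 3 then 5 else 0

/-- `octahedronLabel` is an automorphism of the octahedron if `a`, `b`, `c` form a triangle and `d`
is the antipode of `a`. -/
theorem octahedron_labels : ∀ a b c d : Fin 6, a.val % 3 ≠ b.val % 3 → b.val % 3 ≠ c.val % 3 →
    a.val % 3 ≠ c.val % 3 → a.val % 3 = d.val % 3 → d.val ≠ a.val → ∀ i j : Fin 6,
    octahedronLabel a b c d i < 6 ∧
      (i < j → octahedronLabel a b c d i ≠ octahedronLabel a b c d j) ∧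
      (octahedronLabel a b c d i % 3 ≠ octahedronLabel a b c d j % 3 ↔ i.val % 3 ≠ j.val % 3) := by
  decide +kernel

/-- The octahedron has only one expansion, again by its symmetry. -/
theorem relC_six_child {v₁ v₂ v₃ v₄ : Fin 6}
    (hv : IsSite (natGraph (relC 6) 6) v₁ v₂ v₃ v₄) :
    Nonempty (expansion (natGraph (relC 6) 6) v₁ v₂ v₃ v₄ ≃g natGraph (relC 7) 7) := by
  have h12 := (linked_relC_six v₁.2 v₂.2).1 hv.adj₁₂
  have h23 := (linked_relC_six v₂.2 v₃.2).1 hv.adj₂₃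
  have h13 := (linked_relC_six v₁.2 v₃.2).1 hv.adj₁₃
  have h24 := (linked_relC_six v₂.2 v₄.2).1 hv.adj₂₄
  have h41 : v₄.val ≠ v₁ := fun h => hv.ne₄₁ (Fin.ext h)
  have h43 : v₄.val ≠ v₃ := fun h => hv.ne₄₃ (Fin.ext h)
  -- up to exchanging `v₁` and `v₃`, the vertex `v₄` is the antipode of `v₁`
  wlog h14 : v₁.val % 3 = v₄.val % 3 generalizing v₁ v₃
  · rw [expansion_swap]
    exact this hv.swap h23.symm h12.symm h13.symm h43 h41 (by omega)
  have hlab := octahedron_labels v₁ v₂ v₃ v₄ h12 h23 h13 h14 h41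
  have hlt : ∀ i < 6, octahedronLabel v₁ v₂ v₃ v₄ i < 6 := fun i hi => (hlab ⟨i, hi⟩ ⟨i, hi⟩).1
  obtain ⟨e, he⟩ := exists_natGraph_iso (r := relC 6) (r' := relC 6) (N := 6)
    (octahedronLabel v₁ v₂ v₃ v₄) hlt
    (fun i j hij hj => (hlab ⟨i, hij.trans hj⟩ ⟨j, hj⟩).2.1 hij) (fun i j hij hj => by
      rw [← linked_of_lt (r := relC 6) hij, linked_relC_six (hij.trans hj) hj,
        linked_relC_six (hlt i (hij.trans hj)) (hlt j hj)]
      exact (hlab ⟨i, hij.trans hj⟩ ⟨j, hj⟩).2.2)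
  unfold octahedronLabel at he
  obtain ⟨f⟩ := expansion_congr e v₁ v₂ v₃ v₄
  obtain ⟨g⟩ := relC_insert_right (N := 6) (by norm_num) (v₁ := e v₁) (v₂ := e v₂) (v₃ := e v₃)
    (v₄ := e v₄) (by rw [he, if_pos rfl])
    (by rw [he, if_neg (by omega), if_neg (by omega), if_pos rfl])
    (by rw [he, if_neg (by omega), if_neg (by omega), if_neg (by omega), if_pos rfl])
    (by rw [he, if_neg (by omega), if_pos rfl])
  exact ⟨f.trans g⟩

/-- A `K₅` descendant is the square of a cycle, a completed chain of two or three zigzags, or has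
level at least four. -/
theorem IsK5Descendant.classification {V : Type u} {G : SimpleGraph V} (hG : IsK5Descendant G) :
    Finite V ∧ ((∃ N, 5 ≤ N ∧ Nonempty (G ≃g natGraph (relC N) N)) ∨ IsDoubleChain G ∨
      IsTemplate G ∨ 4 ≤ level G) := by
  induction hG with
  | @complete V hV =>
    have hfin : Finite V := Nat.finite_of_card_ne_zero (by omega)
    refine ⟨hfin, Or.inl ⟨5, le_rfl, ?_⟩⟩
    rw [natGraph_relC_five]
    exact ⟨SimpleGraph.Iso.completeGraph ((Finite.equivFinOfCardEq hV))⟩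
  | @child V W G H hG hGH ih =>
    obtain ⟨hfin, ih⟩ := ih
    obtain ⟨v₁, v₂, v₃, v₄, hv, ⟨f⟩⟩ := isChild_iff.1 hGH
    refine ⟨Finite.of_equiv _ f.symm.toEquiv, ?_⟩
    rcases ih with ⟨N, hN, ⟨e⟩⟩ | ⟨p, N, hp, hN, ⟨e⟩⟩ | ⟨p, q, s, t, N, hP, ⟨e⟩⟩ | hl
    · obtain ⟨g⟩ := expansion_congr e v₁ v₂ v₃ v₄
      have hv' := hv.map e
      have hcases : N = 5 ∨ N = 6 ∨ 7 ≤ N := by omega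
      rcases hcases with rfl | rfl | hN'
      · obtain ⟨k⟩ := relC_five_child hv'
        exact Or.inl ⟨6, by norm_num, ⟨(f.trans g).trans k⟩⟩
      · obtain ⟨k⟩ := relC_six_child hv'
        exact Or.inl ⟨7, by norm_num, ⟨(f.trans g).trans k⟩⟩
      · rcases relC_child hN' hv' with ⟨⟨k⟩⟩ | h
        · exact Or.inl ⟨N + 1, by omega, ⟨(f.trans g).trans k⟩⟩
        · exact Or.inr (Or.inl (h.of_iso (f.trans g)))
    · obtain ⟨g⟩ := expansion_congr e v₁ v₂ v₃ v₄
      by_cases hl : 4 ≤ level H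
      · exact Or.inr (Or.inr (Or.inr hl))
      · rw [level_eq_of_iso (f.trans g)] at hl
        rcases relD_child hp hN (hv.map e) (by omega) with h | h
        · exact Or.inr (Or.inl (h.of_iso (f.trans g)))
        · exact Or.inr (Or.inr (Or.inl (h.of_iso (f.trans g))))
    · obtain ⟨g⟩ := expansion_congr e v₁ v₂ v₃ v₄
      by_cases hl : 4 ≤ level H
      · exact Or.inr (Or.inr (Or.inr hl))
      · rw [level_eq_of_iso (f.trans g)] at hl
        exact Or.inr (Or.inr (Or.inl ((relE_child hP (hv.map e) (by omega)).of_iso (f.trans g))))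
    · have := level_le_level_expansion hv
      rw [level_eq_of_iso f]
      exact Or.inr (Or.inr (Or.inr (by omega)))

theorem isSite_natGraph {r : ℕ → ℕ → Prop} {N v₁ v₂ v₃ v₄ : ℕ} {h1 : v₁ < N} {h2 : v₂ < N}
    {h3 : v₃ < N} {h4 : v₄ < N} (h12 : Linked r v₁ v₂) (h23 : Linked r v₂ v₃)
    (h13 : Linked r v₁ v₃) (h24 : Linked r v₂ v₄) (h41 : v₄ ≠ v₁) (h43 : v₄ ≠ v₃) :
    IsSite (natGraph r N) ⟨v₁, h1⟩ ⟨v₂, h2⟩ ⟨v₃, h3⟩ ⟨v₄, h4⟩ :=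
  ⟨h12, h23, h13, h24, fun h => h41 (congrArg Fin.val h), fun h => h43 (congrArg Fin.val h)⟩

theorem isDescendantShape_relC {N : ℕ} (hN : 5 ≤ N) :
    IsDescendantShape.{u} (natGraph (relC N) N) := by
  induction N, hN using Nat.le_induction with
  | base =>
    rintro V H ⟨e⟩
    rw [natGraph_relC_five] at e
    have : H = ⊤ := by
      ext x y
      rw [← e.map_adj_iff]
      simp
    subst this
    exact .complete (by rw [Nat.card_congr e.toEquiv]; simp)
  | succ N hN ih =>
    refine ih.expansion (v₁ := ⟨1, by omega⟩) (v₂ := ⟨2, by omega⟩) (v₃ := ⟨3, by omega⟩)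
      (v₄ := ⟨4, by omega⟩) (isSite_natGraph ?_ ?_ ?_ ?_ (by omega) (by omega))
      (relC_insert_right hN rfl rfl rfl rfl)
    all_goals exact Or.inl ⟨by omega, by unfold relC; omega⟩

theorem isDescendantShape_relD {p N : ℕ} (hp : 4 ≤ p) (hN : p + 4 ≤ N) :
    IsDescendantShape.{u} (natGraph (relD p N) N) := by
  obtain ⟨k, rfl⟩ : ∃ k, p = 4 + k := ⟨p - 4, by omega⟩
  clear hp
  induction k generalizing N with
  | zero =>
    obtain ⟨M, rfl⟩ : ∃ M, N = M + 1 := ⟨N - 1, by omega⟩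
    refine (isDescendantShape_relC (N := M) (by omega)).expansion
      (v₁ := ⟨0, by omega⟩) (v₂ := ⟨2, by omega⟩) (v₃ := ⟨1, by omega⟩) (v₄ := ⟨3, by omega⟩)
      (isSite_natGraph ?_ ?_ ?_ ?_ (by omega) (by omega))
      (relC_split_start_three (by omega) rfl rfl rfl rfl)
    all_goals
      unfold Linked relC
      omega
  | succ k ih =>
    obtain ⟨M, rfl⟩ : ∃ M, N = M + 1 := ⟨N - 1, by omega⟩
    refine (ih (N := M) (by omega)).expansion (v₁ := ⟨0, by omega⟩) (v₂ := ⟨1, by omega⟩)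
      (v₃ := ⟨2, by omega⟩) (v₄ := ⟨3, by omega⟩)
      (isSite_natGraph ?_ ?_ ?_ ?_ (by omega) (by omega))
      (relD_insert_right (c := 1) (by omega) (by omega) rfl rfl rfl (by omega)
        (Or.inl ⟨rfl, by omega⟩))
    all_goals
      unfold Linked relD
      omega

/-- The templates with a distinguished zigzag arise from a chain of two zigzags, by splitting off
the first three triangles of the first zigzag and lengthening the result. -/
theorem isDescendantShape_relE_of_eq {p q N : ℕ} (hp : 4 ≤ p) (hq : p < q) (hN : q + 4 ≤ N) :
    IsDescendantShape.{u} (natGraph (relE p q (p + 1) (q - 1) N) N) := by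
  obtain ⟨k, rfl⟩ : ∃ k, p = 4 + k := ⟨p - 4, by omega⟩
  clear hp
  induction k generalizing q N with
  | zero =>
    obtain ⟨M, rfl⟩ : ∃ M, N = M + 1 := ⟨N - 1, by omega⟩
    obtain ⟨m, rfl⟩ : ∃ m, q = m + 1 := ⟨q - 1, by omega⟩
    refine (isDescendantShape_relD (p := m) (N := M) (by omega) (by omega)).expansion
      (v₁ := ⟨0, by omega⟩) (v₂ := ⟨2, by omega⟩) (v₃ := ⟨1, by omega⟩) (v₄ := ⟨3, by omega⟩)
      (isSite_natGraph ?_ ?_ ?_ ?_ (by omega) (by omega))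
      (relD_split_two_three (by omega) (by omega) rfl rfl rfl rfl)
    all_goals
      unfold Linked relD
      omega
  | succ k ih =>
    obtain ⟨M, rfl⟩ : ∃ M, N = M + 1 := ⟨N - 1, by omega⟩
    obtain ⟨m, rfl⟩ : ∃ m, q = m + 1 := ⟨q - 1, by omega⟩
    have hm : m + 1 - 1 = m - 1 + 1 := by omega
    rw [hm]
    refine (ih (q := m) (N := M) (by omega) (by omega)).expansion
      (v₁ := ⟨0, by omega⟩) (v₂ := ⟨1, by omega⟩) (v₃ := ⟨2, by omega⟩) (v₄ := ⟨3, by omega⟩)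
      (isSite_natGraph ?_ ?_ ?_ ?_ (by omega) (by omega))
      (relE_insert_first_right (c := 1) (by unfold Params; omega) rfl rfl rfl (by omega)
        (Or.inl ⟨rfl, by omega⟩))
    all_goals
      unfold Linked relE
      omega

/-- The templates without a distinguished zigzag arise by twisting a zigzag with two triangles, and
lengthening it. -/
theorem isDescendantShape_relE_of_ne {p q N : ℕ} (hp : 4 ≤ p) (hq : p + 4 ≤ q) (hN : q + 4 ≤ N) :
    IsDescendantShape.{u} (natGraph (relE p q (q - 1) (p + 1) N) N) := by
  induction q, hq using Nat.le_induction generalizing N with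
  | base =>
    obtain ⟨M, rfl⟩ : ∃ M, N = M + 1 := ⟨N - 1, by omega⟩
    refine (isDescendantShape_relE_of_eq (p := p) (q := p + 3) (N := M) hp (by omega)
      (by omega)).expansion
      (v₁ := ⟨p, by omega⟩) (v₂ := ⟨p + 2, by omega⟩) (v₃ := ⟨p + 1, by omega⟩)
      (v₄ := ⟨p + 3, by omega⟩)
      (isSite_natGraph ?_ ?_ ?_ ?_ (by omega) (by omega))
      (relE_twist_end (by omega) (by omega) rfl rfl rfl rfl)
    · exact relE_linked_add_two (by omega) (by omega)
    · exact (linked_add_one (Or.inl rfl)).symm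
    · exact linked_add_one (Or.inl rfl)
    · exact linked_add_one (Or.inl rfl)
  | succ q hq ih =>
    obtain ⟨M, rfl⟩ : ∃ M, N = M + 1 := ⟨N - 1, by omega⟩
    refine (ih (N := M) (by omega)).expansion
      (v₁ := ⟨p, by omega⟩) (v₂ := ⟨p + 1, by omega⟩) (v₃ := ⟨p + 2, by omega⟩)
      (v₄ := ⟨p + 3, by omega⟩)
      (isSite_natGraph ?_ ?_ ?_ ?_ (by omega) (by omega))
      (relE_insert_middle_right (c := p + 1) (by unfold Params; omega) rfl rfl rfl (by omega)
        (by omega) (Or.inr ⟨by omega, rfl, by omega, by omega, rfl⟩)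
        (Or.inl ⟨rfl, by omega⟩))
    · exact linked_add_one (Or.inl rfl)
    · exact linked_add_one (Or.inl rfl)
    · exact relE_linked_add_two (by omega) (by omega)
    · exact relE_linked_add_two (by omega) (by omega)

theorem isDescendantShape_relE {p q s t N : ℕ} (h : Params p q s t N) :
    IsDescendantShape.{u} (natGraph (relE p q s t N) N) := by
  obtain ⟨hp, hq, hN, ⟨rfl, ht⟩ | ⟨hs, rfl, hpq⟩⟩ := h
  · obtain rfl : t = q - 1 := by omega
    exact isDescendantShape_relE_of_eq hp hq hN
  · obtain rfl : s = q - 1 := by omega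
    exact isDescendantShape_relE_of_ne hp hpq hN

/-- An expansion of the square of a long cycle is a chain of two zigzags, which has level two, and
the squares of shorter cycles expand to those of longer ones. -/
theorem level_relC_le {N : ℕ} (hN : 5 ≤ N) : level (natGraph (relC N) N) ≤ 2 := by
  have long : ∀ N, 7 ≤ N → level (natGraph (relC N) N) ≤ 2 := by
    intro N hN
    have hv : IsSite (natGraph (relC N) N) ⟨0, by omega⟩ ⟨2, by omega⟩ ⟨1, by omega⟩
        ⟨3, by omega⟩ := by
      refine isSite_natGraph ?_ ?_ ?_ ?_ (by omega) (by omega)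
      all_goals
        unfold Linked relC
        omega
    obtain ⟨e⟩ := relC_split_start_three hN (v₁ := ⟨0, by omega⟩) (v₂ := ⟨2, by omega⟩)
      (v₃ := ⟨1, by omega⟩) (v₄ := ⟨3, by omega⟩) rfl rfl rfl rfl
    have := level_le_level_expansion hv
    rwa [level_eq_of_iso e, level_relD (by omega) (by omega)] at this
  have step : ∀ N, 5 ≤ N →
      level (natGraph (relC N) N) ≤ level (natGraph (relC (N + 1)) (N + 1)) := by
    intro N hN
    have hv : IsSite (natGraph (relC N) N) ⟨1, by omega⟩ ⟨2, by omega⟩ ⟨3, by omega⟩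
        ⟨4, by omega⟩ := by
      refine isSite_natGraph ?_ ?_ ?_ ?_ (by omega) (by omega)
      all_goals exact Or.inl ⟨by omega, by unfold relC; omega⟩
    obtain ⟨e⟩ := relC_insert_right hN (v₁ := ⟨1, by omega⟩) (v₂ := ⟨2, by omega⟩)
      (v₃ := ⟨3, by omega⟩) (v₄ := ⟨4, by omega⟩) rfl rfl rfl rfl
    have := level_le_level_expansion hv
    rwa [level_eq_of_iso e] at this
  exact ((step N hN).trans (step (N + 1) (by omega))).trans (long (N + 1 + 1) (by omega))

/-- A graph is a descendant of level three if and only if it is a template graph. -/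
theorem isK5Descendant_and_level_eq_three_iff {V : Type u} {G : SimpleGraph V} :
    IsK5Descendant G ∧ level G = 3 ↔ IsTemplate G := by
  constructor
  · rintro ⟨hG, hl⟩
    obtain ⟨-, ⟨N, hN, ⟨e⟩⟩ | ⟨p, N, hp, hN, ⟨e⟩⟩ | h | h⟩ := hG.classification
    · have := level_relC_le hN
      rw [← level_eq_of_iso e] at this
      omega
    · have := level_relD hp hN
      rw [← level_eq_of_iso e] at this
      omega
    · exact h
    · omega
  · rintro ⟨p, q, s, t, N, hP, ⟨e⟩⟩
    exact ⟨isDescendantShape_relE hP _ _ ⟨e⟩, by rw [level_eq_of_iso e, level_relE hP]⟩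

end Descendants

/-! ### The templates as labelled graphs -/

section Templates

variable {z : Fin 3 → ℕ}

/-- The position of the first end of each zigzag of a closed chain of three, starting with the
zigzag `1`. -/
def chainStart (z : Fin 3 → ℕ) : Fin 3 → ℕ := ![z 1 + z 2 + 2, 0, z 1 + 1]

/-- The position along the chain of a vertex of a closed chain of three zigzags. -/
def chainPos (z : Fin 3 → ℕ) (x : ChainVertex z) : ℕ := chainStart z x.1 + x.2

theorem chainPos_lt (x : ChainVertex z) : chainPos z x < z 0 + z 1 + z 2 + 3 := by
  obtain ⟨i, j⟩ := x
  have := j.2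
  fin_cases i <;> simp [chainPos, chainStart] at this ⊢ <;> omega

theorem chainPos_injective : Function.Injective (chainPos z) := by
  rintro ⟨i, j⟩ ⟨i', j'⟩ h
  have h1 := j.2
  have h2 := j'.2
  have hi : i = i' := by
    fin_cases i <;> fin_cases i' <;> simp [chainPos, chainStart] at h h1 h2 ⊢ <;> omega
  subst hi
  have : j = j' := by
    apply Fin.ext
    simpa [chainPos] using h
  rw [this]

theorem chainPos_chainVertex (i : Fin 3) (j : Fin (z i + 2)) :
    chainPos z (chainVertex z i j) =
      if chainStart z i + j = z 0 + z 1 + z 2 + 3 then 0 else chainStart z i + j := by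
  have hj := j.2
  unfold chainVertex
  split_ifs with h1 h2 h2
  · fin_cases i <;> simp [chainStart] at h1 h2 <;> omega
  · rfl
  · fin_cases i <;> simp [chainPos, chainStart] at h1 h2 hj ⊢ <;> omega
  · fin_cases i <;> simp [chainPos, chainStart] at h1 h2 hj ⊢ <;> omega

/-- The edges of a closed chain of three zigzags. -/
def relChain (p q N i j : ℕ) : Prop :=
  j = i + 1 ∨ (j = i + 2 ∧ i + 1 ≠ p ∧ i + 1 ≠ q) ∨ (i = 0 ∧ j + 1 = N) ∨ (i = 0 ∧ j + 2 = N)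

/-- The last end of the zigzag `0` is the vertex at the position `0`, so the two edges of this
zigzag at that end join the position `0` to the last two positions. -/
theorem closedChain_adj_iff_of_lt (h0 : 3 ≤ z 0) (h1 : 3 ≤ z 1) {x y : ChainVertex z}
    (hxy : chainPos z x < chainPos z y) : (closedChain z).Adj x y ↔
      relChain (z 1 + 1) (z 1 + z 2 + 2) (z 0 + z 1 + z 2 + 3) (chainPos z x) (chainPos z y) := by
  have hy := chainPos_lt y
  constructor
  · intro h
    rw [closedChain, SimpleGraph.iSup_adj] at h
    obtain ⟨i, -, a, b, hab, rfl, rfl⟩ := h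
    rw [zigzag, SimpleGraph.fromRel_adj] at hab
    obtain ⟨hne, hab⟩ := hab
    have hX := chainPos_chainVertex i a
    have hY := chainPos_chainVertex i b
    have ha := a.2
    have hb := b.2
    rw [Ne, Fin.ext_iff] at hne
    generalize chainPos z (chainVertex z i a) = X at hX hxy ⊢
    generalize chainPos z (chainVertex z i b) = Y at hY hxy hy ⊢
    unfold relChain
    have s0 : chainStart z 0 = z 1 + z 2 + 2 := rfl
    have s1 : chainStart z 1 = 0 := rfl
    have s2 : chainStart z 2 = z 1 + 1 := rfl
    obtain rfl | rfl | rfl : i = 0 ∨ i = 1 ∨ i = 2 := by fin_cases i <;> simp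
    · rw [s0] at hX hY
      grind (splits := 60)
    · rw [s1] at hX hY
      grind (splits := 60)
    · rw [s2] at hX hY
      grind (splits := 60)
  · intro h
    have key : ∀ (i : Fin 3) (a b : ℕ), a < z i + 2 → b < z i + 2 → (b = a + 1 ∨ b = a + 2) →
        ((chainStart z i + a = chainPos z x ∧ (chainStart z i + b = chainPos z y)) ∨
          (chainStart z i + a = chainPos z y ∧ chainStart z i + b = z 0 + z 1 + z 2 + 3 ∧
            chainPos z x = 0)) → (closedChain z).Adj x y := by
      intro i a b ha hb hab hpos
      have hadj : (zigzag (z i)).Adj ⟨a, ha⟩ ⟨b, hb⟩ := by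
        rw [zigzag, SimpleGraph.fromRel_adj]
        refine ⟨?_, Or.inl hab⟩
        rw [Ne, Fin.mk.injEq]
        omega
      have hne : x ≠ y := by
        rintro rfl
        exact lt_irrefl _ hxy
      rw [closedChain, SimpleGraph.iSup_adj]
      refine ⟨i, hne, ?_⟩
      rcases hpos with ⟨hp1, hp2⟩ | ⟨hp1, hp2, hp3⟩
      · refine ⟨_, _, hadj, chainPos_injective ?_, chainPos_injective ?_⟩
        · rw [chainPos_chainVertex, if_neg (by dsimp; omega)]
          exact hp1
        · rw [chainPos_chainVertex, if_neg (by dsimp; omega)]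
          exact hp2
      · refine ⟨_, _, hadj.symm, chainPos_injective ?_, chainPos_injective ?_⟩
        · rw [chainPos_chainVertex, if_pos (by dsimp; omega), hp3]
        · rw [chainPos_chainVertex, if_neg (by dsimp; omega)]
          exact hp1
    have s0 : chainStart z 0 = z 1 + z 2 + 2 := rfl
    have s1 : chainStart z 1 = 0 := rfl
    have s2 : chainStart z 2 = z 1 + 1 := rfl
    unfold relChain at h
    rcases h with h | h | h | h
    · by_cases c1 : chainPos z y ≤ z 1 + 1
      · exact key 1 (chainPos z x) (chainPos z y) (by omega) (by omega) (by omega) (by omega)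
      · by_cases c2 : chainPos z y ≤ z 1 + z 2 + 2
        · exact key 2 (chainPos z x - (z 1 + 1)) (chainPos z y - (z 1 + 1)) (by omega) (by omega)
            (by omega) (by omega)
        · exact key 0 (chainPos z x - (z 1 + z 2 + 2)) (chainPos z y - (z 1 + z 2 + 2)) (by omega)
            (by omega) (by omega) (by omega)
    · by_cases c1 : chainPos z y ≤ z 1 + 1
      · exact key 1 (chainPos z x) (chainPos z y) (by omega) (by omega) (by omega) (by omega)
      · by_cases c2 : chainPos z y ≤ z 1 + z 2 + 2
        · exact key 2 (chainPos z x - (z 1 + 1)) (chainPos z y - (z 1 + 1)) (by omega) (by omega)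
            (by omega) (by omega)
        · exact key 0 (chainPos z x - (z 1 + z 2 + 2)) (chainPos z y - (z 1 + z 2 + 2)) (by omega)
            (by omega) (by omega) (by omega)
    · exact key 0 (z 0) (z 0 + 1) (by omega) (by omega) (by omega) (by omega)
    · exact key 0 (z 0 - 1) (z 0 + 1) (by omega) (by omega) (by omega) (by omega)

/-- A graph on the vertices of a chain whose edges are described by `r` in terms of positions. -/
theorem nonempty_iso_natGraph {G : SimpleGraph (ChainVertex z)} {r : ℕ → ℕ → Prop}
    (h : ∀ x y, chainPos z x < chainPos z y → (G.Adj x y ↔ r (chainPos z x) (chainPos z y))) :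
    Nonempty (G ≃g natGraph r (z 0 + z 1 + z 2 + 3)) := by
  let f : ChainVertex z → Fin (z 0 + z 1 + z 2 + 3) := fun x => ⟨chainPos z x, chainPos_lt x⟩
  have hf : Function.Injective f := fun x y hxy => chainPos_injective (congrArg Fin.val hxy)
  have hcard : Nat.card (ChainVertex z) = Nat.card (Fin (z 0 + z 1 + z 2 + 3)) := by
    simp [Fin.sum_univ_three]
    omega
  refine ⟨⟨Equiv.ofBijective f (hf.bijective_of_nat_card_le hcard.ge), ?_⟩⟩
  intro x y
  change Linked r (chainPos z x) (chainPos z y) ↔ _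
  rcases lt_trichotomy (chainPos z x) (chainPos z y) with hlt | heq | hlt
  · rw [linked_of_lt hlt, h x y hlt]
  · rw [chainPos_injective heq]
    simp [Linked]
  · rw [linked_comm, linked_of_lt hlt, G.adj_comm, h y x hlt]

theorem eq_iff_chainPos {x y : ChainVertex z} : x = y ↔ chainPos z x = chainPos z y :=
  chainPos_injective.eq_iff.symm

theorem chainPos_firstChord (h0 : 3 ≤ z 0) (i : Fin 3) :
    chainPos z (firstChord z i) = chainStart z i + 1 := by
  rw [firstChord, chainPos_chainVertex, if_neg]
  · rfl
  · fin_cases i <;> simp [chainStart] <;> omega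

theorem chainPos_lastChord (i : Fin 3) :
    chainPos z (lastChord z i) = chainStart z i + z i := by
  rw [lastChord, chainPos_chainVertex, if_neg]
  fin_cases i <;> simp [chainStart] <;> omega

/-- Along the chain that starts with the zigzag `1`, the distinguished zigzag `2` comes second,
between the positions `z 1 + 1` and `z 1 + z 2 + 2`. -/
theorem templateA_iso (h0 : 3 ≤ z 0) (h1 : 3 ≤ z 1) :
    Nonempty (templateA z ≃g natGraph (relE (z 1 + 1) (z 1 + z 2 + 2) (z 1 + 2) (z 1 + z 2 + 1)
      (z 0 + z 1 + z 2 + 3)) (z 0 + z 1 + z 2 + 3)) := by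
  refine nonempty_iso_natGraph fun x y hxy => ?_
  have hy := chainPos_lt y
  have s0 : chainStart z 0 = z 1 + z 2 + 2 := rfl
  have s1 : chainStart z 1 = 0 := rfl
  have s2 : chainStart z 2 = z 1 + 1 := rfl
  simp only [templateA, SimpleGraph.sup_adj, SimpleGraph.edge_adj,
    closedChain_adj_iff_of_lt h0 h1 hxy, eq_iff_chainPos, ne_eq,
    chainPos_firstChord h0, chainPos_lastChord, s0, s1, s2]
  unfold relChain relE
  generalize chainPos z x = i at *
  generalize chainPos z y = j at *
  grind (splits := 60)

theorem templateB_iso (h0 : 3 ≤ z 0) (h1 : 3 ≤ z 1) (h2 : 3 ≤ z 2) :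
    Nonempty (templateB z ≃g natGraph (relE (z 1 + 1) (z 1 + z 2 + 2) (z 1 + z 2 + 1) (z 1 + 2)
      (z 0 + z 1 + z 2 + 3)) (z 0 + z 1 + z 2 + 3)) := by
  refine nonempty_iso_natGraph fun x y hxy => ?_
  have hy := chainPos_lt y
  have s0 : chainStart z 0 = z 1 + z 2 + 2 := rfl
  have s1 : chainStart z 1 = 0 := rfl
  have s2 : chainStart z 2 = z 1 + 1 := rfl
  have h3 : ∀ P : Fin 3 → Prop, (∃ i, P i) ↔ P 0 ∨ P 1 ∨ P 2 := fun P => by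
    simp [Fin.exists_fin_succ]
  have t0 : (0 : Fin 3) + 1 = 1 := rfl
  have t1 : (1 : Fin 3) + 1 = 2 := rfl
  have t2 : (2 : Fin 3) + 1 = 0 := rfl
  simp only [templateB, SimpleGraph.sup_adj, SimpleGraph.iSup_adj, SimpleGraph.edge_adj,
    closedChain_adj_iff_of_lt h0 h1 hxy, h3, t0, t1, t2,
    eq_iff_chainPos, ne_eq, chainPos_firstChord h0, chainPos_lastChord, s0, s1, s2]
  unfold relChain relE
  generalize chainPos z x = i at *
  generalize chainPos z y = j at *
  grind (splits := 60)

theorem isTemplate_iff {V : Type u} {G : SimpleGraph V} : IsTemplate G ↔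
    ∃ z : Fin 3 → ℕ, (3 ≤ z 0 ∧ 3 ≤ z 1 ∧ Nonempty (G ≃g templateA z)) ∨
      (3 ≤ z 0 ∧ 3 ≤ z 1 ∧ 3 ≤ z 2 ∧ Nonempty (G ≃g templateB z)) := by
  constructor
  · rintro ⟨p, q, s, t, N, ⟨hp, hq, hN, hst⟩, ⟨e⟩⟩
    obtain ⟨z, hz0, hz1, hz2⟩ : ∃ z : Fin 3 → ℕ, z 0 = N - q - 1 ∧ z 1 = p - 1 ∧
      z 2 = q - p - 1 := ⟨![N - q - 1, p - 1, q - p - 1], rfl, rfl, rfl⟩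
    refine ⟨z, ?_⟩
    have e1 : N = z 0 + z 1 + z 2 + 3 := by omega
    have e2 : p = z 1 + 1 := by omega
    have e3 : q = z 1 + z 2 + 2 := by omega
    rcases hst with ⟨hs, ht⟩ | ⟨hs, ht, hpq⟩
    · left
      obtain rfl : s = z 1 + 2 := by omega
      obtain rfl : t = z 1 + z 2 + 1 := by omega
      clear hz0 hz1 hz2
      subst e1 e2 e3
      obtain ⟨f⟩ := templateA_iso (z := z) (by omega) (by omega)
      exact ⟨by omega, by omega, ⟨e.trans f.symm⟩⟩
    · right
      obtain rfl : t = z 1 + 2 := by omega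
      obtain rfl : s = z 1 + z 2 + 1 := by omega
      clear hz0 hz1 hz2
      subst e1 e2 e3
      obtain ⟨f⟩ := templateB_iso (z := z) (by omega) (by omega) (by omega)
      exact ⟨by omega, by omega, by omega, ⟨e.trans f.symm⟩⟩
  · rintro ⟨z, ⟨h0, h1, ⟨e⟩⟩ | ⟨h0, h1, h2, ⟨e⟩⟩⟩
    · obtain ⟨f⟩ := templateA_iso h0 h1
      exact ⟨_, _, _, _, _, by unfold Params; omega, ⟨e.trans f⟩⟩
    · obtain ⟨f⟩ := templateB_iso h0 h1 h2
      exact ⟨_, _, _, _, _, by unfold Params; omega, ⟨e.trans f⟩⟩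

end Templates

/-! ### Recovering the zigzags from the graph -/

section FullZigzags

variable {V : Type u} {W : Type v}

/-- `f 0, …, f (L + 1)` is a zigzag with `L` triangles that cannot be extended at either end. -/
structure IsFullZigzag (G : SimpleGraph V) (L : ℕ) (f : ℕ → V) : Prop where
  injOn : ∀ i j, i ≤ L + 1 → j ≤ L + 1 → f i = f j → i = j
  adj_add_one : ∀ i, i ≤ L → G.Adj (f i) (f (i + 1))
  adj_add_two : ∀ i, i < L → G.Adj (f i) (f (i + 2))
  start_maximal : ∀ x, x ≠ f 2 → G.Adj x (f 0) → ¬ G.Adj x (f 1)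
  end_maximal : ∀ x, x ≠ f (L - 1) → G.Adj x (f L) → ¬ G.Adj x (f (L + 1))

theorem IsFullZigzag.map {G : SimpleGraph V} {H : SimpleGraph W} (e : G ≃g H) {L : ℕ} {f : ℕ → V}
    (h : IsFullZigzag G L f) : IsFullZigzag H L (fun i => e (f i)) where
  injOn i j hi hj hij := h.injOn i j hi hj (e.injective hij)
  adj_add_one i hi := e.map_adj_iff.2 (h.adj_add_one i hi)
  adj_add_two i hi := e.map_adj_iff.2 (h.adj_add_two i hi)
  start_maximal x hx h0 h1 := by
    obtain ⟨y, rfl⟩ := e.surjective x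
    exact h.start_maximal y (fun h => hx (congrArg e h)) (e.map_adj_iff.1 h0) (e.map_adj_iff.1 h1)
  end_maximal x hx h0 h1 := by
    obtain ⟨y, rfl⟩ := e.surjective x
    exact h.end_maximal y (fun h => hx (congrArg e h)) (e.map_adj_iff.1 h0) (e.map_adj_iff.1 h1)

theorem IsFullZigzag.reverse {G : SimpleGraph V} {L : ℕ} (hL : 1 ≤ L) {f : ℕ → V}
    (h : IsFullZigzag G L f) : IsFullZigzag G L (fun i => f (L + 1 - i)) where
  injOn i j hi hj hij := by
    have := h.injOn _ _ (by omega) (by omega) hij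
    omega
  adj_add_one i hi := by
    have := (h.adj_add_one (L - i) (by omega)).symm
    rwa [show L - i + 1 = L + 1 - i by omega, show L - i = L + 1 - (i + 1) by omega] at this
  adj_add_two i hi := by
    have := (h.adj_add_two (L - 1 - i) (by omega)).symm
    rwa [show L - 1 - i + 2 = L + 1 - i by omega, show L - 1 - i = L + 1 - (i + 2) by omega] at this
  start_maximal x hx h0 h1 := by
    refine h.end_maximal x (by rwa [show L - 1 = L + 1 - 2 by omega]) ?_ h0
    rwa [show L + 1 - 1 = L by omega] at h1
  end_maximal x hx h0 h1 := by
    refine h.start_maximal x (by rwa [show L + 1 - (L - 1) = 2 by omega] at hx) ?_ ?_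
    · rwa [show L + 1 - (L + 1) = 0 by omega] at h1
    · rwa [show L + 1 - L = 1 by omega] at h0

/-- Two full zigzags with `L` and `M` triangles that share an end, and whose chord vertices next to
the other ends are related by adjacency (`b = True`) or not (`b = False`). -/
def Facing (G : SimpleGraph V) (b : Prop) (L M : ℕ) : Prop :=
  3 ≤ L ∧ 3 ≤ M ∧ ∃ f g : ℕ → V, IsFullZigzag G L f ∧ IsFullZigzag G M g ∧ f 0 = g 0 ∧ f 1 ≠ g 1 ∧
    (G.Adj (f L) (g M) ↔ b)

theorem Facing.map {G : SimpleGraph V} {H : SimpleGraph W} (e : G ≃g H) {b : Prop} {L M : ℕ}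
    (h : Facing G b L M) : Facing H b L M := by
  obtain ⟨hL, hM, f, g, hf, hg, h0, h1, h2⟩ := h
  exact ⟨hL, hM, _, _, hf.map e, hg.map e, congrArg e h0, fun h => h1 (e.injective h),
    e.map_adj_iff.trans h2⟩

variable {p q s t N : ℕ}

/-- `P` and `E` are the positions of the ends of one of the three zigzags. -/
def IsSegment (p q N P E : ℕ) : Prop := (P = 0 ∧ E = p) ∨ (P = p ∧ E = q) ∨ (P = q ∧ E = N)

/-- The vertex at the position `i ≤ N`. -/
def wrap (N i : ℕ) : ℕ := if i = N then 0 else i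

/-- A triangle consists of a chord vertex `m` and the vertices before and after it. -/
theorem relE_triangle_middle (h : Params p q s t N) {a b c : ℕ} (ha : a < N) (hb : b < N)
    (hc : c < N) (hab : Linked (relE p q s t N) a b) (hbc : Linked (relE p q s t N) b c)
    (hac : Linked (relE p q s t N) a c) : ∃ m, 1 ≤ m ∧ m < N ∧ m ≠ p ∧ m ≠ q ∧
      (a + 1 = m ∨ a = m ∨ a = wrap N (m + 1)) ∧ (b + 1 = m ∨ b = m ∨ b = wrap N (m + 1)) ∧
      (c + 1 = m ∨ c = m ∨ c = wrap N (m + 1)) ∧ a ≠ b ∧ b ≠ c ∧ a ≠ c := by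
  have hP := h
  unfold Params at hP
  have key : ∀ x y z, x < y → y < z → z < N → Linked (relE p q s t N) x y →
      Linked (relE p q s t N) y z → Linked (relE p q s t N) x z → ∃ m, 1 ≤ m ∧ m < N ∧ m ≠ p ∧
      m ≠ q ∧ (x + 1 = m ∨ x = m ∨ x = wrap N (m + 1)) ∧ (y + 1 = m ∨ y = m ∨ y = wrap N (m + 1)) ∧
      (z + 1 = m ∨ z = m ∨ z = wrap N (m + 1)) := by
    intro x y z hxy hyz hz h1 h2 h3
    rcases relE_exists_middle h hxy hyz hz h1 h2 h3 with h' | h'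
    · refine ⟨y, by omega, by omega, by omega, by omega, ?_⟩
      rw [wrap, if_neg (by omega)]
      omega
    · refine ⟨z, by omega, by omega, by omega, by omega, ?_⟩
      rw [wrap, if_pos (by omega)]
      omega
  have ne : ∀ {x y}, Linked (relE p q s t N) x y → x ≠ y := by
    rintro x y (h | h) <;> omega
  have n1 := ne hab
  have n2 := ne hbc
  have n3 := ne hac
  rcases lt_or_gt_of_ne n1 with l1 | l1 <;> rcases lt_or_gt_of_ne n2 with l2 | l2 <;>
    rcases lt_or_gt_of_ne n3 with l3 | l3
  · obtain ⟨m, e1, e2, e3, e4, ha, hb, hc⟩ := key a b c l1 l2 hc hab hbc hac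
    exact ⟨m, e1, e2, e3, e4, ha, hb, hc, n1, n2, n3⟩
  · omega
  · obtain ⟨m, e1, e2, e3, e4, ha, hc, hb⟩ := key a c b l3 l2 hb hac hbc.symm hab
    exact ⟨m, e1, e2, e3, e4, ha, hb, hc, n1, n2, n3⟩
  · obtain ⟨m, e1, e2, e3, e4, hc, ha, hb⟩ := key c a b l3 l1 hb hac.symm hab hbc.symm
    exact ⟨m, e1, e2, e3, e4, ha, hb, hc, n1, n2, n3⟩
  · obtain ⟨m, e1, e2, e3, e4, hb, ha, hc⟩ := key b a c l1 l3 hc hab.symm hac hbc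
    exact ⟨m, e1, e2, e3, e4, ha, hb, hc, n1, n2, n3⟩
  · obtain ⟨m, e1, e2, e3, e4, hb, hc, ha⟩ := key b c a l2 l3 ha hbc hac.symm hab.symm
    exact ⟨m, e1, e2, e3, e4, ha, hb, hc, n1, n2, n3⟩
  · omega
  · obtain ⟨m, e1, e2, e3, e4, hc, hb, ha⟩ := key c b a l2 l1 ha hbc.symm hab.symm hac.symm
    exact ⟨m, e1, e2, e3, e4, ha, hb, hc, n1, n2, n3⟩

/-- An edge in two triangles joins consecutive vertices inside a zigzag. -/
theorem relE_two_triangles (h : Params p q s t N) {x y u v : ℕ} (hx : x < N) (hy : y < N)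
    (hu : u < N) (hv : v < N) (huv : u ≠ v) (hxy : Linked (relE p q s t N) x y)
    (hux : Linked (relE p q s t N) u x) (huy : Linked (relE p q s t N) u y)
    (hvx : Linked (relE p q s t N) v x) (hvy : Linked (relE p q s t N) v y) :
    ∃ b, 1 ≤ b ∧ b + 2 ≤ N ∧ b ≠ p ∧ b ≠ q ∧ b + 1 ≠ p ∧ b + 1 ≠ q ∧
      ((x = b ∧ y = b + 1) ∨ (y = b ∧ x = b + 1)) ∧
      ((u + 1 = b ∧ v = wrap N (b + 2)) ∨ (v + 1 = b ∧ u = wrap N (b + 2))) := by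
  obtain ⟨m, h1, h2, h3, h4, h5, h6, h7, h8, h9, h10⟩ := relE_triangle_middle h hu hx hy hux hxy huy
  obtain ⟨m', h1', h2', h3', h4', h5', h6', h7', h8', h9', h10'⟩ :=
    relE_triangle_middle h hv hx hy hvx hxy hvy
  unfold Params at h
  rcases lt_trichotomy m m' with hlt | heq | hlt
  · refine ⟨m, h1, ?_⟩
    unfold wrap at *
    grind (splits := 60)
  · subst heq
    unfold wrap at *
    grind (splits := 60)
  · refine ⟨m', h1', ?_⟩
    unfold wrap at *
    grind (splits := 60)

theorem linked_wrap_add_one (h : Params p q s t N) {i : ℕ} :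
    Linked (relE p q s t N) i (wrap N (i + 1)) := by
  unfold Params at h
  unfold wrap
  split_ifs with h'
  · exact Or.inr ⟨by omega, Or.inr (Or.inr (Or.inl ⟨rfl, h'⟩))⟩
  · exact linked_add_one (Or.inl rfl)

theorem linked_wrap_add_two (h : Params p q s t N) {i : ℕ} (hp : i + 1 ≠ p)
    (hq : i + 1 ≠ q) : Linked (relE p q s t N) i (wrap N (i + 2)) := by
  unfold Params at h
  unfold wrap
  split_ifs with h'
  · exact Or.inr ⟨by omega, Or.inr (Or.inr (Or.inr (Or.inl ⟨rfl, h'⟩)))⟩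
  · exact relE_linked_add_two hp hq

theorem wrap_lt {i : ℕ} (hN : 0 < N) (hi : i ≤ N) : wrap N i < N := by
  unfold wrap
  split_ifs <;> omega

/-- A full zigzag that starts in increasing direction is one of the three zigzags of the chain. -/
theorem IsFullZigzag.exists_segment_of_increasing (h : Params p q s t N) {L : ℕ} (hL : 3 ≤ L)
    {f : ℕ → Fin N} (hf : IsFullZigzag (natGraph (relE p q s t N) N) L f)
    (hinc : (f 2).val = (f 1).val + 1) : ∃ P E, IsSegment p q N P E ∧ P + L + 1 = E ∧
      ∀ k ≤ L + 1, (f k).val = wrap N (P + k) := by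
  have hP := h
  unfold Params at hP
  -- the edge from `f (j + 1)` to `f (j + 2)` lies in two triangles
  have hS : ∀ j, j + 2 ≤ L → ∃ b, 1 ≤ b ∧ b + 2 ≤ N ∧ b ≠ p ∧ b ≠ q ∧ b + 1 ≠ p ∧ b + 1 ≠ q ∧
      (((f (j + 1)).val = b ∧ (f (j + 2)).val = b + 1) ∨
        ((f (j + 2)).val = b ∧ (f (j + 1)).val = b + 1)) ∧
      (((f j).val + 1 = b ∧ (f (j + 3)).val = wrap N (b + 2)) ∨
        ((f (j + 3)).val + 1 = b ∧ (f j).val = wrap N (b + 2))) := by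
    intro j hj
    refine relE_two_triangles h (f (j + 1)).2 (f (j + 2)).2 (f j).2 (f (j + 3)).2 ?_
      (hf.adj_add_one (j + 1) (by omega)) (hf.adj_add_one j (by omega))
      (hf.adj_add_two j (by omega)) (hf.adj_add_two (j + 1) (by omega)).symm
      (hf.adj_add_one (j + 2) (by omega)).symm
    intro heq
    have := hf.injOn j (j + 3) (by omega) (by omega) (Fin.ext heq)
    omega
  -- so the zigzag keeps following the chain, and its edges of this kind avoid the ends `p` and `q`
  obtain ⟨P, hC⟩ : ∃ P, ∀ j, j + 2 ≤ L → (f j).val = P + j ∧ (f (j + 1)).val = P + j + 1 ∧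
      (f (j + 2)).val = P + j + 2 ∧ (f (j + 3)).val = wrap N (P + j + 3) ∧ P + j + 3 ≤ N ∧
      P + j + 1 ≠ p ∧ P + j + 1 ≠ q ∧ P + j + 2 ≠ p ∧ P + j + 2 ≠ q := by
    obtain ⟨b, b1, b2, b3, b4, b5, b6, b7, b8⟩ := hS 0 (by omega)
    obtain ⟨c, c1, c2, c3, c4, c5, c6, c7, c8⟩ := hS 1 (by omega)
    simp only [Nat.zero_add, Nat.reduceAdd] at b7 b8 c7 c8
    refine ⟨b - 1, fun j hj => ?_⟩
    induction j with
    | zero =>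
      simp only [Nat.zero_add, Nat.add_zero]
      rw [show b - 1 + 3 = b + 2 by omega]
      omega
    | succ j ih =>
      obtain ⟨i1, i2, i3, i4, i5, i6⟩ := ih (by omega)
      obtain ⟨d, d1, d2, d3, d4, d5, d6, d7, d8⟩ := hS (j + 1) hj
      simp only [show j + 1 + 1 = j + 2 by omega, show j + 1 + 2 = j + 3 by omega,
        show j + 1 + 3 = j + 4 by omega] at d7 d8 ⊢
      have hN : b - 1 + j + 3 ≠ N := by
        intro h'
        rw [wrap, if_pos h'] at i4
        omega
      rw [wrap, if_neg hN] at i4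
      have hd : d = b - 1 + j + 2 := by omega
      subst hd
      have h4 : (f (j + 4)).val = wrap N (b - 1 + (j + 1) + 3) := by
        rcases d8 with d8 | d8
        · rw [d8.2, show b - 1 + j + 2 + 2 = b - 1 + (j + 1) + 3 by omega]
        · have := d8.2
          unfold wrap at this
          split_ifs at this <;> omega
      exact ⟨by omega, by omega, by omega, h4, by omega, by omega, by omega, by omega, by omega⟩
  have hall : ∀ k ≤ L + 1, (f k).val = wrap N (P + k) := by
    intro k hk
    rcases Nat.lt_or_ge k 3 with hk3 | hk3
    · obtain ⟨h0, h1, h2, -, hle, -⟩ := hC 0 (by omega)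
      simp only [Nat.zero_add, Nat.add_zero] at h0 h1 h2
      rw [wrap, if_neg (by omega)]
      obtain rfl | rfl | rfl : k = 0 ∨ k = 1 ∨ k = 2 := by omega
      · exact h0
      · exact h1
      · exact h2
    · obtain ⟨j, rfl⟩ : ∃ j, k = j + 3 := ⟨k - 3, by omega⟩
      exact (hC j (by omega)).2.2.2.1
  obtain ⟨l1, l2, l3, l4, l5, l6⟩ := hC (L - 2) (by omega)
  rw [show P + (L - 2) + 3 = P + L + 1 by omega] at l5
  have hno : ∀ m, P < m → m < P + L + 1 → m ≠ p ∧ m ≠ q := by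
    intro m h1 h2
    rcases Nat.lt_or_ge (m + 2) (P + L + 1) with h3 | h3
    · obtain ⟨-, -, -, -, -, i1, i2, -⟩ := hC (m - P - 1) (by omega)
      omega
    · omega
  -- by maximality, it starts and stops at ends of zigzags of the chain
  have hstart : P = 0 ∨ P = p ∨ P = q := by
    by_contra hcon
    obtain ⟨x, rfl⟩ : ∃ x, P = x + 1 := ⟨P - 1, by omega⟩
    have h0 := hall 0 (by omega)
    have h1 := hall 1 (by omega)
    have h2 := hall 2 (by omega)
    rw [wrap, if_neg (by omega)] at h0 h1 h2
    refine hf.start_maximal ⟨x, by omega⟩ (fun h => ?_) ?_ ?_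
    · have := congrArg Fin.val h
      dsimp at this
      omega
    · rw [natGraph_adj, h0]
      exact linked_add_one (Or.inl rfl)
    · rw [natGraph_adj, h1]
      exact relE_linked_add_two (i := x) (by omega) (by omega)
  have hend : P + L + 1 = p ∨ P + L + 1 = q ∨ P + L + 1 = N := by
    by_contra hcon
    have h0 := hall (L - 1) (by omega)
    have h1 := hall L (by omega)
    have h2 := hall (L + 1) (by omega)
    rw [wrap, if_neg (by omega)] at h0 h1 h2
    have hwrap : wrap N (P + L + 2) ≠ P + (L - 1) := by
      unfold wrap
      split_ifs <;> omega
    refine hf.end_maximal ⟨wrap N (P + L + 2), wrap_lt (by omega) (by omega)⟩ (fun h => ?_) ?_ ?_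
    · have := congrArg Fin.val h
      dsimp at this
      omega
    · rw [natGraph_adj, h1]
      exact (linked_wrap_add_two h (by omega) (by omega)).symm
    · rw [natGraph_adj, h2]
      exact (linked_wrap_add_one h (i := P + L + 1)).symm
  refine ⟨P, P + L + 1, ?_, rfl, hall⟩
  have := hno p
  have := hno q
  unfold IsSegment
  omega

/-- A full zigzag with at least three triangles is one of the three zigzags of the chain, in one of
the two directions. -/
theorem IsFullZigzag.exists_segment (h : Params p q s t N) {L : ℕ} (hL : 3 ≤ L)
    {f : ℕ → Fin N} (hf : IsFullZigzag (natGraph (relE p q s t N) N) L f) :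
    ∃ P E, IsSegment p q N P E ∧ P + L + 1 = E ∧
      (((f 0).val = wrap N P ∧ (f 1).val = P + 1 ∧ (f L).val + 1 = E) ∨
        ((f 0).val = wrap N E ∧ (f 1).val + 1 = E ∧ (f L).val = P + 1)) := by
  have hP := h
  unfold Params at hP
  by_cases hinc : (f 2).val = (f 1).val + 1
  · obtain ⟨P, E, hPE, hE, hall⟩ := hf.exists_segment_of_increasing h hL hinc
    refine ⟨P, E, hPE, hE, Or.inl ⟨hall 0 (by omega), ?_, ?_⟩⟩
    · rw [hall 1 (by omega), wrap, if_neg]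
      unfold IsSegment at hPE
      omega
    · rw [hall L (by omega), wrap, if_neg]
      · omega
      · unfold IsSegment at hPE
        omega
  -- a zigzag in decreasing direction is turned around by the reversal of the chain
  · have hdec : (f 1).val = (f 2).val + 1 := by
      obtain ⟨b, -, -, -, -, -, -, h', -⟩ := relE_two_triangles h (f 1).2 (f 2).2 (f 0).2 (f 3).2
        (fun heq => by
          have := hf.injOn 0 3 (by omega) (by omega) (Fin.ext heq)
          omega)
        (hf.adj_add_one 1 (by omega)) (hf.adj_add_one 0 (by omega))
        (hf.adj_add_two 0 (by omega)) (hf.adj_add_two 1 (by omega)).symm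
        (hf.adj_add_one 2 (by omega)).symm
      omega
    obtain ⟨e, he⟩ := relE_reverse h
    have hP' : Params (N - q) (N - p) (N - t) (N - s) N := by
      unfold Params
      omega
    have hval : ∀ x : Fin N, x.val = wrap N (N - (e x).val) := by
      intro x
      have := x.2
      rw [he x, wrap]
      split_ifs <;> omega
    have h1 := he (f 1)
    have h2 := he (f 2)
    obtain ⟨P, E, hPE, hE, hall⟩ := (hf.map e).exists_segment_of_increasing hP' hL (by
      have := (f 1).2
      change (e (f 2)).val = (e (f 1)).val + 1
      rw [h1, h2]
      have hne : (f 2).val ≠ 0 := by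
        intro h0
        obtain ⟨b, b1, -, -, -, -, -, h', -⟩ := relE_two_triangles h (f 1).2 (f 2).2 (f 0).2
          (f 3).2
          (fun heq => by
            have := hf.injOn 0 3 (by omega) (by omega) (Fin.ext heq)
            omega)
          (hf.adj_add_one 1 (by omega)) (hf.adj_add_one 0 (by omega))
          (hf.adj_add_two 0 (by omega)) (hf.adj_add_two 1 (by omega)).symm
          (hf.adj_add_one 2 (by omega)).symm
        omega
      rw [if_neg hne, if_neg (by omega)]
      omega)
    unfold IsSegment at hPE
    have a0 := hall 0 (by omega)
    have a1 := hall 1 (by omega)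
    have aL := hall L (by omega)
    rw [wrap, if_neg (by omega)] at a0 a1 aL
    have v0 := hval (f 0)
    have v1 := hval (f 1)
    have vL := hval (f L)
    rw [a0] at v0
    rw [a1, wrap, if_neg (by omega)] at v1
    rw [aL, wrap, if_neg (by omega)] at vL
    refine ⟨N - E, N - P, ?_, by omega, Or.inr ⟨v0, by omega, by omega⟩⟩
    unfold IsSegment
    omega

/-- The vertices of a segment, from its first end on. -/
def segmentMap (hN : 0 < N) (P : ℕ) (k : ℕ) : Fin N := ⟨(P + k) % N, Nat.mod_lt _ hN⟩

theorem segmentMap_val (hN : 0 < N) {P k : ℕ} (hk : P + k ≤ N) :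
    (segmentMap hN P k).val = wrap N (P + k) := by
  unfold segmentMap wrap
  split_ifs with h
  · simp [h]
  · exact Nat.mod_eq_of_lt (by omega)

theorem isFullZigzag_segmentMap (h : Params p q s t N) (hN : 0 < N) {P E L : ℕ}
    (hPE : IsSegment p q N P E) (hL : 3 ≤ L) (hE : P + L + 1 = E) :
    IsFullZigzag (natGraph (relE p q s t N) N) L (segmentMap hN P) := by
  have hP := h
  unfold Params at hP
  unfold IsSegment at hPE
  have hv : ∀ k ≤ L, (segmentMap hN P k).val = P + k := by
    intro k hk
    rw [segmentMap_val hN (by omega), wrap, if_neg (by omega)]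
  have hv' : (segmentMap hN P (L + 1)).val = wrap N (P + L + 1) := segmentMap_val hN (by omega)
  refine ⟨?_, ?_, ?_, ?_, ?_⟩
  · intro i j hi hj hij
    have := congrArg Fin.val hij
    rw [segmentMap_val hN (by omega), segmentMap_val hN (by omega)] at this
    unfold wrap at this
    split_ifs at this <;> omega
  · intro i hi
    rw [natGraph_adj, hv i hi, segmentMap_val hN (by omega)]
    exact linked_wrap_add_one h
  · intro i hi
    rw [natGraph_adj, hv i (by omega), segmentMap_val hN (by omega)]
    exact linked_wrap_add_two h (by omega) (by omega)
  · intro x hx h0 h1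
    rw [natGraph_adj, hv 0 (by omega)] at h0
    rw [natGraph_adj, hv 1 (by omega)] at h1
    have hx' : x.val ≠ P + 2 := fun h => hx (Fin.ext (h.trans (hv 2 (by omega)).symm))
    obtain ⟨m, h1, h2, h3, h4, h5, h6, h7, h8, h9, h10⟩ := relE_triangle_middle h x.2 (by omega)
      (by omega) h0 (linked_add_one (Or.inl rfl)) h1
    have := x.2
    unfold wrap at h5 h6 h7
    grind
  · intro x hx h0 h1
    rw [natGraph_adj, hv L (by omega)] at h0
    rw [natGraph_adj, hv'] at h1
    have hx' : x.val ≠ P + (L - 1) := fun h => hx (Fin.ext (h.trans (hv (L - 1) (by omega)).symm))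
    obtain ⟨m, h1, h2, h3, h4, h5, h6, h7, h8, h9, h10⟩ := relE_triangle_middle h x.2 (by omega)
      (wrap_lt hN (by omega)) h0 (linked_wrap_add_one h) h1
    have := x.2
    unfold wrap at h5 h6 h7 h9 h10
    grind

end FullZigzags

/-! ### The number of isomorphism classes -/

section Counting

theorem relE_rotate {p q N : ℕ} (hp : 4 ≤ p) (hpq : p + 4 ≤ q) (hq : q + 4 ≤ N) :
    Nonempty (natGraph (relE p q (q - 1) (p + 1) N) N ≃g
      natGraph (relE (q - p) (N - p) (N - p - 1) (q - p + 1) N) N) := by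
  obtain ⟨e, -⟩ := exists_natGraph_iso (r := relE p q (q - 1) (p + 1) N)
    (r' := relE (q - p) (N - p) (N - p - 1) (q - p + 1) N) (N := N)
    (fun i => if i < p then i + N - p else i - p) (by
      intro i hi; split_ifs <;> omega) (by
      intro i j hi hj; split_ifs <;> omega) (by
      intro i j hi hj
      simp only [Linked, relE]
      split_ifs <;> constructor <;> intro h' <;> grind (splits := 60))
  exact ⟨e⟩

/-- The pairs of facing zigzags. If the middle zigzag is distinguished, only the other two zigzags
have adjacent far chord vertices; otherwise all pairs do. -/
theorem facing_relE {p q s t N : ℕ} (h : Params p q s t N) {b : Prop} {L M : ℕ}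
    (hF : Facing (natGraph (relE p q s t N) N) b L M) :
    ((s = p + 1 ∧ t + 1 = q) → b → (L + 1 = p ∧ M + 1 + q = N) ∨ (M + 1 = p ∧ L + 1 + q = N)) ∧
    ((s + 1 = q ∧ t = p + 1) → b ∧ ((L + 1 = p ∧ M + 1 + q = N) ∨ (M + 1 = p ∧ L + 1 + q = N) ∨
      (L + 1 = p ∧ M + 1 + p = q) ∨ (M + 1 = p ∧ L + 1 + p = q) ∨
      (L + 1 + p = q ∧ M + 1 + q = N) ∨ (M + 1 + p = q ∧ L + 1 + q = N))) := by
  obtain ⟨hL, hM, f, g, hf, hg, h0, h1, hb⟩ := hF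
  obtain ⟨P, E, hPE, hE, hfv⟩ := hf.exists_segment h hL
  obtain ⟨P', E', hPE', hE', hgv⟩ := hg.exists_segment h hM
  rw [← hb, natGraph_adj]
  replace h0 := congrArg Fin.val h0
  replace h1 := fun h' => h1 (Fin.ext h')
  clear hb hf hg
  generalize (f 0).val = f0 at *
  generalize (f 1).val = f1 at *
  generalize (f L).val = fL at *
  generalize (g 0).val = g0 at *
  generalize (g 1).val = g1 at *
  generalize (g M).val = gM at *
  unfold Params at h
  unfold IsSegment at *
  unfold wrap at *
  unfold Linked relE
  rcases hPE with ⟨rfl, rfl⟩ | ⟨rfl, rfl⟩ | ⟨rfl, rfl⟩ <;>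
  rcases hPE' with ⟨rfl, rfl⟩ | ⟨rfl, rfl⟩ | ⟨rfl, rfl⟩ <;>
  rcases hfv with ⟨a1, a2, a3⟩ | ⟨a1, a2, a3⟩ <;>
  rcases hgv with ⟨b1, b2, b3⟩ | ⟨b1, b2, b3⟩ <;>
  split_ifs at a1 b1 <;>
  first
  | (exfalso; omega)
  | grind (splits := 60)

/-- The first and the last zigzag share the end `0`, and `p - 1` is adjacent to `q + 1`. -/
theorem facing_relE_outer {p q s t N : ℕ} (h : Params p q s t N) :
    Facing (natGraph (relE p q s t N) N) True (p - 1) (N - q - 1) := by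
  have hP := h
  unfold Params at hP
  have hN : 0 < N := by omega
  have hf := isFullZigzag_segmentMap h hN (P := 0) (E := p) (L := p - 1) (by simp [IsSegment])
    (by omega) (by omega)
  have hg := (isFullZigzag_segmentMap h hN (P := q) (E := N) (L := N - q - 1) (by simp [IsSegment])
    (by omega) (by omega)).reverse (by omega)
  refine ⟨by omega, by omega, _, _, hf, hg, Fin.ext ?_, fun h' => ?_, ?_⟩
  · rw [segmentMap_val hN (by omega), segmentMap_val hN (by omega)]
    unfold wrap
    split_ifs <;> omega
  · have := congrArg Fin.val h'
    rw [segmentMap_val hN (by omega), segmentMap_val hN (by omega)] at this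
    unfold wrap at this
    split_ifs at this <;> omega
  · rw [natGraph_adj, segmentMap_val hN (by omega), segmentMap_val hN (by omega), iff_true,
      wrap, wrap, if_neg (by omega), if_neg (by omega), linked_of_lt (by omega)]
    unfold relE
    omega

/-- The first and the middle zigzag share the end `p`, and `1` is adjacent to `s`, which is the far
chord vertex `q - 1` of the middle zigzag unless that one is distinguished. -/
theorem facing_relE_middle {p q s t N : ℕ} (h : Params p q s t N) (hpq : p + 4 ≤ q) :
    Facing (natGraph (relE p q s t N) N) (s + 1 = q) (p - 1) (q - p - 1) := by
  have hP := h
  unfold Params at hP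
  have hN : 0 < N := by omega
  have hf := (isFullZigzag_segmentMap h hN (P := 0) (E := p) (L := p - 1) (by simp [IsSegment])
    (by omega) (by omega)).reverse (by omega)
  have hg := isFullZigzag_segmentMap h hN (P := p) (E := q) (L := q - p - 1) (by simp [IsSegment])
    (by omega) (by omega)
  refine ⟨by omega, by omega, _, _, hf, hg, Fin.ext ?_, fun h' => ?_, ?_⟩
  · rw [segmentMap_val hN (by omega), segmentMap_val hN (by omega)]
    unfold wrap
    split_ifs <;> omega
  · have := congrArg Fin.val h'
    rw [segmentMap_val hN (by omega), segmentMap_val hN (by omega)] at this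
    unfold wrap at this
    split_ifs at this <;> omega
  · rw [natGraph_adj, segmentMap_val hN (by omega), segmentMap_val hN (by omega),
      wrap, wrap, if_neg (by omega), if_neg (by omega), linked_of_lt (by omega)]
    unfold relE
    omega

/-- The graph of `templateA` whose zigzags have `x`, `n - 3 - x - y`, `y` triangles; the middle one
is the distinguished one. -/
def formA (n : ℕ) (z : ℕ × ℕ) : SimpleGraph (Fin n) :=
  natGraph (relE (z.1 + 1) (n - z.2 - 1) (z.1 + 2) (n - z.2 - 2) n) n

/-- The graph of `templateB` whose zigzags have `x`, `n - 3 - x - y`, `y` triangles. -/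
def formB (n : ℕ) (z : ℕ × ℕ) : SimpleGraph (Fin n) :=
  natGraph (relE (z.1 + 1) (n - z.2 - 1) (n - z.2 - 2) (z.1 + 2) n) n

/-- The representatives of the isomorphism classes of the graphs `formA n`, up to `formA_swap`. -/
def pairsA (n : ℕ) : Finset (ℕ × ℕ) :=
  (Finset.range n ×ˢ Finset.range n).filter fun z => 3 ≤ z.1 ∧ z.1 ≤ z.2 ∧ z.1 + z.2 + 3 ≤ n

/-- The representatives of the isomorphism classes of the graphs `formB n`: the middle zigzag, with
`n - 3 - x - y` triangles, is a largest one. -/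
def pairsB (n : ℕ) : Finset (ℕ × ℕ) :=
  (Finset.range n ×ˢ Finset.range n).filter fun z => 3 ≤ z.1 ∧ z.1 ≤ z.2 ∧ z.1 + 2 * z.2 + 3 ≤ n

theorem mem_pairsA {n x y : ℕ} : (x, y) ∈ pairsA n ↔ 3 ≤ x ∧ x ≤ y ∧ x + y + 3 ≤ n := by
  simp only [pairsA, Finset.mem_filter, Finset.mem_product, Finset.mem_range]
  omega

theorem mem_pairsB {n x y : ℕ} : (x, y) ∈ pairsB n ↔ 3 ≤ x ∧ x ≤ y ∧ x + 2 * y + 3 ≤ n := by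
  simp only [pairsB, Finset.mem_filter, Finset.mem_product, Finset.mem_range]
  omega

theorem params_formA {n x y : ℕ} (hx : 3 ≤ x) (hy : 3 ≤ y) (hn : x + y + 3 ≤ n) :
    Params (x + 1) (n - y - 1) (x + 2) (n - y - 2) n := by
  unfold Params
  omega

theorem params_formB {n x y : ℕ} (hx : 3 ≤ x) (hy : 3 ≤ y) (hn : x + y + 6 ≤ n) :
    Params (x + 1) (n - y - 1) (n - y - 2) (x + 2) n := by
  unfold Params
  omega

theorem formA_swap {n x y : ℕ} (hx : 3 ≤ x) (hy : 3 ≤ y) (hn : x + y + 3 ≤ n) :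
    Nonempty (formA n (x, y) ≃g formA n (y, x)) := by
  obtain ⟨e, -⟩ := relE_reverse (params_formA hx hy hn)
  rw [show n - (n - y - 1) = y + 1 by omega, show n - (x + 1) = n - x - 1 by omega,
    show n - (n - y - 2) = y + 2 by omega, show n - (x + 2) = n - x - 2 by omega] at e
  exact ⟨e⟩

theorem formB_swap {n x y : ℕ} (hx : 3 ≤ x) (hy : 3 ≤ y) (hn : x + y + 6 ≤ n) :
    Nonempty (formB n (x, y) ≃g formB n (y, x)) := by
  obtain ⟨e, -⟩ := relE_reverse (params_formB hx hy hn)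
  rw [show n - (n - y - 1) = y + 1 by omega, show n - (x + 1) = n - x - 1 by omega,
    show n - (n - y - 2) = y + 2 by omega, show n - (x + 2) = n - x - 2 by omega] at e
  exact ⟨e⟩

theorem formB_rotate {x y z : ℕ} (hx : 3 ≤ x) (hy : 3 ≤ y) (hz : 3 ≤ z) :
    Nonempty (formB (x + y + z + 3) (x, z) ≃g formB (x + y + z + 3) (y, x)) := by
  obtain ⟨e⟩ := relE_rotate (p := x + 1) (q := x + y + 2) (N := x + y + z + 3) (by omega)
    (by omega) (by omega)
  unfold formB
  dsimp only
  rw [show x + y + 2 - (x + 1) = y + 1 by omega,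
    show x + y + z + 3 - (x + 1) = x + y + z + 3 - x - 1 by omega] at e
  rw [show x + y + z + 3 - z - 1 = x + y + 2 by omega,
    show x + y + z + 3 - z - 2 = x + y + 2 - 1 by omega]
  exact ⟨e⟩

/-- The zigzags of `formB` may be permuted, so that the largest one comes in the middle and the
other two are sorted. -/
theorem exists_mem_pairsB {x y z : ℕ} (hx : 3 ≤ x) (hy : 3 ≤ y) (hz : 3 ≤ z) :
    ∃ c ∈ pairsB (x + y + z + 3),
      Nonempty (formB (x + y + z + 3) (x, z) ≃g formB (x + y + z + 3) c) := by
  have key : ∀ x y z, 3 ≤ x → 3 ≤ y → 3 ≤ z → x ≤ y → z ≤ y → ∃ c ∈ pairsB (x + y + z + 3),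
      Nonempty (formB (x + y + z + 3) (x, z) ≃g formB (x + y + z + 3) c) := by
    intro x y z hx hy hz h1 h2
    rcases le_total x z with h | h
    · exact ⟨(x, z), mem_pairsB.2 ⟨hx, h, by omega⟩, ⟨SimpleGraph.Iso.refl⟩⟩
    · exact ⟨(z, x), mem_pairsB.2 ⟨hz, h, by omega⟩, formB_swap hx hz (by omega)⟩
  obtain ⟨e₁⟩ := formB_rotate hx hy hz
  by_cases h1 : x ≤ y ∧ z ≤ y
  · exact key x y z hx hy hz h1.1 h1.2
  by_cases h2 : y ≤ z ∧ x ≤ z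
  · obtain ⟨c, hc, ⟨e⟩⟩ := key y z x hy hz hx h2.1 h2.2
    rw [show y + z + x + 3 = x + y + z + 3 by omega] at hc e
    exact ⟨c, hc, ⟨e₁.trans e⟩⟩
  · obtain ⟨e₂⟩ := formB_rotate hy hz hx
    obtain ⟨c, hc, ⟨e⟩⟩ := key z x y hz hx hy (by omega) (by omega)
    rw [show y + z + x + 3 = x + y + z + 3 by omega] at e₂
    rw [show z + x + y + 3 = x + y + z + 3 by omega] at hc e
    exact ⟨c, hc, ⟨(e₁.trans e₂).trans e⟩⟩

theorem isTemplate_iff_formA_or_formB {n : ℕ} {G : SimpleGraph (Fin n)} : IsTemplate G ↔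
    (∃ z ∈ pairsA n, Nonempty (G ≃g formA n z)) ∨ ∃ z ∈ pairsB n, Nonempty (G ≃g formB n z) := by
  constructor
  · rintro ⟨p, q, s, t, N, h, ⟨e⟩⟩
    obtain rfl : n = N := by simpa using Fintype.card_congr e.toEquiv
    have hP := h
    unfold Params at hP
    obtain ⟨h1, h2, h3, ⟨rfl, h5⟩ | ⟨h4, rfl, h5⟩⟩ := hP
    · left
      obtain rfl : t = q - 1 := by omega
      have e' : G ≃g formA n (p - 1, n - q - 1) := by
        unfold formA
        dsimp only
        rwa [show p - 1 + 1 = p by omega, show n - (n - q - 1) - 1 = q by omega,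
          show p - 1 + 2 = p + 1 by omega, show n - (n - q - 1) - 2 = q - 1 by omega]
      rcases le_total (p - 1) (n - q - 1) with hle | hle
      · exact ⟨_, mem_pairsA.2 ⟨by omega, hle, by omega⟩, ⟨e'⟩⟩
      · obtain ⟨e''⟩ := formA_swap (n := n) (x := p - 1) (y := n - q - 1) (by omega) (by omega)
          (by omega)
        exact ⟨_, mem_pairsA.2 ⟨by omega, hle, by omega⟩, ⟨e'.trans e''⟩⟩
    · right
      obtain rfl : s = q - 1 := by omega
      have e' : G ≃g formB n (p - 1, n - q - 1) := by
        unfold formB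
        dsimp only
        rwa [show p - 1 + 1 = p by omega, show n - (n - q - 1) - 1 = q by omega,
          show p - 1 + 2 = p + 1 by omega, show n - (n - q - 1) - 2 = q - 1 by omega]
      obtain ⟨c, hc, ⟨e''⟩⟩ := exists_mem_pairsB (x := p - 1) (y := q - p - 1) (z := n - q - 1)
        (by omega) (by omega) (by omega)
      rw [show p - 1 + (q - p - 1) + (n - q - 1) + 3 = n by omega] at hc e''
      exact ⟨c, hc, ⟨e'.trans e''⟩⟩
  · rintro (⟨⟨x, y⟩, hz, he⟩ | ⟨⟨x, y⟩, hz, he⟩)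
    · rw [mem_pairsA] at hz
      exact ⟨_, _, _, _, _, params_formA (by omega) (by omega) (by omega), he⟩
    · rw [mem_pairsB] at hz
      exact ⟨_, _, _, _, _, params_formB (by omega) (by omega) (by omega), he⟩

theorem facing_formA {n x y : ℕ} (hx : 3 ≤ x) (hy : 3 ≤ y) (hn : x + y + 3 ≤ n) :
    Facing (formA n (x, y)) True x y := by
  have := facing_relE_outer (params_formA hx hy hn)
  rwa [show x + 1 - 1 = x by omega, show n - (n - y - 1) - 1 = y by omega] at this

theorem facing_formB {n x y : ℕ} (hx : 3 ≤ x) (hy : 3 ≤ y) (hn : x + y + 6 ≤ n) :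
    Facing (formB n (x, y)) True x y := by
  have := facing_relE_outer (params_formB hx hy hn)
  rwa [show x + 1 - 1 = x by omega, show n - (n - y - 1) - 1 = y by omega] at this

theorem facing_formB_middle {n x y : ℕ} (hx : 3 ≤ x) (hy : 3 ≤ y) (hn : x + y + 6 ≤ n) :
    Facing (formB n (x, y)) True x (n - 3 - x - y) := by
  have := facing_relE_middle (params_formB hx hy hn) (by omega)
  rwa [show x + 1 - 1 = x by omega, show n - y - 1 - (x + 1) - 1 = n - 3 - x - y by omega,
    eq_true (show n - y - 2 + 1 = n - y - 1 by omega)] at this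

/-- The numbers of triangles of the two facing zigzags are determined by the graph. -/
theorem formA_injective {n : ℕ} {c d : ℕ × ℕ} (hc : c ∈ pairsA n) (hd : d ∈ pairsA n)
    (e : formA n c ≃g formA n d) : c = d := by
  obtain ⟨x, y⟩ := c
  obtain ⟨x', y'⟩ := d
  rw [mem_pairsA] at hc hd
  have h := (facing_relE (params_formA (by omega) (by omega) (by omega))
    ((facing_formA (by omega) (by omega) (by omega)).map e)).1 (by omega) trivial
  rw [Prod.mk.injEq]
  omega

theorem formB_injective {n : ℕ} {c d : ℕ × ℕ} (hc : c ∈ pairsB n) (hd : d ∈ pairsB n)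
    (e : formB n c ≃g formB n d) : c = d := by
  obtain ⟨x, y⟩ := c
  obtain ⟨x', y'⟩ := d
  rw [mem_pairsB] at hc hd
  have h := ((facing_relE (params_formB (by omega) (by omega) (by omega))
    ((facing_formB (by omega) (by omega) (by omega)).map e)).2 (by omega)).2
  have h' := ((facing_relE (params_formB (by omega) (by omega) (by omega))
    ((facing_formB (by omega) (by omega) (by omega)).map e.symm)).2 (by omega)).2
  rw [Prod.mk.injEq]
  omega

/-- If the graphs are isomorphic, two facing pairs of `formB` have the same sizes as the facing pair
of `formA`. So the distinguished zigzag of `formA` has as many triangles as some zigzag of `formB`,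
at least three. But then it faces another zigzag, with far chord vertices that are not adjacent. -/
theorem formA_not_iso_formB {n : ℕ} {c d : ℕ × ℕ} (hc : c ∈ pairsA n) (hd : d ∈ pairsB n)
    (e : formA n c ≃g formB n d) : False := by
  obtain ⟨x, y⟩ := c
  obtain ⟨x', y'⟩ := d
  rw [mem_pairsA] at hc
  rw [mem_pairsB] at hd
  have hA := params_formA (n := n) (x := x) (y := y) (by omega) (by omega) (by omega)
  have h1 := (facing_relE hA ((facing_formB (by omega) (by omega) (by omega)).map e.symm)).1
    (by omega) trivial
  have h2 := (facing_relE hA ((facing_formB_middle (by omega) (by omega) (by omega)).map e.symm)).1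
    (by omega) trivial
  have h3 := ((facing_relE (params_formB (by omega) (by omega) (by omega))
    ((facing_relE_middle hA (by omega)).map e)).2 (by omega)).1
  omega

/-- Each class has exactly one representative among the graphs `formA` and `formB`. -/
theorem numDescendants_three_eq (n : ℕ) (h : ∀ G : SimpleGraph (Fin n),
    IsK5Descendant G ∧ level G = 3 ↔ IsTemplate G) :
    numDescendants 3 n = (pairsA n).card + (pairsB n).card := by
  have himage : Quotient.mk (isoSetoid (Fin n)) '' {G | IsK5Descendant G ∧ level G = 3} =
      (fun z => Quotient.mk (isoSetoid (Fin n)) (formA n z)) '' (pairsA n) ∪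
        (fun z => Quotient.mk (isoSetoid (Fin n)) (formB n z)) '' (pairsB n) := by
    ext c
    obtain ⟨G, rfl⟩ := Quotient.exists_rep c
    simp only [Set.mem_image, Set.mem_ofPred_eq, Set.mem_union, h, Finset.mem_coe]
    constructor
    · rintro ⟨H, hH, hHG⟩
      have hGH : IsTemplate G := hH.of_iso (Quotient.exact hHG).some.symm
      rcases isTemplate_iff_formA_or_formB.1 hGH with ⟨z, hz, ⟨e⟩⟩ | ⟨z, hz, ⟨e⟩⟩
      · exact Or.inl ⟨z, hz, Quotient.sound ⟨e.symm⟩⟩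
      · exact Or.inr ⟨z, hz, Quotient.sound ⟨e.symm⟩⟩
    · rintro (⟨z, hz, he⟩ | ⟨z, hz, he⟩)
      · obtain ⟨e⟩ := Quotient.exact he
        exact ⟨G, isTemplate_iff_formA_or_formB.2 (Or.inl ⟨z, hz, ⟨e.symm⟩⟩), rfl⟩
      · obtain ⟨e⟩ := Quotient.exact he
        exact ⟨G, isTemplate_iff_formA_or_formB.2 (Or.inr ⟨z, hz, ⟨e.symm⟩⟩), rfl⟩
  unfold numDescendants
  rw [himage, Set.ncard_union_eq ?_ ((Finset.finite_toSet _).image _)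
    ((Finset.finite_toSet _).image _), Set.InjOn.ncard_image, Set.InjOn.ncard_image,
    Set.ncard_coe_finset, Set.ncard_coe_finset]
  · intro c hc d hd hcd
    obtain ⟨e⟩ := Quotient.exact hcd
    exact formB_injective hc hd e
  · intro c hc d hd hcd
    obtain ⟨e⟩ := Quotient.exact hcd
    exact formA_injective hc hd e
  · rw [Set.disjoint_left]
    rintro _ ⟨c, hc, rfl⟩ ⟨d, hd, hcd⟩
    obtain ⟨e⟩ := Quotient.exact hcd
    exact formA_not_iso_formB hc hd e.symm

/-- The new pairs are those with `x + y + 3 = n + 1`; for small `n` the truncated subtraction gives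
zero. -/
theorem card_pairsA_succ (n : ℕ) :
    (pairsA (n + 1)).card = (pairsA n).card + ((n + 1 - 3) / 2 - 2) := by
  have h : pairsA (n + 1) = pairsA n ∪
      (Finset.Icc 3 ((n - 2) / 2)).image (fun x => (x, n - 2 - x)) := by
    ext ⟨x, y⟩
    simp only [Finset.mem_union, Finset.mem_image, Finset.mem_Icc, mem_pairsA, Prod.mk.injEq]
    constructor
    · intro h
      by_cases h' : x + y + 3 ≤ n
      · exact Or.inl (by omega)
      · exact Or.inr ⟨x, by omega, rfl, by omega⟩
    · rintro (h | ⟨x', h1, rfl, h2⟩) <;> omega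
  rw [h, Finset.card_union_of_disjoint, Finset.card_image_of_injective, Nat.card_Icc]
  · omega
  · intro x y hxy
    exact (Prod.mk.inj hxy).1
  · rw [Finset.disjoint_left]
    rintro ⟨x, y⟩ hxy
    simp only [Finset.mem_image, Finset.mem_Icc, Prod.mk.injEq, not_exists, not_and]
    rw [mem_pairsA] at hxy
    omega

/-- The pairs with `x > 3` come from the pairs for `n` by adding a triangle to every zigzag. -/
theorem card_pairsB_add_three (n : ℕ) :
    (pairsB (n + 3)).card = (pairsB n).card + ((n - 3) / 2 - 2) := by
  have h : pairsB (n + 3) = (pairsB n).image (fun z => (z.1 + 1, z.2 + 1)) ∪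
      (Finset.Icc 3 ((n - 3) / 2)).image (fun y => (3, y)) := by
    ext ⟨x, y⟩
    simp only [Finset.mem_union, Finset.mem_image, Finset.mem_Icc, mem_pairsB, Prod.mk.injEq,
      Prod.exists]
    constructor
    · intro h
      by_cases h' : x = 3
      · exact Or.inr ⟨y, by omega, h'.symm, rfl⟩
      · exact Or.inl ⟨x - 1, y - 1, by omega, by omega, by omega⟩
    · rintro (⟨x', y', h, rfl, rfl⟩ | ⟨y', h, rfl, rfl⟩) <;> omega
  rw [h, Finset.card_union_of_disjoint, Finset.card_image_of_injective,
    Finset.card_image_of_injective, Nat.card_Icc]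
  · omega
  · intro x y hxy
    exact (Prod.mk.inj hxy).2
  · rintro ⟨x, y⟩ ⟨x', y'⟩ hxy
    simpa using hxy
  · rw [Finset.disjoint_left]
    rintro ⟨x, y⟩ hxy
    simp only [Finset.mem_image, Prod.mk.injEq, Prod.exists, mem_pairsB] at hxy
    simp only [Finset.mem_image, Finset.mem_Icc, Prod.mk.injEq, not_exists, not_and]
    obtain ⟨x', y', h1, h2, h3⟩ := hxy
    omega

theorem card_pairsA_zero : (pairsA 0).card = 0 := rfl

theorem card_pairsB_of_lt {n : ℕ} (hn : n < 3) : (pairsB n).card = 0 := by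
  rw [Finset.card_eq_zero, Finset.eq_empty_iff_forall_notMem]
  rintro ⟨x, y⟩ h
  rw [mem_pairsB] at h
  omega

/-! ### The generating function -/

open PowerSeries in
/-- The generating function of the number of pairs `3 ≤ x ≤ y` with `x + y + 3 = n`. -/
theorem mk_half_mul_eq_X_pow :
    (PowerSeries.mk fun n => (((n - 3) / 2 - 2 : ℕ) : ℚ)) * (1 - X ^ 2) * (1 - X) = X ^ 9 := by
  have h1 : (PowerSeries.mk fun n => (((n - 3) / 2 - 2 : ℕ) : ℚ)) * (1 - X ^ 2) =
      PowerSeries.mk fun n => if 9 ≤ n then 1 else 0 := by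
    ext n
    simp only [mul_sub, mul_one, map_sub, coeff_mul_X_pow', coeff_mk]
    rcases Nat.lt_or_ge n 9 with h | h
    · rw [if_neg (show ¬ 9 ≤ n by omega), show (n - 3) / 2 - 2 = (n - 2 - 3) / 2 - 2 by omega]
      split_ifs
      · exact sub_self _
      · rw [show (n - 2 - 3) / 2 - 2 = 0 by omega, Nat.cast_zero, sub_zero]
    · rw [if_pos (show 2 ≤ n by omega), if_pos h,
        show (n - 3) / 2 - 2 = (n - 2 - 3) / 2 - 2 + 1 by omega,
        Nat.cast_add, Nat.cast_one, add_sub_cancel_left]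
  rw [h1]
  ext n
  rcases n with _ | n
  · simp [mul_sub, coeff_X_pow]
  · simp only [mul_sub, mul_one, map_sub, coeff_succ_mul_X, coeff_mk, coeff_X_pow]
    rcases lt_trichotomy n 8 with h | h | h
    · simp [show ¬ 9 ≤ n + 1 by omega, show ¬ 9 ≤ n by omega, show n ≠ 8 by omega]
    · simp [h]
    · simp [show 9 ≤ n + 1 by omega, show 9 ≤ n by omega, show n ≠ 8 by omega]

open PowerSeries in
theorem mk_add_eq_of_recurrence {a b : ℕ → ℕ} (ha0 : a 0 = 0)
    (ha : ∀ n, a (n + 1) = a n + ((n + 1 - 3) / 2 - 2))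
    (hb0 : ∀ n < 3, b n = 0) (hb : ∀ n, b (n + 3) = b n + ((n - 3) / 2 - 2)) :
    (PowerSeries.mk fun n => ((a n + b n : ℕ) : ℚ)) =
      X ^ 9 * (1 + X ^ 2) * ((1 - X) ^ 3 * (1 + X + X ^ 2))⁻¹ := by
  set c : ℚ⟦X⟧ := PowerSeries.mk fun n => (((n - 3) / 2 - 2 : ℕ) : ℚ) with hc
  have h1 : (PowerSeries.mk fun n => (a n : ℚ)) * (1 - X) = c := by
    ext n
    rcases n with _ | n
    · simp [hc, ha0, mul_sub]
    · rw [mul_sub, mul_one, map_sub, coeff_succ_mul_X, hc, coeff_mk, coeff_mk, coeff_mk, ha]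
      push_cast
      ring
  have h2 : (PowerSeries.mk fun n => (b n : ℚ)) * (1 - X ^ 3) = X ^ 3 * c := by
    ext n
    rw [mul_sub, mul_one, map_sub, coeff_mul_X_pow', coeff_X_pow_mul', hc]
    split_ifs with h
    · obtain ⟨m, rfl⟩ := Nat.exists_eq_add_of_le' h
      rw [coeff_mk, coeff_mk, coeff_mk, hb, Nat.add_sub_cancel]
      push_cast
      ring
    · rw [coeff_mk, hb0 n (by omega)]
      simp
  have h3 : (PowerSeries.mk fun n => ((a n + b n : ℕ) : ℚ)) =
      (PowerSeries.mk fun n => (a n : ℚ)) + (PowerSeries.mk fun n => (b n : ℚ)) := by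
    ext n
    simp
  have h4 : c * (1 - X ^ 2) * (1 - X) = X ^ 9 := mk_half_mul_eq_X_pow
  rw [PowerSeries.eq_mul_inv_iff_mul_eq (by simp), h3]
  linear_combination (1 - X) ^ 2 * (1 + X + X ^ 2) * h1 + (1 - X) ^ 2 * h2 + (1 + X ^ 2) * h4

end Counting

end DoubleTriangle

theorem mainTheorem3 :
    (∀ (V : Type u) (G : SimpleGraph V),
      DoubleTriangle.IsK5Descendant G ∧ DoubleTriangle.level G = 3 ↔
        ∃ z : Fin 3 → ℕ,
          (3 ≤ z 0 ∧ 3 ≤ z 1 ∧ Nonempty (G ≃g DoubleTriangle.templateA z)) ∨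
          (3 ≤ z 0 ∧ 3 ≤ z 1 ∧ 3 ≤ z 2 ∧ Nonempty (G ≃g DoubleTriangle.templateB z))) ∧
    (PowerSeries.mk fun n => (DoubleTriangle.numDescendants 3 n : ℚ)) =
      PowerSeries.X ^ 9 * (1 + PowerSeries.X ^ 2) *
        ((1 - PowerSeries.X) ^ 3 * (1 + PowerSeries.X + PowerSeries.X ^ 2))⁻¹ := by
  refine ⟨fun V G => DoubleTriangle.isK5Descendant_and_level_eq_three_iff.trans
    DoubleTriangle.isTemplate_iff, ?_⟩
  rw [← DoubleTriangle.mk_add_eq_of_recurrence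
    (a := fun n => (DoubleTriangle.pairsA n).card)
    (b := fun n => (DoubleTriangle.pairsB n).card) DoubleTriangle.card_pairsA_zero
    DoubleTriangle.card_pairsA_succ (fun n hn => DoubleTriangle.card_pairsB_of_lt hn)
    DoubleTriangle.card_pairsB_add_three]
  ext n
  rw [PowerSeries.coeff_mk, PowerSeries.coeff_mk, DoubleTriangle.numDescendants_three_eq n
    fun G => DoubleTriangle.isK5Descendant_and_level_eq_three_iff]
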